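/- Let $\mathbf S^2=\{x\in\mathbf R^3:|x|=1\}$ with surface measure $\lambda$, let $\triangle$ be its Laplace–Beltrami operator, $Y_{lm}$ ($l\ge 0$, $|m|\le l$) the spherical harmonics and $\mu_l=l(l+1)$, so that $\triangle Y_{lm}=-\mu_lY_{lm}$. Let $P_s=e^{s\triangle}$, $s\geq 0$, be the heat semigroup on $L^2(\mathbf S^2)$ and, for $\alpha\in(0,1)$, define $(-\triangle)^\alpha$ by Bochner subordination, $$-(-\triangle)^\alpha f=\frac{\alpha}{\Gamma(1-\alpha)}\int_0^\infty\big(P_sf-f\big)\frac{ds}{s^{\alpha+1}}\qquad\text{in }L^2(\mathbf S^2),$$ the integral being the limit of $\int_\varepsilon^\infty$ as $\varepsilon\downarrow0$, and the domain being the set of $f$ for which the limit exists. Let $T=\{T(x):x\in\mathbf S^2\}$ be a real, measurable, zero-mean, isotropic (its law is invariant under $SO(3)$) Gaussian random field on a probability space $(\Omega,\mathfrak F,\mathbb P)$. Write $\mathfrak F_T$ for the $\sigma$-field generated by $T$, and $$a_{lm}=\int_{\mathbf S^2}T(x)\,Y_{lm}^*(x)\,\lambda(dx),\qquad T_l(x)=\sum_{|m|\le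 l}a_{lm}Y_{lm}(x).$$ For $x\in\mathbf S^2$ let $B^x$ be the rotational Brownian motion on $\mathbf S^2$ (the diffusion with generator $\triangle$) started from $x$, and let $D$ be a stable subordinator with Laplace exponent $\Psi(\mu)=\mu^\alpha$, that is $\mathbb E\,e^{-\mu D_t}=e^{-t\mu^\alpha}$. Suppose that for each $x$ the objects $T$, $B^x$, $D$ are independent. Put $$\mathfrak T^\Psi_t(x)=T\big(B^x_{D_t}\big),\qquad \mathbb P_tf(x)=\mathbb E\,f\big(B^x_{D_t}\big).$$ Then, for $\alpha\in(0,1)$, there is a measurable random field $\eta_t(x)$, $t\ge0$, $x\in\mathbf S^2$, with $\eta_0=T$, such that almost surely $t\mapsto\eta_t$ is continuous from $[0,\infty)$ to $L^2(\mathbf S^2)$ and solves $$\big(\partial_t+(-\triangle)^\alpha\big)\eta_t=0\quad(t>0),\qquad \eta_0=T,$$ with the derivative taken in $L^2(\mathbf S^2)$ and $\eta_t$ in the domain of $(-\triangle)^\alpha$ for each $t>0$. The solution is unique: if $\zeta$ is another family that almost surely solves the problem in this sense, then almost surely $\zeta_t=\eta_t$ $\lambda$-a.e. for all $t\ge0$.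 Moreover $\eta$ is a Gaussian random field; $$\eta_t(x)=\sum_{l=0}^\infty e^{-t\mu_l^\alpha}\sum_{|m|\le l}a_{lm}Y_{lm}(x)=\sum_{l=0}^\infty e^{-t\mu_l^\alpha}\,T_l(x)$$ in the sense that for every $t\ge0$ $$\lim_{L\to\infty}\mathbb E\int_{\mathbf S^2}\Big|\eta_t(x)-\sum_{l=0}^Le^{-t\mu_l^\alpha}T_l(x)\Big|^2\lambda(dx)=0;$$ and for all $t\ge0$ and $x\in\mathbf S^2$, almost surely, $$\eta_t(x)=\mathbb P_tT(x)=\mathbb E\big[\mathfrak T^\Psi_t(x)\,\big|\,\mathfrak F_T\big],$$ where $\mathbb P_t$ acts on the realization $y\mapsto T(y)$, and both expectations are absolutely convergent. -/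

import Mathlib

open MeasureTheory ProbabilityTheory Filter Topology
open scoped NNReal ENNReal

noncomputable section

/-! ### The unit sphere, its surface measure and spherical harmonics -/

/-- Euclidean three-space. -/
abbrev E3 : Type := EuclideanSpace ℝ (Fin 3)

/-- The unit sphere of `ℝ³`. -/
abbrev S2 : Type := Metric.sphere (0 : E3) 1

/-- The surface (Lebesgue) measure on the unit sphere, of total mass `4π`. -/
def sphMeasure : Measure S2 := (volume : Measure E3).toSphere

/-- The real Hilbert space `L²(S², λ)`. -/
abbrev L2S : Type := Lp ℝ 2 sphMeasure

/-- `μ_l = l (l + 1)`. -/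
def sphEigenvalue (l : ℕ) : ℝ := l * (l + 1)

/-- The Legendre polynomial `Q_l`, by Rodrigues' formula. -/
def legendreQ (l : ℕ) : Polynomial ℝ :=
  Polynomial.C (1 / (2 ^ l * (l.factorial : ℝ))) *
    Polynomial.derivative^[l] ((Polynomial.X ^ 2 - 1) ^ l)

/-- The spherical harmonic `Y_{lm}` for `m ≥ 0`:
`√((2l+1)/(4π) (l-m)!/(l+m)!) Q_{lm}(cos ϑ) e^{imφ}`, where
`Q_{lm}(z) = (-1)^m (1-z²)^{m/2} (d/dz)^m Q_l(z)`. At the point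
`x = (sin ϑ cos φ, sin ϑ sin φ, cos ϑ)` of the sphere one has
`(1 - cos² ϑ)^{m/2} e^{imφ} = (x₀ + i x₁)^m`. -/
def sphHarmonicNat (l m : ℕ) (x : S2) : ℂ :=
  (Real.sqrt ((2 * l + 1) / (4 * Real.pi) * ((l - m).factorial / (l + m).factorial)) : ℂ) *
    ((-1) ^ m * ((Polynomial.derivative^[m] (legendreQ l)).eval (x.1 2) : ℝ) *
      ((x.1 0 : ℂ) + (x.1 1 : ℂ) * Complex.I) ^ m)

/-- The spherical harmonics `Y_{lm}`, `|m| ≤ l`, with `Y_{l,-m} = (-1)^m Y_{lm}^*`. -/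
def sphHarmonic (l : ℕ) (m : ℤ) (x : S2) : ℂ :=
  if 0 ≤ m then sphHarmonicNat l m.natAbs x
  else (-1) ^ m.natAbs * (starRingEnd ℂ) (sphHarmonicNat l m.natAbs x)

/-- The Fourier coefficient `f_{lm} = ∫ f Y_{lm}^* dλ`. -/
def sphCoeff (f : S2 → ℝ) (l : ℕ) (m : ℤ) : ℂ :=
  ∫ x, (f x : ℂ) * (starRingEnd ℂ) (sphHarmonic l m x) ∂sphMeasure

/-- The `l`-th frequency component `f_l = ∑_{|m| ≤ l} f_{lm} Y_{lm}`. -/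
def sphComponent (f : S2 → ℝ) (l : ℕ) (x : S2) : ℂ :=
  ∑ m ∈ Finset.Icc (-(l : ℤ)) l, sphCoeff f l m * sphHarmonic l m x

/-! ### The spherical Laplacian, its heat semigroup and its fractional powers -/

/-- The extension of `f` to `ℝ³ ∖ {0}` that is constant along rays: `x ↦ f (x / |x|)`. -/
def radialExt (f : S2 → ℝ) (x : E3) : ℝ :=
  if h : x ≠ 0 then
    f ⟨‖x‖⁻¹ • x, by
      rw [mem_sphere_zero_iff_norm, norm_smul, norm_inv, norm_norm,
        inv_mul_cancel₀ (norm_ne_zero_iff.mpr h)]⟩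
  else 0

/-- `f ∈ C^∞(S²)`. -/
def SphSmooth (f : S2 → ℝ) : Prop :=
  ContDiffOn ℝ (⊤ : ℕ∞) (radialExt f) {0}ᶜ

/-- The spherical Laplacian (the Laplace-Beltrami operator of the unit sphere): the Euclidean
Laplacian of the extension that is constant along rays, restricted to the sphere. -/
def sphLaplacian (f : S2 → ℝ) (x : S2) : ℝ :=
  Laplacian.laplacian (radialExt f) (x : E3)

/-- The eigenspace in `L²(S²)` of the spherical Laplacian for the eigenvalue `-μ_l`
(it is a closed subspace already; the closure records this for the projection below). -/
def sphEigenspace (l : ℕ) : Submodule ℝ L2S :=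
  (Submodule.span ℝ {f : L2S | ∃ φ : S2 → ℝ, SphSmooth φ ∧
    (∀ x, sphLaplacian φ x = -(sphEigenvalue l) * φ x) ∧
    (f : S2 → ℝ) =ᵐ[sphMeasure] φ}).topologicalClosure

instance (l : ℕ) : CompleteSpace (sphEigenspace l) := by
  unfold sphEigenspace; infer_instance

/-- The heat semigroup `P_s = e^{s Δ}` on `L²(S²)`, in the sense of the functional calculus of
the spherical Laplacian `Δ`, whose spectrum is `{-μ_l : l ≥ 0}`. -/
def heatSemigroup (s : ℝ) (f : L2S) : L2S :=
  ∑' l : ℕ, Real.exp (-(s * sphEigenvalue l)) • (sphEigenspace l).starProjection f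

/-- `HasFracLaplacian α f g`: `f` is in the domain of `(-Δ)^α` and `(-Δ)^α f = g`, in the sense of
Bochner subordination,
`-(-Δ)^α f = α / Γ(1-α) ∫_0^∞ (P_s f - f) s^{-α-1} ds` in `L²(S²)`.
The integral over `(ε, ∞)` converges absolutely for every `f`, and the integral over `(0, ∞)` is
its limit in `L²(S²)` as `ε ↓ 0`. -/
def HasFracLaplacian (α : ℝ) (f g : L2S) : Prop :=
  Tendsto
    (fun ε : ℝ => (α / Real.Gamma (1 - α)) •
      ∫ s in Set.Ioi ε, s ^ (-α - 1) • (heatSemigroup s f - f))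
    (𝓝[>] 0) (𝓝 (-g))

/-- `v` is a solution, in `L²(S²)`, to the Cauchy problem
`(∂_t + (-Δ)^α) v_t = 0` for `t > 0`, `v_0 = f`: the curve `t ↦ v_t` is continuous from `[0, ∞)`
to `L²(S²)`, starts at `f`, and at each `t > 0` it is differentiable and lies in the domain of
`(-Δ)^α`, with `∂_t v_t = -(-Δ)^α v_t`. -/
def IsFracHeatSolution (α : ℝ) (f : S2 → ℝ) (v : ℝ≥0 → S2 → ℝ) : Prop :=
  ∃ u : ℝ → L2S,
    (∀ t : ℝ≥0, (u t : S2 → ℝ) =ᵐ[sphMeasure] v t) ∧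
    (u 0 : S2 → ℝ) =ᵐ[sphMeasure] f ∧
    ContinuousOn u (Set.Ici 0) ∧
    ∀ t : ℝ, 0 < t → ∃ g : L2S, HasFracLaplacian α (u t) g ∧ HasDerivAt u (-g) t

/-! ### Random fields and processes -/

/-- The action of a linear isometry of `ℝ³` on the sphere. -/
def sphRotate (g : E3 ≃ₗᵢ[ℝ] E3) (x : S2) : S2 :=
  ⟨g x, by rw [mem_sphere_zero_iff_norm, g.norm_map]; exact mem_sphere_zero_iff_norm.mp x.2⟩

/-- The `σ`-field generated by a family of random variables. -/
abbrev sigmaField {Ω ι β : Type*} [MeasurableSpace β] (X : ι → Ω → β) : MeasurableSpace Ω :=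
  ⨆ i, MeasurableSpace.comap (X i) inferInstance

/-- A measurable, zero-mean, isotropic Gaussian random field on the sphere. -/
structure IsIsotropicGaussianField {Ω : Type*} [MeasurableSpace Ω] (T : S2 → Ω → ℝ)
    (P : Measure Ω) : Prop where
  measurable : ∀ x, Measurable (T x)
  /-- Joint measurability in `(x, ω)`, with respect to the `σ`-field generated by the field. -/
  measurable_joint :
    @Measurable (S2 × Ω) ℝ (@Prod.instMeasurableSpace S2 Ω inferInstance (sigmaField T))
      inferInstance (fun p => T p.1 p.2)
  gaussian : IsGaussianProcess T P
  mean_zero : ∀ x, ∫ ω, T x ω ∂P = 0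
  /-- The law of the field is invariant under the rotations `g ∈ SO(3)`. -/
  isotropic : ∀ g : E3 ≃ₗᵢ[ℝ] E3, LinearMap.det (g : E3 →ₗ[ℝ] E3) = 1 →
    IdentDistrib (fun ω x => T (sphRotate g x) ω) (fun ω x => T x ω) P P

/-- Rotational Brownian motion on the sphere with starting point `x`: the continuous process with
generator the spherical Laplacian `Δ` (so its transition semigroup solves `∂_t u = Δ u`), as the
solution to the martingale problem for `Δ`. -/
structure IsRotationalBrownianMotion {Ω : Type*} [MeasurableSpace Ω] (x : S2)
    (B : ℝ≥0 → Ω → S2) (P : Measure Ω) : Prop where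
  measurable : ∀ t, Measurable (B t)
  start : ∀ᵐ ω ∂P, B 0 ω = x
  continuous : ∀ ω, Continuous (fun t => B t ω)
  martingale : ∀ f : S2 → ℝ, SphSmooth f →
    Martingale
      (fun (t : ℝ≥0) ω => f (B t ω) - f x - ∫ s in (0 : ℝ)..t, sphLaplacian f (B s.toNNReal ω))
      (Filtration.natural B (fun t => (measurable t).stronglyMeasurable)) P

/-- A stable subordinator of index `α`: independent and stationary increments, non-decreasing
right-continuous paths from `0`, and Laplace exponent `Ψ(μ) = μ^α`. -/
structure IsStableSubordinator {Ω : Type*} [MeasurableSpace Ω] (α : ℝ)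
    (D : ℝ≥0 → Ω → ℝ≥0) (P : Measure Ω) : Prop where
  measurable : ∀ t, Measurable (D t)
  start : ∀ᵐ ω ∂P, D 0 ω = 0
  monotone : ∀ᵐ ω ∂P, Monotone (fun t => D t ω)
  right_continuous : ∀ᵐ ω ∂P, ∀ t, ContinuousWithinAt (fun t => D t ω) (Set.Ici t) t
  indep_increments : HasIndepIncrements (fun t ω => (D t ω : ℝ)) P
  laplace : ∀ s t : ℝ≥0, s ≤ t → ∀ μ : ℝ, 0 ≤ μ →
    ∫ ω, Real.exp (-(μ * ((D t ω : ℝ) - D s ω))) ∂P = Real.exp (-(((t : ℝ) - s) * μ ^ α))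

/-- The subordinate process `B^Ψ_t = B_{D_t}`. -/
def subordinate {Ω : Type*} (B : ℝ≥0 → Ω → S2) (D : ℝ≥0 → Ω → ℝ≥0) (t : ℝ≥0) (ω : Ω) : S2 :=
  B (D t ω) ω

/-- The coordinates-change field `𝔗^Ψ_t(x)`: the field `T` evaluated at the subordinate rotational
Brownian motion started from `x`. Here `B x` is the Brownian motion started from `x`. -/
def timeChangedField {Ω : Type*} (T : S2 → Ω → ℝ) (B : S2 → ℝ≥0 → Ω → S2)
    (D : ℝ≥0 → Ω → ℝ≥0) (t : ℝ≥0) (x : S2) (ω : Ω) : ℝ :=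
  T (subordinate (B x) D t ω) ω

end

/-! ### Legendre polynomials -/

section Legendre

open Polynomial

/-! Everything is diagonal in the spherical harmonics. On degree `l` the heat semigroup is
multiplication by e^{-sμ_l}. Since ∫_0^∞ (1 - e^{-sμ}) s^{-α-1} ds = Γ(1-α) μ^α / α, Bochner's
integral makes (-△)^α multiplication by μ_l^α. The Cauchy problem thus splits into the scalar
equations y' = -μ_l^α y, and its solution is the multiplier e^{-tμ_l^α} (`fracHeat`). The bound x
e^{-tx} ≤ 1/t puts it in the domain for t > 0 and dominates the difference quotients; an integrating
factor in each mode gives uniqueness (`eq_fracHeat_of_hasDerivAt`).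

The same multipliers come from probability. For an eigenfunction φ with eigenvalue -μ, the
martingale problem gives E φ(B_s) = e^{-sμ} φ(x), and averaging over the independent time D_t gives
e^{-tμ^α} φ(x). A finite measure on the sphere is determined by its integrals against the Y_{lm},
which span a dense subspace of C(S²). Hence for t > 0 the law of B_{D_t} has the density ∑_l
e^{-tμ_l^α} ∑_m Y_{lm}(x) Y_{lm}(y)^* (`eq_withDensity_of_integral_sphHarmonic`). Unsöld's theorem
bounds the inner sums by (2l+1)/(4π), so the kernel is continuous and η_t(x) = ∫ kernel(x, y) T(y)
λ(dy) makes sense at every point x, for every realization in L². This gives `ℙ_t T`, and freezing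
the independent point B_{D_t} gives the conditional expectation.

The spectral input is that the Y_{lm} are orthonormal, complete, smooth eigenfunctions, and that
they exhaust the eigenspaces. The last point replaces Green's formula by the Brownian motion: its
law at time one defines a symmetric kernel operator with eigenvalue e^{-μ_k} on Y_{km}, and every
smooth eigenfunction for -μ_l is an eigenfunction of that operator for e^{-μ_l}. As the μ_l are
distinct, such a function has coefficients of degree `l` only (`zonalOp_of_eigenfunction`).

On the random side, isotropy makes E T(x)² constant, so almost every realization is in L² by Fubini.
Integrals of T against continuous kernels stay in the closed linear span of T in L²(P), all of whose
elements are centred Gaussian. The series converges in mean square by dominated convergence, with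
4‖T‖² as dominating variable. -/

/-- The `m`-th derivative of the Legendre polynomial of degree `l`. -/
noncomputable def legendreD (l m : ℕ) : ℝ[X] := derivative^[m] (legendreQ l)

lemma derivative_legendreD (l m : ℕ) : derivative (legendreD l m) = legendreD l (m + 1) := by
  rw [legendreD, legendreD, Function.iterate_succ_apply']

/-- The function w = (X² - 1)^l satisfies (X² - 1) w' = 2l X w. One differentiation gives the case k
= 0, and each further one passes from k to k + 1. -/
lemma iterate_derivative_rodrigues (l k : ℕ) :
    ((X ^ 2 - 1 : ℝ[X])) * derivative^[k + 2] ((X ^ 2 - 1 : ℝ[X]) ^ l)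
      + C (2 * ((k : ℝ) + 1) - 2 * l) * X * derivative^[k + 1] ((X ^ 2 - 1 : ℝ[X]) ^ l)
      + C (((k : ℝ) + 1) * (k - 2 * l)) * derivative^[k] ((X ^ 2 - 1 : ℝ[X]) ^ l) = 0 := by
  induction k with
  | zero =>
    have h : (X ^ 2 - 1 : ℝ[X]) * derivative ((X ^ 2 - 1 : ℝ[X]) ^ l)
        = C (2 * (l : ℝ)) * X * (X ^ 2 - 1 : ℝ[X]) ^ l := by
      cases l with
      | zero => simp
      | succ n =>
        rw [derivative_pow]
        simp [map_ofNat]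
        ring
    have h2 := congrArg derivative h
    simp only [derivative_mul, derivative_sub, derivative_X_pow, derivative_one, derivative_C,
      derivative_X] at h2
    simp only [Function.iterate_succ_apply', Function.iterate_zero_apply]
    simp only [map_sub, map_mul, map_add, map_natCast, map_ofNat, map_one, Nat.cast_zero,
      map_zero, Nat.cast_ofNat] at h2 ⊢
    linear_combination h2
  | succ k ih =>
    have h2 := congrArg derivative ih
    simp only [derivative_add, derivative_mul, derivative_sub, derivative_X_pow, derivative_one,
      derivative_C, derivative_X, derivative_zero, ← Function.iterate_succ_apply'] at h2
    simp only [map_sub, map_mul, map_add, map_natCast, map_ofNat, map_one, Nat.cast_add,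
      Nat.cast_one, Nat.cast_ofNat, Nat.succ_eq_add_one] at h2 ⊢
    linear_combination h2

lemma legendreD_eq (l m : ℕ) : legendreD l m =
    C (1 / (2 ^ l * (l.factorial : ℝ))) * derivative^[l + m] ((X ^ 2 - 1) ^ l) := by
  rw [legendreD, legendreQ, iterate_derivative_C_mul, ← Function.iterate_add_apply, add_comm]

/-- The differential equation of the associated Legendre functions. -/
lemma legendreD_ode (l m : ℕ) :
    (1 - X ^ 2) * legendreD l (m + 2) - C (2 * ((m : ℝ) + 1)) * X * legendreD l (m + 1)
      + C (((l : ℝ) - m) * (l + m + 1)) * legendreD l m = 0 := by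
  -- At k = l + m the coefficients collapse to 2(m+1) and (m-l)(l+m+1); the minus sign in the final
  -- multiplier turns X² - 1 into 1 - X².
  have h := iterate_derivative_rodrigues l (l + m)
  simp only [legendreD_eq, ← add_assoc]
  simp only [map_sub, map_mul, map_add, map_natCast, map_ofNat, map_one, Nat.cast_add] at h ⊢
  linear_combination (-(C (1 / (2 ^ l * (l.factorial : ℝ))))) * h

lemma degree_iterate_derivative_eq {p : ℝ[X]} {n : ℕ} (hp : p.natDegree = n) (h0 : p ≠ 0) (k : ℕ)
    (hk : k ≤ n) : derivative^[k] p ≠ 0 ∧ (derivative^[k] p).natDegree = n - k := by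
  induction k with
  | zero => simpa using ⟨h0, hp⟩
  | succ k ih =>
    obtain ⟨h1, h2⟩ := ih (by omega)
    have h3 : (derivative^[k + 1] p).natDegree = n - (k + 1) := by
      rw [Function.iterate_succ_apply', natDegree_derivative, h2]
      omega
    refine ⟨?_, h3⟩
    rw [Function.iterate_succ_apply']
    intro h
    have := derivative_eq_zero.1 h
    omega

lemma natDegree_rodrigues (l : ℕ) : ((X ^ 2 - 1 : ℝ[X]) ^ l).natDegree = 2 * l := by
  rw [natDegree_pow, show (X ^ 2 - 1 : ℝ[X]) = X ^ 2 - C 1 by simp, natDegree_X_pow_sub_C, mul_comm]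

lemma rodrigues_ne_zero (l : ℕ) : (X ^ 2 - 1 : ℝ[X]) ^ l ≠ 0 := by
  apply pow_ne_zero
  rw [show (X ^ 2 - 1 : ℝ[X]) = X ^ 2 - C 1 by simp]
  exact X_pow_sub_C_ne_zero (by norm_num) _

lemma degree_legendreD (l m : ℕ) (h : m ≤ l) : (legendreD l m).degree = (l - m : ℕ) := by
  obtain ⟨h1, h2⟩ := degree_iterate_derivative_eq (natDegree_rodrigues l) (rodrigues_ne_zero l)
    (l + m) (by omega)
  rw [legendreD_eq, degree_C_mul (by positivity), degree_eq_natDegree h1, h2]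
  congr 1
  omega

lemma legendreD_eq_zero (l m : ℕ) (h : l < m) : legendreD l m = 0 := by
  rw [legendreD_eq, iterate_derivative_eq_zero (by rw [natDegree_rodrigues]; omega), mul_zero]

lemma legendreD_self (l : ℕ) :
    legendreD l l = C (((2 * l).factorial : ℝ) / (2 ^ l * (l.factorial : ℝ))) := by
  have hm : ((X ^ 2 - 1 : ℝ[X]) ^ l).Monic := by
    apply Monic.pow
    rw [show (X ^ 2 - 1 : ℝ[X]) = X ^ 2 - C 1 by simp]
    exact monic_X_pow_sub_C _ (by norm_num)
  -- The 2l-th derivative of a monic polynomial of degree 2l is the constant (2l)!.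
  have h2 : derivative^[l + l] ((X ^ 2 - 1 : ℝ[X]) ^ l) = C ((2 * l).factorial : ℝ) := by
    have hd : (derivative^[l + l] ((X ^ 2 - 1 : ℝ[X]) ^ l)).natDegree = 0 := by
      rw [(degree_iterate_derivative_eq (natDegree_rodrigues l) (rodrigues_ne_zero l) (l + l)
        (by omega)).2]
      omega
    rw [eq_C_of_natDegree_eq_zero hd, coeff_iterate_derivative, zero_add,
      Nat.descFactorial_self]
    have : ((X ^ 2 - 1 : ℝ[X]) ^ l).coeff (l + l) = 1 := by
      have := hm.coeff_natDegree
      rwa [natDegree_rodrigues, two_mul] at this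
    rw [this, ← two_mul]
    simp
  rw [legendreD_eq, h2, ← C_mul]
  congr 1
  ring

/-- The integral over `[-1, 1]` as a linear functional on polynomials. -/
noncomputable def polyIntegral (p : ℝ[X]) : ℝ := ∫ x in (-1 : ℝ)..1, p.eval x

lemma polyIntegral_add (p q : ℝ[X]) : polyIntegral (p + q) = polyIntegral p + polyIntegral q := by
  simp only [polyIntegral, eval_add]
  exact intervalIntegral.integral_add (p.continuous.intervalIntegrable _ _)
    (q.continuous.intervalIntegrable _ _)

lemma polyIntegral_C_mul (c : ℝ) (p : ℝ[X]) : polyIntegral (C c * p) = c * polyIntegral p := by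
  simp only [polyIntegral, eval_mul, eval_C]
  exact intervalIntegral.integral_const_mul _ _

lemma polyIntegral_derivative (p : ℝ[X]) : polyIntegral (derivative p) = p.eval 1 - p.eval (-1) :=
  intervalIntegral.integral_eq_sub_of_hasDerivAt (fun x _ => p.hasDerivAt x)
    ((derivative p).continuous.intervalIntegrable _ _)

/-- The inner product of associated Legendre functions. -/
noncomputable def legendreI (m l k : ℕ) : ℝ :=
  polyIntegral ((1 - X ^ 2) ^ m * legendreD l m * legendreD k m)

lemma legendreI_comm (m l k : ℕ) : legendreI m l k = legendreI m k l := by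
  simp only [legendreI]; congr 1; ring

lemma derivative_one_sub_sq_pow (m : ℕ) : derivative ((1 - X ^ 2 : ℝ[X]) ^ (m + 1))
    = -(C (2 * ((m : ℝ) + 1)) * X) * (1 - X ^ 2) ^ m := by
  rw [derivative_pow]
  simp [map_ofNat]
  ring

/-- Integration by parts: the boundary terms vanish because of the factor (1 - X²)^{m+1}, and the
differential equation in self-adjoint form rewrites the derivative that falls on degree `l`. -/
lemma legendreI_succ (m l k : ℕ) :
    legendreI (m + 1) l k = ((l : ℝ) - m) * (l + m + 1) * legendreI m l k := by
  have hd : derivative ((1 - X ^ 2) ^ (m + 1) * legendreD l (m + 1) * legendreD k m)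
      = (1 - X ^ 2) ^ (m + 1) * legendreD l (m + 1) * legendreD k (m + 1)
        + C (-(((l : ℝ) - m) * (l + m + 1))) * ((1 - X ^ 2) ^ m * legendreD l m * legendreD k m) := by
    rw [derivative_mul, derivative_mul, derivative_one_sub_sq_pow, derivative_legendreD,
      derivative_legendreD, C_neg]
    linear_combination ((1 - X ^ 2) ^ m * legendreD k m) * legendreD_ode l m
  have h := polyIntegral_derivative ((1 - X ^ 2) ^ (m + 1) * legendreD l (m + 1) * legendreD k m)
  rw [hd, polyIntegral_add, polyIntegral_C_mul] at h
  simp only [eval_mul, eval_pow, eval_sub, eval_one, eval_X] at h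
  simp only [legendreI]
  norm_num at h
  linarith

/-- The recursion in `m` has a factor depending on `l` alone, while the integral is symmetric in `l`
and `k`. The two factors differ by (l-k)(l+k+1), which is nonzero. -/
lemma legendreI_of_ne (m l k : ℕ) (h : l ≠ k) : legendreI m l k = 0 := by
  have h1 := legendreI_succ m l k
  have h2 := legendreI_succ m k l
  rw [legendreI_comm, h1, legendreI_comm m k l] at h2
  have h3 : ((l : ℝ) - k) * (l + k + 1) * legendreI m l k = 0 := by linarith
  have h4 : (l : ℝ) - k ≠ 0 := sub_ne_zero.2 (by exact_mod_cast h)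
  have h5 : (l : ℝ) + k + 1 ≠ 0 := by positivity
  simpa [h4, h5] using h3

/-- X (1 - X²)^{l+1} vanishes at both endpoints, so the integral of its derivative is zero; this is
a recursion in `l`. -/
lemma polyIntegral_one_sub_sq_pow (l : ℕ) : polyIntegral ((1 - X ^ 2) ^ l)
    = 2 ^ (2 * l + 1) * (l.factorial : ℝ) ^ 2 / (2 * l + 1).factorial := by
  induction l with
  | zero => norm_num [polyIntegral]
  | succ l ih =>
    have hd : derivative (X * (1 - X ^ 2 : ℝ[X]) ^ (l + 1))
        = C (2 * (l : ℝ) + 3) * (1 - X ^ 2) ^ (l + 1) + C (-(2 * ((l : ℝ) + 1))) * (1 - X ^ 2) ^ l := by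
      rw [derivative_mul, derivative_one_sub_sq_pow]
      simp [map_ofNat]
      ring
    have h := polyIntegral_derivative (X * (1 - X ^ 2 : ℝ[X]) ^ (l + 1))
    rw [hd, polyIntegral_add, polyIntegral_C_mul, polyIntegral_C_mul, ih] at h
    norm_num at h
    have h3 : (2 * (l : ℝ) + 3) ≠ 0 := by positivity
    have : polyIntegral ((1 - X ^ 2) ^ (l + 1)) = (2 * ((l : ℝ) + 1)) / (2 * l + 3) *
        (2 ^ (2 * l + 1) * (l.factorial : ℝ) ^ 2 / (2 * l + 1).factorial) := by
      field_simp
      field_simp at h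
      linarith
    rw [this, show 2 * (l + 1) + 1 = (2 * l + 1) + 1 + 1 by ring, Nat.factorial_succ (2 * l + 1 + 1),
      Nat.factorial_succ (2 * l + 1), Nat.factorial_succ l]
    push_cast
    have h6 : ((2 * l + 1).factorial : ℝ) ≠ 0 := by positivity
    field_simp
    ring

lemma legendreI_eq_zero_mul (m l : ℕ) (h : m ≤ l) :
    legendreI m l l * ((l - m).factorial : ℝ) = ((l + m).factorial : ℝ) * legendreI 0 l l := by
  induction m with
  | zero => simp [mul_comm]
  | succ m ih =>
    have ih := ih (by omega)
    rw [legendreI_succ]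
    obtain ⟨d, rfl⟩ : ∃ d, l = m + 1 + d := ⟨l - (m + 1), by omega⟩
    rw [show m + 1 + d - m = d + 1 by omega, Nat.factorial_succ] at ih
    rw [show m + 1 + d - (m + 1) = d by omega,
      show m + 1 + d + (m + 1) = (m + 1 + d + m) + 1 by ring, Nat.factorial_succ]
    push_cast at ih ⊢
    linear_combination (m + 1 + d + m + 1 : ℝ) * ih

/-- Climbing the recursion to m = l replaces the Legendre polynomial by a constant, and only the
integral of (1 - X²)^l remains. -/
lemma legendreI_zero_self (l : ℕ) : legendreI 0 l l = 2 / (2 * l + 1) := by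
  have h := legendreI_eq_zero_mul l l le_rfl
  have h2 : legendreI l l l = (((2 * l).factorial : ℝ) / (2 ^ l * (l.factorial : ℝ))) ^ 2 *
      (2 ^ (2 * l + 1) * (l.factorial : ℝ) ^ 2 / (2 * l + 1).factorial) := by
    rw [← polyIntegral_one_sub_sq_pow, ← polyIntegral_C_mul, legendreI, legendreD_self, C_pow]
    congr 1
    ring
  rw [h2, Nat.factorial_succ, ← two_mul] at h
  simp at h
  have h6 : ((2 * l).factorial : ℝ) ≠ 0 := by positivity
  have h7 : (l.factorial : ℝ) ≠ 0 := by positivity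
  have h8 : legendreI 0 l l = ((2 * l).factorial : ℝ)⁻¹ * (((2 * l).factorial : ℝ) * legendreI 0 l l) := by
    field_simp
  rw [h8, ← h]
  field_simp
  ring

lemma legendreI_self (m l : ℕ) (h : m ≤ l) :
    legendreI m l l = 2 / (2 * l + 1) * ((l + m).factorial / (l - m).factorial) := by
  have := legendreI_eq_zero_mul m l h
  rw [legendreI_zero_self] at this
  field_simp at this ⊢
  linarith

/-- The sum `∑_{|m| ≤ l} |Q_{lm}|²` with the weights of the addition theorem. -/
noncomputable def legendreUnsold (l : ℕ) : ℝ[X] :=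
  legendreD l 0 ^ 2 + ∑ m ∈ Finset.range l,
    C (2 * ((l - (m + 1)).factorial / (l + (m + 1)).factorial : ℝ)) *
      ((1 - X ^ 2) ^ (m + 1) * legendreD l (m + 1) ^ 2)

/-- This is the addition theorem on the diagonal, without the full addition theorem: by the
differential equation the derivatives of the summands telescope. The lower end cancels the
derivative of Q_l², and the upper end contains the (l+1)-st derivative of a polynomial of degree
`l`. -/
lemma derivative_legendreUnsold (l : ℕ) : derivative (legendreUnsold l) = 0 := by
  set g : ℕ → ℝ[X] := fun m => C (2 * ((l - m).factorial / (l + m).factorial : ℝ)) *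
    ((1 - X ^ 2) ^ m * legendreD l m * legendreD l (m + 1)) with hg
  have key : ∀ m ∈ Finset.range l,
      derivative (C (2 * ((l - (m + 1)).factorial / (l + (m + 1)).factorial : ℝ)) *
      ((1 - X ^ 2) ^ (m + 1) * legendreD l (m + 1) ^ 2)) = g (m + 1) - g m := by
    intro m hm
    have hm : m < l := Finset.mem_range.1 hm
    have hc : (2 * ((l - m).factorial / (l + m).factorial : ℝ)) =
        2 * ((l - (m + 1)).factorial / (l + (m + 1)).factorial : ℝ) *
          (((l : ℝ) - m) * (l + m + 1)) := by
      obtain ⟨d, rfl⟩ : ∃ d, l = m + 1 + d := ⟨l - (m + 1), by omega⟩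
      rw [show m + 1 + d - m = d + 1 by omega, Nat.factorial_succ,
        show m + 1 + d - (m + 1) = d by omega,
        show m + 1 + d + (m + 1) = (m + 1 + d + m) + 1 by ring, Nat.factorial_succ]
      push_cast
      have : ((m + 1 + d + m).factorial : ℝ) ≠ 0 := by positivity
      field_simp
      ring
    rw [hg]
    simp only
    rw [hc]
    generalize 2 * ((l - (m + 1)).factorial / (l + (m + 1)).factorial : ℝ) = c
    rw [derivative_C_mul, derivative_mul, derivative_one_sub_sq_pow, derivative_pow,
      derivative_legendreD, C_mul]
    simp only [Nat.cast_ofNat, map_ofNat, Nat.add_one_sub_one, pow_one]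
    have hode := legendreD_ode l m
    simp only [map_mul, map_add, map_sub, map_natCast, map_ofNat, map_one] at hode ⊢
    linear_combination (C c * ((1 - X ^ 2) ^ m * legendreD l (m + 1))) * hode
  rw [legendreUnsold, derivative_add, derivative_sum, Finset.sum_congr rfl key,
    Finset.sum_range_sub, derivative_pow, derivative_legendreD, hg]
  have h0 : legendreD l (l + 1) = 0 := legendreD_eq_zero _ _ (by omega)
  have : ((l.factorial : ℝ) / l.factorial) = 1 := div_self (by positivity)
  simp [h0, this, map_ofNat]
  ring

end Legendre

/-! ### The surface measure -/

section Surface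

open Set
open scoped Pointwise

instance : IsFiniteMeasure sphMeasure := by unfold sphMeasure; infer_instance

lemma measurable_sphRotate (g : E3 ≃ₗᵢ[ℝ] E3) : Measurable (sphRotate g) :=
  (g.continuous.measurable.comp measurable_subtype_coe).subtype_mk

/-- The surface measure of a set is a multiple of the volume of the cone over it, and an isometry
carries cones to cones of the same volume. -/
lemma measurePreserving_sphRotate (g : E3 ≃ₗᵢ[ℝ] E3) :
    MeasurePreserving (sphRotate g) sphMeasure sphMeasure := by
  refine ⟨measurable_sphRotate g, ?_⟩
  ext s hs
  rw [Measure.map_apply (measurable_sphRotate g) hs, sphMeasure,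
    Measure.toSphere_apply' _ ((measurable_sphRotate g) hs), Measure.toSphere_apply' _ hs]
  congr 1
  rw [← (g.measurePreserving).measure_preimage_emb g.toHomeomorph.measurableEmbedding
    (Ioo (0 : ℝ) 1 • (Subtype.val '' s))]
  congr 1
  ext x
  simp only [Set.mem_smul, mem_image, mem_preimage, Subtype.exists, exists_and_right, exists_eq_right]
  constructor
  · rintro ⟨r, hr, y, ⟨hy, hys⟩, rfl⟩
    exact ⟨r, hr, g y, ⟨by simpa using hy, hys⟩, by simp⟩
  · rintro ⟨r, hr, y, ⟨hy, hys⟩, h⟩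
    refine ⟨r, hr, g.symm y, ⟨?_, ?_⟩, ?_⟩
    · simpa using hy
    · simpa [sphRotate] using hys
    · apply g.injective
      simpa using h

lemma integral_sphRotate {F : Type*} [NormedAddCommGroup F] [NormedSpace ℝ F]
    (g : E3 ≃ₗᵢ[ℝ] E3) (f : S2 → F) :
    ∫ x, f (sphRotate g x) ∂sphMeasure = ∫ x, f x ∂sphMeasure := by
  refine (measurePreserving_sphRotate g).integral_comp ?_ f
  refine (measurable_sphRotate g).measurableEmbedding ?_
  intro x y h
  have := congrArg Subtype.val h
  exact Subtype.ext (g.injective this)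

lemma integral_pow_mul_exp_neg_sq_real (k : ℕ) :
    ∫ x : ℝ, x ^ (2 * k) * Real.exp (-x ^ 2) = Real.Gamma (k + 1 / 2) := by
  have h := integral_comp_abs (f := fun x : ℝ => x ^ (2 * k) * Real.exp (-x ^ 2))
  have h2 := integral_rpow_mul_exp_neg_rpow (p := 2) (q := 2 * k) (by norm_num)
    (by have : (0 : ℝ) ≤ k := by positivity
        linarith)
  have h3 : ∫ x in Ioi (0 : ℝ), x ^ (2 * k) * Real.exp (-x ^ 2)
      = 1 / 2 * Real.Gamma ((2 * k + 1) / 2) := by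
    rw [← h2]
    refine setIntegral_congr_fun measurableSet_Ioi fun x hx => ?_
    simp only [← Real.rpow_natCast]
    norm_num
  rw [h3] at h
  simp only [pow_mul, sq_abs] at h ⊢
  rw [h]
  rw [show ((2 * k + 1) / 2 : ℝ) = k + 1 / 2 by ring]
  ring

/-- Polar coordinates: `n` of the powers of r come from the homogeneity of the integrand, the other
two from the surface element of a sphere in dimension three. -/
lemma integral_polar (n : ℕ) :
    ∫ x : E3, (x 2) ^ n * Real.exp (-‖x‖ ^ 2)
      = (∫ x : S2, (x.1 2) ^ n ∂sphMeasure) *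
        ∫ r in Ioi (0 : ℝ), r ^ (n + 2) * Real.exp (-r ^ 2) := by
  calc ∫ x : E3, (x 2) ^ n * Real.exp (-‖x‖ ^ 2)
      = ∫ x : ({(0 : E3)}ᶜ : Set E3), (x.1 2) ^ n * Real.exp (-‖x.1‖ ^ 2)
          ∂(Measure.comap (↑) (volume : Measure E3)) := by
        rw [integral_subtype_comap (measurableSet_singleton _).compl
          fun x : E3 => (x 2) ^ n * Real.exp (-‖x‖ ^ 2), restrict_compl_singleton]
    _ = ∫ p : S2 × Ioi (0 : ℝ), ((p.1.1 2) ^ n) * ((p.2.1) ^ n * Real.exp (-(p.2.1) ^ 2))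
          ∂(sphMeasure.prod (Measure.volumeIoiPow (Module.finrank ℝ E3 - 1))) := by
        rw [sphMeasure, ← ((volume : Measure E3).measurePreserving_homeomorphUnitSphereProd).integral_comp
          (Homeomorph.measurableEmbedding _)]
        refine integral_congr_ae (Eventually.of_forall fun x => ?_)
        have hx : ‖x.1‖ ≠ 0 := norm_ne_zero_iff.2 x.2
        simp only [homeomorphUnitSphereProd_apply_fst_coe, homeomorphUnitSphereProd_apply_snd_coe]
        simp only [PiLp.smul_apply, smul_eq_mul]
        rw [← mul_assoc, ← mul_pow]
        congr 2
        field_simp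
    _ = _ := by
        rw [integral_prod_mul (fun x : S2 => (x.1 2) ^ n)
          (fun r : Ioi (0 : ℝ) => (r.1) ^ n * Real.exp (-(r.1) ^ 2))]
        congr 1
        simp only [Measure.volumeIoiPow, ENNReal.ofReal, finrank_euclideanSpace, Fintype.card_fin]
        rw [integral_withDensity_eq_integral_smul,
          integral_subtype_comap measurableSet_Ioi
            fun a : ℝ => Real.toNNReal (a ^ (3 - 1)) • (a ^ n * Real.exp (-a ^ 2)),
          setIntegral_congr_fun measurableSet_Ioi fun x hx => ?_]
        · rw [NNReal.smul_def, Real.coe_toNNReal _ (pow_nonneg hx.out.le _), smul_eq_mul]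
          ring
        · exact (measurable_subtype_coe.pow_const _).real_toNNReal

lemma integral_gaussian_moment (k : ℕ) :
    ∫ x : E3, (x 2) ^ (2 * k) * Real.exp (-‖x‖ ^ 2) = Real.pi * Real.Gamma (k + 1 / 2) := by
  rw [← (PiLp.volume_preserving_toLp (Fin 3)).integral_comp
    (MeasurableEquiv.toLp 2 (Fin 3 → ℝ)).measurableEmbedding]
  have : ∀ x : Fin 3 → ℝ, ((WithLp.toLp 2 x : E3) 2) ^ (2 * k) * Real.exp (-‖(WithLp.toLp 2 x : E3)‖ ^ 2)
      = ∏ i, (![fun y : ℝ => Real.exp (-y ^ 2), fun y : ℝ => Real.exp (-y ^ 2),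
        fun y : ℝ => y ^ (2 * k) * Real.exp (-y ^ 2)] : Fin 3 → ℝ → ℝ) i (x i) := by
    intro x
    simp only [EuclideanSpace.norm_eq, Fin.sum_univ_three, Fin.prod_univ_three]
    rw [Real.sq_sqrt (by positivity)]
    simp only [Real.norm_eq_abs, sq_abs, Matrix.cons_val]
    rw [neg_add, neg_add, Real.exp_add, Real.exp_add]
    ring
  simp_rw [this]
  rw [integral_fintype_prod_volume_eq_prod]
  simp only [Fin.prod_univ_three, Matrix.cons_val]
  have h := integral_gaussian 1
  simp only [neg_mul, one_mul, div_one] at h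
  rw [h, integral_pow_mul_exp_neg_sq_real, Real.mul_self_sqrt Real.pi_pos.le]

/-- The same Gaussian integral is computed in Cartesian and in polar coordinates; Γ(k + 3/2) = (k +
1/2) Γ(k + 1/2) makes the Gamma factors cancel. -/
lemma integral_sphere_even (k : ℕ) :
    ∫ x : S2, (x.1 2) ^ (2 * k) ∂sphMeasure = 4 * Real.pi / (2 * k + 1) := by
  have h := integral_polar (2 * k)
  rw [integral_gaussian_moment] at h
  have h3 : ∫ r in Ioi (0 : ℝ), r ^ (2 * k + 2) * Real.exp (-r ^ 2)
      = 1 / 2 * ((k + 1 / 2) * Real.Gamma (k + 1 / 2)) := by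
    have h2 := integral_rpow_mul_exp_neg_rpow (p := 2) (q := 2 * k + 2) (by norm_num)
      (by have : (0 : ℝ) ≤ k := by positivity
          linarith)
    rw [← Real.Gamma_add_one (by positivity), show (k + 1 / 2 + 1 : ℝ) = (2 * k + 2 + 1) / 2 by ring,
      ← h2]
    refine setIntegral_congr_fun measurableSet_Ioi fun x hx => ?_
    simp only [← Real.rpow_natCast]
    norm_num
  rw [h3] at h
  have hG : Real.Gamma (k + 1 / 2) ≠ 0 := (Real.Gamma_pos_of_pos (by positivity)).ne'
  have : Real.pi = (∫ x : S2, (x.1 2) ^ (2 * k) ∂sphMeasure) * (1 / 2 * (k + 1 / 2)) := by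
    apply mul_right_cancel₀ hG
    linarith
  rw [eq_div_iff (by positivity)]
  linarith

/-- The antipodal map preserves the measure and changes the sign of the integrand. -/
lemma integral_sphere_odd (k : ℕ) :
    ∫ x : S2, (x.1 2) ^ (2 * k + 1) ∂sphMeasure = 0 := by
  have h := integral_sphRotate (LinearIsometryEquiv.neg ℝ) (fun x : S2 => (x.1 2) ^ (2 * k + 1))
  have h2 : ∀ x : S2, ((sphRotate (LinearIsometryEquiv.neg ℝ) x).1 2) ^ (2 * k + 1)
      = -(x.1 2) ^ (2 * k + 1) := by
    intro x
    simp [sphRotate, Odd.neg_pow ⟨k, rfl⟩]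
  simp only [h2, integral_neg] at h
  linarith

lemma continuous_coord (i : Fin 3) : Continuous fun x : S2 => x.1 i := by fun_prop

lemma integrable_of_continuous_S2 {F : Type*} [NormedAddCommGroup F] [SecondCountableTopology F]
    [MeasurableSpace F] [BorelSpace F] {f : S2 → F} (μ : Measure S2) [IsFiniteMeasure μ]
    (hf : Continuous f) : Integrable f μ :=
  hf.integrable_of_hasCompactSupport (HasCompactSupport.of_compactSpace f)

/-- Archimedes' theorem, for polynomials. -/
lemma integral_sphere_eval (p : Polynomial ℝ) :
    ∫ x : S2, p.eval (x.1 2) ∂sphMeasure = 2 * Real.pi * polyIntegral p := by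
  induction p using Polynomial.induction_on' with
  | add p q hp hq =>
    simp only [Polynomial.eval_add]
    rw [integral_add, hp, hq, polyIntegral_add, mul_add]
    · exact integrable_of_continuous_S2 _ (p.continuous.comp (continuous_coord 2))
    · exact integrable_of_continuous_S2 _ (q.continuous.comp (continuous_coord 2))
  | monomial n a =>
    simp only [Polynomial.eval_monomial, polyIntegral]
    rw [integral_const_mul, intervalIntegral.integral_const_mul, integral_pow]
    obtain ⟨k, rfl | rfl⟩ := Nat.even_or_odd' n
    · rw [integral_sphere_even]
      push_cast
      rw [Odd.neg_one_pow ⟨k, rfl⟩]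
      field_simp
      ring
    · rw [integral_sphere_odd]
      rw [Even.neg_one_pow ⟨k + 1, by ring⟩]
      simp

/-- The rotation by the angle `θ` about the third coordinate axis. -/
noncomputable def axisRotation (θ : ℝ) : E3 ≃ₗᵢ[ℝ] E3 :=
  LinearIsometry.toLinearIsometryEquiv
    { toFun := fun x => !₂[Real.cos θ * x 0 - Real.sin θ * x 1, Real.sin θ * x 0 + Real.cos θ * x 1, x 2]
      map_add' := fun x y => by ext i; fin_cases i <;> simp <;> ring
      map_smul' := fun c x => by ext i; fin_cases i <;> simp <;> ring
      norm_map' := fun x => by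
        simp only [EuclideanSpace.norm_eq, Fin.sum_univ_three]
        congr 1
        simp
        linear_combination (x 0 ^ 2 + x 1 ^ 2) * Real.sin_sq_add_cos_sq θ } rfl

/-- The complex coordinate `x₀ + i x₁`. -/
noncomputable def cplxCoord (x : S2) : ℂ := (x.1 0 : ℂ) + (x.1 1 : ℂ) * Complex.I

lemma continuous_cplxCoord : Continuous cplxCoord := by unfold cplxCoord; fun_prop

lemma cplxCoord_rotate (θ : ℝ) (x : S2) : cplxCoord (sphRotate (axisRotation θ) x)
    = Complex.exp (θ * Complex.I) * cplxCoord x := by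
  rw [Complex.exp_mul_I]
  simp [cplxCoord, sphRotate, axisRotation]
  linear_combination (-(Complex.sin θ * x.1 1)) * Complex.I_sq

lemma coord_two_rotate (θ : ℝ) (x : S2) : (sphRotate (axisRotation θ) x).1 2 = x.1 2 := by
  simp [sphRotate, axisRotation]

lemma sum_sq_coord (x : S2) : x.1 0 ^ 2 + x.1 1 ^ 2 + x.1 2 ^ 2 = 1 := by
  have h := mem_sphere_zero_iff_norm.1 x.2
  have h2 := EuclideanSpace.norm_sq_eq x.1
  rw [h] at h2
  simpa [Fin.sum_univ_three] using h2.symm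

lemma cplxCoord_mul_conj (x : S2) :
    cplxCoord x * (starRingEnd ℂ) (cplxCoord x) = ((1 - x.1 2 ^ 2 : ℝ) : ℂ) := by
  rw [Complex.mul_conj]
  congr 1
  have := sum_sq_coord x
  simp [cplxCoord, Complex.normSq_apply]
  linarith

end Surface

/-! ### Spherical harmonics -/

section Harmonics

open Polynomial

/-- The polynomial `p` with `Y_{lm} = p(z) (x + i y)^m`, `m ≥ 0`. -/
noncomputable def harmonicPoly (l m : ℕ) : ℝ[X] :=
  C (Real.sqrt ((2 * l + 1) / (4 * Real.pi) * ((l - m).factorial / (l + m).factorial)) * (-1) ^ m) *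
    legendreD l m

lemma sphHarmonicNat_eq (l m : ℕ) (x : S2) :
    sphHarmonicNat l m x = ((harmonicPoly l m).eval (x.1 2) : ℝ) * cplxCoord x ^ m := by
  simp only [sphHarmonicNat, harmonicPoly, cplxCoord, legendreD, eval_mul, eval_C]
  push_cast
  ring

/-- `(x + i y)^m` for `m ≥ 0` and `(-1)^m (x - i y)^|m|` for `m < 0`. -/
noncomputable def angularPart (m : ℤ) (x : S2) : ℂ :=
  if 0 ≤ m then cplxCoord x ^ m.natAbs
  else (-1) ^ m.natAbs * (starRingEnd ℂ) (cplxCoord x) ^ m.natAbs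

lemma sphHarmonic_eq (l : ℕ) (m : ℤ) (x : S2) :
    sphHarmonic l m x = ((harmonicPoly l m.natAbs).eval (x.1 2) : ℝ) * angularPart m x := by
  simp only [sphHarmonic, angularPart, sphHarmonicNat_eq]
  split_ifs with h
  · rfl
  · rw [map_mul, map_pow, Complex.conj_ofReal]
    ring

lemma continuous_angularPart (m : ℤ) : Continuous (angularPart m) := by
  unfold angularPart
  have := continuous_cplxCoord
  split_ifs
  · fun_prop
  · exact continuous_const.mul ((Complex.continuous_conj.comp this).pow _)

lemma continuous_sphHarmonic (l : ℕ) (m : ℤ) : Continuous (sphHarmonic l m) := by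
  have : sphHarmonic l m = fun x =>
    (((harmonicPoly l m.natAbs).eval (x.1 2) : ℝ) : ℂ) * angularPart m x :=
    funext fun x => sphHarmonic_eq l m x
  rw [this]
  exact (Complex.continuous_ofReal.comp
    ((harmonicPoly l m.natAbs).continuous.comp (continuous_coord 2))).mul (continuous_angularPart m)

lemma angularPart_rotate (m : ℤ) (θ : ℝ) (x : S2) :
    angularPart m (sphRotate (axisRotation θ) x)
      = Complex.exp (m * θ * Complex.I) * angularPart m x := by
  simp only [angularPart, cplxCoord_rotate]
  split_ifs with h
  · rw [mul_pow, ← Complex.exp_nat_mul]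
    have h2 : (m.natAbs : ℂ) = m := by rw [← Int.cast_natCast (R := ℂ), Int.natAbs_of_nonneg h]
    rw [h2, mul_assoc]
  · rw [map_mul, mul_pow, ← Complex.exp_conj, ← Complex.exp_nat_mul]
    have h2 : (m.natAbs : ℂ) = -m := by
      rw [← Int.cast_natCast (R := ℂ), Int.ofNat_natAbs_of_nonpos (by omega), Int.cast_neg]
    rw [h2]
    simp only [map_mul, Complex.conj_ofReal, Complex.conj_I]
    rw [show (-(m : ℂ)) * (θ * -Complex.I) = m * θ * Complex.I by ring]
    ring

lemma sphHarmonic_rotate (l : ℕ) (m : ℤ) (θ : ℝ) (x : S2) :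
    sphHarmonic l m (sphRotate (axisRotation θ) x)
      = Complex.exp (m * θ * Complex.I) * sphHarmonic l m x := by
  rw [sphHarmonic_eq, sphHarmonic_eq, angularPart_rotate, coord_two_rotate]
  ring

lemma angularPart_mul_conj (m : ℤ) (x : S2) :
    angularPart m x * (starRingEnd ℂ) (angularPart m x)
      = (((1 - X ^ 2 : ℝ[X]) ^ m.natAbs).eval (x.1 2) : ℝ) := by
  have h := cplxCoord_mul_conj x
  have h2 : (((-1 : ℂ)) ^ m.natAbs) * (-1) ^ m.natAbs = 1 := by
    rw [← mul_pow]; simp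
  simp only [angularPart, eval_pow, eval_sub, eval_one, eval_X, Complex.ofReal_pow]
  rw [← h]
  split_ifs
  · rw [map_pow]
    ring
  · simp only [map_pow, map_mul, map_neg, map_one, Complex.conj_conj]
    linear_combination (cplxCoord x * (starRingEnd ℂ) (cplxCoord x)) ^ m.natAbs * h2

/-- Rotating by θ about the axis multiplies the integrand by e^{i(m-m')θ}. The angle θ = π/(m-m')
makes this factor -1, so the integral equals its own negative. -/
lemma integral_sphHarmonic_of_ne (l l' : ℕ) {m m' : ℤ} (h : m ≠ m') :
    ∫ x, sphHarmonic l m x * (starRingEnd ℂ) (sphHarmonic l' m' x) ∂sphMeasure = 0 := by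
  have h1 := integral_sphRotate (axisRotation (Real.pi / (m - m')))
    (fun x => sphHarmonic l m x * (starRingEnd ℂ) (sphHarmonic l' m' x))
  have h3 : (m : ℂ) - m' ≠ 0 := sub_ne_zero.2 (by exact_mod_cast h)
  have h2 : Complex.exp (m * (Real.pi / (m - m') : ℝ) * Complex.I) *
      (starRingEnd ℂ) (Complex.exp (m' * (Real.pi / (m - m') : ℝ) * Complex.I)) = -1 := by
    rw [← Complex.exp_conj, ← Complex.exp_add, ← Complex.exp_pi_mul_I]
    congr 1
    simp only [map_mul, Complex.conj_ofReal, Complex.conj_I, map_intCast]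
    push_cast
    field_simp
    ring
  simp only [sphHarmonic_rotate, map_mul] at h1
  have h4 : ∀ x, Complex.exp (m * (Real.pi / (m - m') : ℝ) * Complex.I) * sphHarmonic l m x *
      ((starRingEnd ℂ) (Complex.exp (m' * (Real.pi / (m - m') : ℝ) * Complex.I)) *
        (starRingEnd ℂ) (sphHarmonic l' m' x)) =
      -(sphHarmonic l m x * (starRingEnd ℂ) (sphHarmonic l' m' x)) := by
    intro x
    linear_combination (sphHarmonic l m x * (starRingEnd ℂ) (sphHarmonic l' m' x)) * h2
  simp only [h4, integral_neg] at h1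
  exact self_eq_neg.1 h1.symm

/-- With equal orders the angular parts multiply to (1 - z²)^{|m|}, so the integrand is a polynomial
in the height and Archimedes' theorem applies. -/
lemma integral_sphHarmonic_same (l l' : ℕ) (m : ℤ) :
    ∫ x, sphHarmonic l m x * (starRingEnd ℂ) (sphHarmonic l' m x) ∂sphMeasure
      = ((2 * Real.pi * polyIntegral ((1 - X ^ 2) ^ m.natAbs * harmonicPoly l m.natAbs *
        harmonicPoly l' m.natAbs) : ℝ) : ℂ) := by
  rw [← integral_sphere_eval, ← integral_complex_ofReal]
  refine integral_congr_ae (Eventually.of_forall fun x => ?_)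
  simp only [sphHarmonic_eq, map_mul, Complex.conj_ofReal, eval_mul, Complex.ofReal_mul,
    ← angularPart_mul_conj]
  ring

lemma polyIntegral_harmonicPoly (l l' m : ℕ) :
    polyIntegral ((1 - X ^ 2) ^ m * harmonicPoly l m * harmonicPoly l' m) =
      Real.sqrt ((2 * l + 1) / (4 * Real.pi) * ((l - m).factorial / (l + m).factorial)) *
      Real.sqrt ((2 * l' + 1) / (4 * Real.pi) * ((l' - m).factorial / (l' + m).factorial)) *
      legendreI m l l' := by
  rw [legendreI, ← polyIntegral_C_mul]
  have : ((-1 : ℝ)) ^ m * (-1) ^ m = 1 := by rw [← mul_pow]; simp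
  have := congrArg (C : ℝ → ℝ[X]) this
  simp only [C_mul, C_1] at this
  congr 1
  simp only [harmonicPoly, C_mul]
  linear_combination ((1 - X ^ 2) ^ m * legendreD l m * legendreD l' m *
    C (√((2 * l + 1) / (4 * Real.pi) * ((l - m).factorial / (l + m).factorial))) *
    C (√((2 * l' + 1) / (4 * Real.pi) * ((l' - m).factorial / (l' + m).factorial)))) * this

/-- The spherical harmonics are orthonormal. -/
lemma integral_sphHarmonic (l l' : ℕ) (m m' : ℤ) (hm : m.natAbs ≤ l) :
    ∫ x, sphHarmonic l m x * (starRingEnd ℂ) (sphHarmonic l' m' x) ∂sphMeasure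
      = if l = l' ∧ m = m' then 1 else 0 := by
  by_cases h : m = m'
  · subst h
    rw [integral_sphHarmonic_same, polyIntegral_harmonicPoly]
    by_cases h' : l = l'
    · subst h'
      simp only [and_self, if_true]
      rw [legendreI_self _ _ hm, Real.mul_self_sqrt (by positivity)]
      norm_cast
      have h1 : ((l - m.natAbs).factorial : ℝ) ≠ 0 := by positivity
      have h2 : ((l + m.natAbs).factorial : ℝ) ≠ 0 := by positivity
      have h3 := Real.pi_ne_zero
      push_cast
      field_simp
      norm_num
    · simp [h', legendreI_of_ne]
  · simp [h, integral_sphHarmonic_of_ne]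

lemma sum_Icc_natAbs (l : ℕ) (F : ℕ → ℝ) :
    ∑ m ∈ Finset.Icc (-(l : ℤ)) l, F m.natAbs = F 0 + ∑ m ∈ Finset.range l, 2 * F (m + 1) := by
  induction l with
  | zero => simp
  | succ l ih =>
    have : Finset.Icc (-((l + 1 : ℕ) : ℤ)) ((l + 1 : ℕ) : ℤ)
        = insert (-((l : ℤ) + 1)) (insert ((l : ℤ) + 1) (Finset.Icc (-(l : ℤ)) l)) := by
      ext a
      simp only [Finset.mem_insert, Finset.mem_Icc]
      push_cast
      omega
    rw [this, Finset.sum_insert (by simp; omega), Finset.sum_insert (by simp), ih,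
      Finset.sum_range_succ]
    have h1 : (-((l : ℤ) + 1)).natAbs = l + 1 := by omega
    have h2 : ((l : ℤ) + 1).natAbs = l + 1 := by omega
    rw [h1, h2]
    ring

lemma norm_sq_sphHarmonic (l : ℕ) (m : ℤ) (x : S2) : ‖sphHarmonic l m x‖ ^ 2 =
    (2 * l + 1) / (4 * Real.pi) * ((l - m.natAbs).factorial / (l + m.natAbs).factorial) *
      ((1 - X ^ 2) ^ m.natAbs * legendreD l m.natAbs ^ 2).eval (x.1 2) := by
  have h : ((‖sphHarmonic l m x‖ ^ 2 : ℝ) : ℂ)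
      = sphHarmonic l m x * (starRingEnd ℂ) (sphHarmonic l m x) := by
    rw [Complex.mul_conj, Complex.normSq_eq_norm_sq]
  rw [sphHarmonic_eq, map_mul, Complex.conj_ofReal, mul_mul_mul_comm, angularPart_mul_conj] at h
  have h1 : ((-1 : ℝ)) ^ m.natAbs * (-1) ^ m.natAbs = 1 := by rw [← mul_pow]; simp
  have h2 := Real.mul_self_sqrt (show 0 ≤ (2 * l + 1) / (4 * Real.pi) *
    ((l - m.natAbs).factorial / (l + m.natAbs).factorial : ℝ) by positivity)
  rw [sphHarmonic_eq]
  have h' := Complex.ofReal_injective (h.trans (by push_cast; rfl :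
    _ = (((harmonicPoly l m.natAbs).eval (x.1 2) * (harmonicPoly l m.natAbs).eval (x.1 2) *
      ((1 - X ^ 2 : ℝ[X]) ^ m.natAbs).eval (x.1 2) : ℝ) : ℂ)))
  rw [h']
  simp only [harmonicPoly, eval_mul, eval_C, eval_pow]
  generalize √((2 * l + 1) / (4 * Real.pi) *
    ((l - m.natAbs).factorial / (l + m.natAbs).factorial : ℝ)) = s at *
  rw [← h2]
  linear_combination (s ^ 2 * (legendreD l m.natAbs).eval (x.1 2) ^ 2 *
    ((1 - X ^ 2 : ℝ[X])).eval (x.1 2) ^ m.natAbs) * h1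

lemma sum_norm_sq_eq_unsold (l : ℕ) (x : S2) :
    ∑ m ∈ Finset.Icc (-(l : ℤ)) l, ‖sphHarmonic l m x‖ ^ 2 =
      (2 * l + 1) / (4 * Real.pi) * (legendreUnsold l).eval (x.1 2) := by
  simp only [norm_sq_sphHarmonic]
  refine (sum_Icc_natAbs l (fun k => (2 * l + 1) / (4 * Real.pi) *
    ((l - k).factorial / (l + k).factorial) *
      ((1 - X ^ 2) ^ k * legendreD l k ^ 2).eval (x.1 2))).trans ?_
  have : ((l.factorial : ℝ) / l.factorial) = 1 := div_self (by positivity)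
  simp only [legendreUnsold, eval_add, eval_finsetSum, mul_add, Finset.mul_sum, eval_mul, eval_C,
    tsub_zero, add_zero, this, pow_zero, one_mul, mul_one]
  congr 1
  refine Finset.sum_congr rfl fun k _ => ?_
  ring

/-- Unsöld's theorem. -/
lemma sum_norm_sq_sphHarmonic (l : ℕ) (x : S2) :
    ∑ m ∈ Finset.Icc (-(l : ℤ)) l, ‖sphHarmonic l m x‖ ^ 2 = (2 * l + 1) / (4 * Real.pi) := by
  -- The sum of squares is constant on the sphere; the constant is found by integrating, since each
  -- of the 2l + 1 terms has integral 1 and the total area is 4π.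
  have hc := eq_C_of_natDegree_eq_zero (derivative_eq_zero.1 (derivative_legendreUnsold l))
  set c := (legendreUnsold l).coeff 0
  have hx : ∀ x : S2, ∑ m ∈ Finset.Icc (-(l : ℤ)) l, ‖sphHarmonic l m x‖ ^ 2
      = (2 * l + 1) / (4 * Real.pi) * c := by
    intro x
    rw [sum_norm_sq_eq_unsold, hc, eval_C]
  have h1 : ∫ x : S2, (∑ m ∈ Finset.Icc (-(l : ℤ)) l, ‖sphHarmonic l m x‖ ^ 2) ∂sphMeasure
      = 2 * l + 1 := by
    have hi : ∀ m : ℤ, Integrable (fun x => ‖sphHarmonic l m x‖ ^ 2) sphMeasure := fun m =>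
      integrable_of_continuous_S2 _ ((continuous_sphHarmonic l m).norm.pow 2)
    rw [integral_finsetSum _ (fun m _ => hi m)]
    have : ∀ m ∈ Finset.Icc (-(l : ℤ)) l, ∫ x, ‖sphHarmonic l m x‖ ^ 2 ∂sphMeasure = 1 := by
      intro m hm
      have h := integral_sphHarmonic l l m m (by rw [Finset.mem_Icc] at hm; omega)
      simp only [and_self, if_true] at h
      apply Complex.ofReal_injective
      rw [← integral_complex_ofReal, Complex.ofReal_one, ← h]
      refine integral_congr_ae (Eventually.of_forall fun x => ?_)
      simp only
      rw [Complex.mul_conj, Complex.normSq_eq_norm_sq]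
    rw [Finset.sum_congr rfl this]
    simp
    have : ((l : ℤ) + 1 + l).toNat = 2 * l + 1 := by omega
    rw [this]
    push_cast
    ring
  have h2 : ∫ _ : S2, (1 : ℝ) ∂sphMeasure = 4 * Real.pi := by
    simpa using integral_sphere_even 0
  simp only [hx] at h1
  have h3 : ∫ _ : S2, (2 * l + 1) / (4 * Real.pi) * c ∂sphMeasure = (2 * l + 1) / (4 * Real.pi) * c *
      ∫ _ : S2, (1 : ℝ) ∂sphMeasure := by
    rw [← integral_const_mul]
    simp
  rw [h3, h2] at h1
  rw [hx]
  have h4 := Real.pi_ne_zero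
  have h5 : (2 * (l : ℝ) + 1) ≠ 0 := by positivity
  field_simp at h1 ⊢
  exact h1

end Harmonics

/-! ### Density of the spherical harmonics -/

section Density

open Polynomial

/-- The spherical harmonic as a continuous function. -/
noncomputable def sphHarmonicC (l : ℕ) (m : ℤ) : C(S2, ℂ) :=
  ⟨sphHarmonic l m, continuous_sphHarmonic l m⟩

/-- The span of the spherical harmonics in `C(S²)`. -/
noncomputable def harmonicSpan : Submodule ℂ C(S2, ℂ) :=
  Submodule.span ℂ {f | ∃ (l : ℕ) (m : ℤ), m.natAbs ≤ l ∧ f = sphHarmonicC l m}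

/-- The third coordinate as a continuous function. -/
noncomputable def axialC : C(S2, ℂ) :=
  ⟨fun x => (x.1 2 : ℂ), Complex.continuous_ofReal.comp (continuous_coord 2)⟩

/-- The complex coordinate `x₀ + i x₁` as a continuous function. -/
noncomputable def cplxCoordC : C(S2, ℂ) := ⟨cplxCoord, continuous_cplxCoord⟩

/-- A real polynomial in the third coordinate as a continuous function. -/
noncomputable def axialPolyC (p : ℝ[X]) : C(S2, ℂ) :=
  ⟨fun x => ((p.eval (x.1 2) : ℝ) : ℂ),
    Complex.continuous_ofReal.comp (p.continuous.comp (continuous_coord 2))⟩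

/-- The k-th derivative of Q_{i+k} has degree exactly `i`, so these polynomials form a basis of
ℝ[X], and membership need only be checked on them. -/
lemma axialPolyC_mul_mem_of_legendre (W : C(S2, ℂ)) (k : ℕ)
    (h : ∀ i, axialPolyC (legendreD (i + k) k) * W ∈ harmonicSpan) (p : ℝ[X]) :
    axialPolyC p * W ∈ harmonicSpan := by
  let S : Polynomial.Sequence ℝ :=
    { elems' := fun i => legendreD (i + k) k
      degree_eq' := fun i => by rw [degree_legendreD _ _ (by omega)]; congr 1; omega }
  have hs : p ∈ Submodule.span ℝ (Set.range S) := by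
    rw [S.span (fun i => (leadingCoeff_ne_zero.2 (S.ne_zero i)).isUnit)]
    trivial
  induction hs using Submodule.span_induction with
  | mem q hq => obtain ⟨i, rfl⟩ := hq; exact h i
  | zero =>
    have : axialPolyC 0 = 0 := by ext x; simp [axialPolyC]
    rw [this, zero_mul]
    exact zero_mem _
  | add q r _ _ hq hr =>
    have : axialPolyC (q + r) = axialPolyC q + axialPolyC r := by ext x; simp [axialPolyC]
    rw [this, add_mul]
    exact add_mem hq hr
  | smul c q _ hq =>
    have : axialPolyC (c • q) = (c : ℂ) • axialPolyC q := by ext x; simp [axialPolyC]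
    rw [this, smul_mul_assoc]
    exact Submodule.smul_mem _ _ hq

lemma harmonicPoly_coef_ne_zero (l m : ℕ) :
    Real.sqrt ((2 * l + 1) / (4 * Real.pi) * ((l - m).factorial / (l + m).factorial)) * (-1) ^ m
      ≠ 0 := by
  have := Real.pi_pos
  have : 0 < (2 * l + 1) / (4 * Real.pi) * ((l - m).factorial / (l + m).factorial : ℝ) := by
    positivity
  exact mul_ne_zero (Real.sqrt_pos.2 this).ne' (pow_ne_zero _ (by norm_num))

/-- On the basis polynomial of degree `i` the product is a scalar multiple of Y_{i+k,k}; the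
normalizing constant is nonzero and can be divided out. -/
lemma axialPolyC_mul_pow_mem (p : ℝ[X]) (k : ℕ) :
    axialPolyC p * cplxCoordC ^ k ∈ harmonicSpan := by
  refine axialPolyC_mul_mem_of_legendre _ k (fun i => ?_) p
  have hc := harmonicPoly_coef_ne_zero (i + k) k
  have : axialPolyC (legendreD (i + k) k) * cplxCoordC ^ k =
      (((Real.sqrt ((2 * (i + k : ℕ) + 1) / (4 * Real.pi) *
        ((i + k - k).factorial / (i + k + k).factorial)) * (-1) ^ k)⁻¹ : ℝ) : ℂ) •
        sphHarmonicC (i + k) k := by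
    ext x
    simp only [axialPolyC, cplxCoordC, sphHarmonicC, ContinuousMap.coe_mul, ContinuousMap.coe_mk,
      Pi.mul_apply, ContinuousMap.coe_pow, Pi.pow_apply, ContinuousMap.coe_smul, Pi.smul_apply,
      sphHarmonic_eq, harmonicPoly, eval_mul, eval_C, angularPart, smul_eq_mul]
    rw [if_pos (by positivity), ← mul_assoc, ← Complex.ofReal_mul]
    simp only [Int.natAbs_natCast]
    rw [← mul_assoc, inv_mul_cancel₀ hc, one_mul]
  rw [this]
  exact Submodule.smul_mem _ _ (Submodule.subset_span ⟨i + k, k, by simp, rfl⟩)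

lemma axialPolyC_mul_star_pow_mem (p : ℝ[X]) (k : ℕ) :
    axialPolyC p * (star cplxCoordC) ^ k ∈ harmonicSpan := by
  rcases Nat.eq_zero_or_pos k with rfl | hk
  · simpa using axialPolyC_mul_pow_mem p 0
  refine axialPolyC_mul_mem_of_legendre _ k (fun i => ?_) p
  have hc := harmonicPoly_coef_ne_zero (i + k) k
  have h2 : (((-1 : ℂ)) ^ k) * (-1) ^ k = 1 := by rw [← mul_pow]; simp
  have : axialPolyC (legendreD (i + k) k) * (star cplxCoordC) ^ k =
      ((((Real.sqrt ((2 * (i + k : ℕ) + 1) / (4 * Real.pi) *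
        ((i + k - k).factorial / (i + k + k).factorial)) * (-1) ^ k)⁻¹ : ℝ) : ℂ) * (-1) ^ k) •
        sphHarmonicC (i + k) (-k) := by
    ext x
    simp only [axialPolyC, cplxCoordC, sphHarmonicC, ContinuousMap.coe_mul, ContinuousMap.coe_mk,
      Pi.mul_apply, ContinuousMap.coe_pow, Pi.pow_apply, ContinuousMap.coe_smul, Pi.smul_apply,
      sphHarmonic_eq, harmonicPoly, eval_mul, eval_C, angularPart, smul_eq_mul,
      ContinuousMap.star_apply]
    rw [if_neg (by omega)]
    simp only [Int.natAbs_neg, Int.natAbs_natCast]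
    have h3 := congrArg (Complex.ofReal) (inv_mul_cancel₀ hc)
    rw [Complex.ofReal_mul, Complex.ofReal_one] at h3
    rw [Complex.ofReal_mul]
    simp only [starRingEnd_apply]
    linear_combination (-((eval (x.1 2) (legendreD (i + k) k) : ℝ) : ℂ) * star (cplxCoord x) ^ k) *
      ((-1) ^ k * (-1) ^ k * h3 + h2)
  rw [this]
  exact Submodule.smul_mem _ _ (Submodule.subset_span ⟨i + k, -k, by simp, rfl⟩)

/-- With w = x₀ + i x₁, the relation w w̄ = 1 - z² removes w or w̄ from the monomial, leaving a
polynomial in z times a power of the other. -/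
lemma monomial_mem_harmonicSpan (a b c : ℕ) :
    axialC ^ a * cplxCoordC ^ b * (star cplxCoordC) ^ c ∈ harmonicSpan := by
  rcases le_total b c with h | h
  · obtain ⟨d, rfl⟩ := Nat.exists_eq_add_of_le h
    have : axialC ^ a * cplxCoordC ^ b * (star cplxCoordC) ^ (b + d) =
        axialPolyC (X ^ a * (1 - X ^ 2) ^ b) * (star cplxCoordC) ^ d := by
      ext x
      have := cplxCoord_mul_conj x
      simp only [starRingEnd_apply] at this
      simp only [axialC, axialPolyC, cplxCoordC, ContinuousMap.coe_mul, ContinuousMap.coe_mk,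
        Pi.mul_apply, ContinuousMap.coe_pow, Pi.pow_apply, ContinuousMap.star_apply, eval_mul,
        eval_pow, eval_X, eval_sub, eval_one, Complex.ofReal_mul, Complex.ofReal_pow, ← this]
      ring
    rw [this]
    exact axialPolyC_mul_star_pow_mem _ _
  · obtain ⟨d, rfl⟩ := Nat.exists_eq_add_of_le h
    have : axialC ^ a * cplxCoordC ^ (c + d) * (star cplxCoordC) ^ c =
        axialPolyC (X ^ a * (1 - X ^ 2) ^ c) * cplxCoordC ^ d := by
      ext x
      have := cplxCoord_mul_conj x
      simp only [starRingEnd_apply] at this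
      simp only [axialC, axialPolyC, cplxCoordC, ContinuousMap.coe_mul, ContinuousMap.coe_mk,
        Pi.mul_apply, ContinuousMap.coe_pow, Pi.pow_apply, ContinuousMap.star_apply, eval_mul,
        eval_pow, eval_X, eval_sub, eval_one, Complex.ofReal_mul, Complex.ofReal_pow, ← this]
      ring
    rw [this]
    exact axialPolyC_mul_pow_mem _ _

lemma star_axialC : star axialC = axialC := by
  ext x; simp [axialC]

lemma adjoin_le_harmonicSpan (f : C(S2, ℂ)) (hf : f ∈ StarAlgebra.adjoin ℂ {axialC, cplxCoordC}) :
    f ∈ harmonicSpan := by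
  rw [← StarSubalgebra.mem_toSubalgebra, StarAlgebra.adjoin_toSubalgebra,
    ← Subalgebra.mem_toSubmodule, Algebra.adjoin_eq_span] at hf
  refine Submodule.span_le.2 ?_ hf
  intro g hg
  have : ∃ a b c : ℕ, g = axialC ^ a * cplxCoordC ^ b * (star cplxCoordC) ^ c := by
    induction hg using Submonoid.closure_induction with
    | mem g hg =>
      rcases hg with (rfl | rfl) | hg
      · exact ⟨1, 0, 0, by simp⟩
      · exact ⟨0, 1, 0, by simp⟩
      · rw [Set.mem_star] at hg
        rcases hg with h | h
        · refine ⟨1, 0, 0, ?_⟩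
          rw [← star_star g, h, star_axialC]
          simp
        · refine ⟨0, 0, 1, ?_⟩
          rw [← star_star g, h]
          simp
    | one => exact ⟨0, 0, 0, by simp⟩
    | mul g h _ _ hg hh =>
      obtain ⟨a, b, c, rfl⟩ := hg
      obtain ⟨a', b', c', rfl⟩ := hh
      exact ⟨a + a', b + b', c + c', by ring⟩
  obtain ⟨a, b, c, rfl⟩ := this
  exact monomial_mem_harmonicSpan a b c

/-- The spherical harmonics span a dense subspace of `C(S²)`. -/
lemma closure_harmonicSpan : harmonicSpan.topologicalClosure = ⊤ := by
  -- Stone–Weierstrass: the height and x₀ + i x₁ determine all three coordinates, hence separate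
  -- points.
  have h := ContinuousMap.starSubalgebra_topologicalClosure_eq_top_of_separatesPoints
    (StarAlgebra.adjoin ℂ {axialC, cplxCoordC}) (by
      intro x y hxy
      by_contra! hcon
      apply hxy
      have h1 := hcon _ ⟨axialC, StarAlgebra.subset_adjoin ℂ _ (by simp), rfl⟩
      have h2 := hcon _ ⟨cplxCoordC, StarAlgebra.subset_adjoin ℂ _ (by simp), rfl⟩
      simp only [axialC, cplxCoordC, ContinuousMap.coe_mk, Complex.ofReal_inj] at h1 h2
      have h3 := congrArg Complex.re h2
      have h4 := congrArg Complex.im h2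
      simp [cplxCoord] at h3 h4
      ext i
      fin_cases i
      · exact h3
      · exact h4
      · exact h1)
  rw [eq_top_iff]
  intro f _
  have hf : f ∈ (StarAlgebra.adjoin ℂ {axialC, cplxCoordC} : StarSubalgebra ℂ C(S2, ℂ)).topologicalClosure := by
    rw [h]; trivial
  exact closure_mono (fun g hg => adjoin_le_harmonicSpan g hg) hf

/-- Two continuous functionals on `C(S²)` that agree on the spherical harmonics are equal. -/
lemma continuousLinearMap_ext_sphHarmonic (Φ Ψ : C(S2, ℂ) →L[ℂ] ℂ)
    (h : ∀ (l : ℕ) (m : ℤ), m.natAbs ≤ l → Φ (sphHarmonicC l m) = Ψ (sphHarmonicC l m)) :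
    Φ = Ψ := by
  refine ContinuousLinearMap.ext_on (s := {f | ∃ (l : ℕ) (m : ℤ), m.natAbs ≤ l ∧ f = sphHarmonicC l m})
    ?_ ?_
  · have := closure_harmonicSpan
    intro f
    have hf : f ∈ harmonicSpan.topologicalClosure := by rw [this]; trivial
    exact hf
  · rintro f ⟨l, m, hm, rfl⟩
    exact h l m hm

end Density

/-! ### Spherical harmonics are eigenfunctions of the spherical Laplacian -/

section Eigenfunctions

open Polynomial

/-- The Laplacian from second derivatives along coordinate lines. -/
lemma laplacian_eq_sum_of_hasDerivAt {f : E3 → ℂ} {x : E3} (hf : ContDiffAt ℝ 2 f x)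
    (g : Fin 3 → ℝ → ℂ) (g' : Fin 3 → ℂ)
    (h1 : ∀ i, ∀ᶠ t in 𝓝 (0 : ℝ),
      HasDerivAt (fun t : ℝ => f (x + t • EuclideanSpace.single i (1 : ℝ))) (g i t) t)
    (h2 : ∀ i, HasDerivAt (g i) (g' i) 0) :
    Laplacian.laplacian f x = ∑ i, g' i := by
  rw [InnerProductSpace.laplacian_eq_iteratedFDeriv_orthonormalBasis f
    (EuclideanSpace.basisFun (Fin 3) ℝ)]
  refine Finset.sum_congr rfl fun i _ => ?_
  rw [iteratedFDeriv_two_apply]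
  simp only [Matrix.cons_val_zero, Matrix.cons_val_one, EuclideanSpace.basisFun_apply]
  set e : E3 := EuclideanSpace.single i (1 : ℝ)
  have hline : ∀ t : ℝ, HasDerivAt (fun t : ℝ => x + t • e) e t := fun t => by
    simpa using ((hasDerivAt_id t).smul_const e).const_add x
  have hd : ∀ᶠ y in 𝓝 x, DifferentiableAt ℝ f y :=
    (hf.eventually (by simp)).mono fun y hy => hy.differentiableAt (by simp)
  have hc : Tendsto (fun t : ℝ => x + t • e) (𝓝 0) (𝓝 x) := by
    have : ContinuousAt (fun t : ℝ => x + t • e) 0 := (hline 0).continuousAt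
    simpa [ContinuousAt] using this
  have hev : (g i) =ᶠ[𝓝 0] fun t => fderiv ℝ f (x + t • e) e := by
    filter_upwards [h1 i, hc.eventually hd] with t ht hdt
    exact ht.unique (hdt.hasFDerivAt.comp_hasDerivAt t (hline t))
  have h3 : HasFDerivAt (fderiv ℝ f) (fderiv ℝ (fderiv ℝ f) x) (x + (0 : ℝ) • e) := by
    rw [zero_smul, add_zero]
    exact ((hf.fderiv_right (m := 1) (by norm_num)).differentiableAt (by simp)).hasFDerivAt
  have h4 : HasDerivAt (fun t : ℝ => fderiv ℝ f (x + t • e) e)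
      (fderiv ℝ (fderiv ℝ f) x e e) 0 := by
    have h5 := h3.comp_hasDerivAt (0 : ℝ) (hline 0)
    exact (h5.clm_apply (hasDerivAt_const (0 : ℝ) e)).congr_deriv (by simp)
  exact h4.unique ((h2 i).congr_of_eventuallyEq hev.symm)

lemma hasDerivAt_eval_mul_pow (p : ℝ[X]) (m : ℕ) {Z Z1 : ℝ → ℝ} {W W1 : ℝ → ℂ} {t : ℝ}
    (hZ : HasDerivAt Z (Z1 t) t) (hW : HasDerivAt W (W1 t) t) :
    HasDerivAt (fun t => ((p.eval (Z t) : ℝ) : ℂ) * W t ^ m)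
      ((((derivative p).eval (Z t) : ℝ) : ℂ) * (Z1 t : ℂ) * W t ^ m +
        ((p.eval (Z t) : ℝ) : ℂ) * (m * W t ^ (m - 1) * W1 t)) t := by
  have h1 := ((p.hasDerivAt (Z t)).comp t hZ).ofReal_comp
  have h2 := h1.mul (hW.pow m)
  refine h2.congr_deriv ?_
  simp [Function.comp]

lemma hasDerivAt_second (p : ℝ[X]) (m : ℕ) {Z Z1 : ℝ → ℝ} {W W1 : ℝ → ℂ} {z2 : ℝ} {w2 : ℂ} {t : ℝ}
    (hZ : HasDerivAt Z (Z1 t) t) (hW : HasDerivAt W (W1 t) t)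
    (hZ1 : HasDerivAt Z1 z2 t) (hW1 : HasDerivAt W1 w2 t) :
    HasDerivAt (fun t => (((derivative p).eval (Z t) : ℝ) : ℂ) * (Z1 t : ℂ) * W t ^ m +
        ((p.eval (Z t) : ℝ) : ℂ) * (m * W t ^ (m - 1) * W1 t))
      ((((derivative (derivative p)).eval (Z t) : ℝ) : ℂ) * (Z1 t : ℂ) ^ 2 * W t ^ m
        + (((derivative p).eval (Z t) : ℝ) : ℂ) * ((z2 : ℂ) * W t ^ m
          + 2 * (m * W t ^ (m - 1)) * ((Z1 t : ℂ) * W1 t))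
        + ((p.eval (Z t) : ℝ) : ℂ) * (m * ((m - 1 : ℕ) * W t ^ (m - 1 - 1)) * W1 t ^ 2
          + m * W t ^ (m - 1) * w2)) t := by
  have h1 := hasDerivAt_eval_mul_pow (derivative p) m hZ hW
  have h2 := hasDerivAt_eval_mul_pow p (m - 1) hZ hW
  have h3 := (h1.mul hZ1.ofReal_comp).add ((h2.const_mul (m : ℂ)).mul hW1)
  refine (h3.congr_of_eventuallyEq (Eventually.of_forall fun s => ?_)).congr_deriv ?_
  · simp only [Pi.add_apply, Pi.mul_apply]
    ring
  · ring

lemma norm_line (x : S2) (i : Fin 3) (t : ℝ) :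
    ‖x.1 + t • EuclideanSpace.single i (1 : ℝ)‖ = Real.sqrt (1 + 2 * t * x.1 i + t ^ 2) := by
  rw [← Real.sqrt_sq (norm_nonneg (x.1 + t • EuclideanSpace.single i (1 : ℝ)))]
  congr 1
  rw [norm_add_sq_real, mem_sphere_zero_iff_norm.1 x.2, norm_smul, inner_smul_right,
    EuclideanSpace.inner_single_right]
  simp
  ring

/-- The reciprocal of the distance to the origin on the line through `x` in direction `e_i`. -/
noncomputable def invNormLine (a t : ℝ) : ℝ := (Real.sqrt (1 + 2 * t * a + t ^ 2))⁻¹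

lemma invNormLine_zero (a : ℝ) : invNormLine a 0 = 1 := by simp [invNormLine]

lemma eventually_pos_line (a : ℝ) : ∀ᶠ t in 𝓝 (0 : ℝ), 0 < 1 + 2 * t * a + t ^ 2 := by
  have : Continuous fun t : ℝ => 1 + 2 * t * a + t ^ 2 := by fun_prop
  exact this.continuousAt.eventually (lt_mem_nhds (by simp))

lemma hasDerivAt_invNormLine (a t : ℝ) (h : 0 < 1 + 2 * t * a + t ^ 2) :
    HasDerivAt (invNormLine a) (-(a + t) * invNormLine a t ^ 3) t := by
  have h1 : HasDerivAt (fun t : ℝ => 1 + 2 * t * a + t ^ 2) (2 * a + 2 * t) t := by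
    refine ((((hasDerivAt_id t).const_mul 2).mul_const a).const_add 1 |>.add
      (hasDerivAt_pow 2 t)).congr_deriv ?_
    simp
  have h2 := (h1.sqrt h.ne').inv (Real.sqrt_pos.2 h).ne'
  refine h2.congr_deriv ?_
  have h3 := (Real.sqrt_pos.2 h).ne'
  rw [invNormLine]
  field_simp

lemma hasDerivAt_invNormLine_second (a : ℝ) :
    HasDerivAt (fun t => -(a + t) * invNormLine a t ^ 3) (3 * a ^ 2 - 1) 0 := by
  have h1 := hasDerivAt_invNormLine a 0 (by simp)
  have h2 := (((hasDerivAt_id (0 : ℝ)).const_add a).neg).mul (h1.pow 3)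
  refine h2.congr_deriv ?_
  simp [invNormLine_zero]
  ring

/-- Along a line through the point, a coordinate of x/|x| is the reciprocal norm times an affine
function. It is stated for a vector-valued coordinate so as to cover both the real z and the complex
x₀ + i x₁. -/
lemma hasDerivAt_coord_line {E : Type*} [NormedAddCommGroup E] [NormedSpace ℝ E] (a : ℝ)
    (c₀ c₁ : E) (t : ℝ) (h : 0 < 1 + 2 * t * a + t ^ 2) :
    HasDerivAt (fun t : ℝ => invNormLine a t • (c₀ + t • c₁))
      (invNormLine a t • c₁ + (-(a + t) * invNormLine a t ^ 3) • (c₀ + t • c₁)) t := by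
  have h1 : HasDerivAt (fun t : ℝ => c₀ + t • c₁) c₁ t := by
    simpa using ((hasDerivAt_id t).smul_const c₁).const_add c₀
  exact (hasDerivAt_invNormLine a t h).smul h1

lemma hasDerivAt_coord_line_second {E : Type*} [NormedAddCommGroup E] [NormedSpace ℝ E] (a : ℝ)
    (c₀ c₁ : E) :
    HasDerivAt (fun t : ℝ => invNormLine a t • c₁ +
        (-(a + t) * invNormLine a t ^ 3) • (c₀ + t • c₁))
      ((-2 * a) • c₁ + (3 * a ^ 2 - 1) • c₀) 0 := by
  have h1 : HasDerivAt (fun t : ℝ => c₀ + t • c₁) c₁ 0 := by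
    simpa using ((hasDerivAt_id (0 : ℝ)).smul_const c₁).const_add c₀
  have h2 := (hasDerivAt_invNormLine a 0 (by simp)).smul_const c₁
  refine (h2.add ((hasDerivAt_invNormLine_second a).smul h1)).congr_deriv ?_
  simp [invNormLine_zero]
  module

/-- The derivative of `p(z) (x + i y)^m`, extended constantly along rays, on a line. -/
noncomputable def lineDerivative (p : ℝ[X]) (m : ℕ) (a z d : ℝ) (w e : ℂ) (t : ℝ) : ℂ :=
  (((derivative p).eval (invNormLine a t • (z + t • d)) : ℝ) : ℂ) *
      ((invNormLine a t • d + (-(a + t) * invNormLine a t ^ 3) • (z + t • d) : ℝ) : ℂ) *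
      (invNormLine a t • (w + t • e)) ^ m +
    ((p.eval (invNormLine a t • (z + t • d)) : ℝ) : ℂ) *
      (m * (invNormLine a t • (w + t • e)) ^ (m - 1) *
        (invNormLine a t • e + (-(a + t) * invNormLine a t ^ 3) • (w + t • e)))

lemma hasDerivAt_lineDerivative (p : ℝ[X]) (m : ℕ) (a z d : ℝ) (w e : ℂ) (t : ℝ)
    (h : 0 < 1 + 2 * t * a + t ^ 2) :
    HasDerivAt (fun t : ℝ => ((p.eval (invNormLine a t • (z + t • d)) : ℝ) : ℂ) *
      (invNormLine a t • (w + t • e)) ^ m) (lineDerivative p m a z d w e t) t :=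
  hasDerivAt_eval_mul_pow p m
    (Z1 := fun t => invNormLine a t • d + (-(a + t) * invNormLine a t ^ 3) • (z + t • d))
    (W1 := fun t => invNormLine a t • e + (-(a + t) * invNormLine a t ^ 3) • (w + t • e))
    (hasDerivAt_coord_line a z d t h) (hasDerivAt_coord_line a w e t h)

lemma hasDerivAt_lineDerivative_zero (p : ℝ[X]) (m : ℕ) (a z d : ℝ) (w e : ℂ) :
    HasDerivAt (lineDerivative p m a z d w e)
      ((((derivative (derivative p)).eval z : ℝ) : ℂ) * (d - a * z : ℂ) ^ 2 * w ^ m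
        + (((derivative p).eval z : ℝ) : ℂ) * ((-2 * a * d + (3 * a ^ 2 - 1) * z : ℂ) * w ^ m
          + 2 * (m * w ^ (m - 1)) * ((d - a * z : ℂ) * (e - a * w)))
        + ((p.eval z : ℝ) : ℂ) * (m * ((m - 1 : ℕ) * w ^ (m - 1 - 1)) * (e - a * w) ^ 2
          + m * w ^ (m - 1) * (-2 * a * e + (3 * a ^ 2 - 1) * w))) 0 := by
  have h := hasDerivAt_second p m
    (Z1 := fun t => invNormLine a t • d + (-(a + t) * invNormLine a t ^ 3) • (z + t • d))
    (W1 := fun t => invNormLine a t • e + (-(a + t) * invNormLine a t ^ 3) • (w + t • e))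
    (hasDerivAt_coord_line a z d 0 (by simp)) (hasDerivAt_coord_line a w e 0 (by simp))
    (hasDerivAt_coord_line_second a z d) (hasDerivAt_coord_line_second a w e)
  refine HasDerivAt.congr_deriv (f := lineDerivative p m a z d w e) h ?_
  simp only [invNormLine_zero, zero_smul, add_zero, one_smul, one_pow, mul_one, smul_eq_mul,
    Complex.real_smul]
  push_cast
  ring_nf

/-- The extension of `p(z) (x + i y)^m` that is constant along rays. -/
noncomputable def harmonicExt (p : ℝ[X]) (m : ℕ) (x : E3) : ℂ :=
  ((p.eval (‖x‖⁻¹ • x 2) : ℝ) : ℂ) * (‖x‖⁻¹ • ((x 0 : ℂ) + (x 1 : ℂ) * Complex.I)) ^ m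

lemma contDiffAt_harmonicExt (p : ℝ[X]) (m : ℕ) {x : E3} (hx : x ≠ 0) {n : WithTop ℕ∞} :
    ContDiffAt ℝ n (harmonicExt p m) x := by
  have hn : ContDiffAt ℝ n (fun x : E3 => ‖x‖⁻¹) x :=
    (contDiffAt_norm ℝ hx).inv (norm_ne_zero_iff.2 hx)
  have hc : ∀ i : Fin 3, ContDiffAt ℝ n (fun x : E3 => x i) x := fun i =>
    (EuclideanSpace.proj (𝕜 := ℝ) i : E3 →L[ℝ] ℝ).contDiff.contDiffAt
  have hof : ∀ {f : E3 → ℝ}, ContDiffAt ℝ n f x → ContDiffAt ℝ n (fun x => (f x : ℂ)) x :=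
    fun h => Complex.ofRealCLM.contDiff.contDiffAt.comp x h
  have hp : ContDiff ℝ n fun y : ℝ => p.eval y := by
    simpa using p.contDiff_aeval (𝕜 := ℝ) n
  unfold harmonicExt
  refine ContDiffAt.mul (hof ?_) (ContDiffAt.pow (ContDiffAt.smul hn ?_) m)
  · exact hp.contDiffAt.comp x (hn.smul (hc 2))
  · exact (hof (hc 0)).add ((hof (hc 1)).mul contDiffAt_const)

lemma S2.ne_zero (x : S2) : x.1 ≠ 0 := by
  intro h
  have := mem_sphere_zero_iff_norm.1 x.2
  rw [h] at this
  simp at this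

/-- Chain rule for p(z) w^m, where z and w are extended constantly along rays: only the first-order
products and the Laplacians of z and w enter, and they are sums over the three axes. -/
lemma laplacian_harmonicExt (p : ℝ[X]) (m : ℕ) (x : S2) :
    Laplacian.laplacian (harmonicExt p m) x.1 =
      ((((1 - X ^ 2) * derivative (derivative p) - C (2 * ((m : ℝ) + 1)) * X * derivative p
        - C ((m : ℝ) * (m + 1)) * p).eval (x.1 2) : ℝ) : ℂ) * cplxCoord x ^ m := by
  let d : Fin 3 → ℝ := ![0, 0, 1]
  let e : Fin 3 → ℂ := ![1, Complex.I, 0]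
  have hline : ∀ i t, harmonicExt p m (x.1 + t • EuclideanSpace.single i (1 : ℝ)) =
      ((p.eval (invNormLine (x.1 i) t • (x.1 2 + t • d i)) : ℝ) : ℂ) *
        (invNormLine (x.1 i) t • (cplxCoord x + t • e i)) ^ m := by
    intro i t
    rw [harmonicExt, norm_line]
    simp only [invNormLine, cplxCoord]
    congr 3
    · fin_cases i <;> simp [d]
    · fin_cases i <;> simp [e]
      · ring
      · ring
  have hs : (x.1 0 : ℂ) ^ 2 + (x.1 1 : ℂ) ^ 2 + (x.1 2 : ℂ) ^ 2 = 1 := by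
    have := congrArg Complex.ofReal (sum_sq_coord x)
    push_cast at this
    exact this
  rw [laplacian_eq_sum_of_hasDerivAt (contDiffAt_harmonicExt p m x.ne_zero)
    (fun i => lineDerivative p m (x.1 i) (x.1 2) (d i) (cplxCoord x) (e i)) _ (fun i => ?_)
    (fun i => hasDerivAt_lineDerivative_zero p m (x.1 i) (x.1 2) (d i) (cplxCoord x) (e i))]
  swap
  · filter_upwards [eventually_pos_line (x.1 i)] with t ht
    simp only [hline]
    exact hasDerivAt_lineDerivative p m _ _ _ _ _ t ht
  simp only [Fin.sum_univ_three, d, e, Matrix.cons_val, eval_sub, eval_mul, eval_C, eval_X, eval_pow,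
    eval_one]
  have hw : cplxCoord x = x.1 0 + x.1 1 * Complex.I := rfl
  generalize cplxCoord x = w at *
  generalize (x.1 0 : ℂ) = a at *
  generalize (x.1 1 : ℂ) = b at *
  push_cast
  generalize ((eval (x.1 2) p : ℝ) : ℂ) = q
  generalize ((eval (x.1 2) (derivative p) : ℝ) : ℂ) = q1
  generalize ((eval (x.1 2) (derivative (derivative p)) : ℝ) : ℂ) = q2
  generalize (x.1 2 : ℂ) = z at *
  have hi := Complex.I_sq
  -- `e1` to `e5` are, in order, |∇z|² = 1 - z², △z = -2z, ∇w·∇w = -w² (without conjugation), △w =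
  -- -2w and ∇z·∇w = -zw on the sphere.
  have e1 : (0 - a * z) ^ 2 + (0 - b * z) ^ 2 + (1 - z * z) ^ 2 = 1 - z ^ 2 := by
    linear_combination z ^ 2 * hs
  have e2 : (-2 * a * 0 + (3 * a ^ 2 - 1) * z) + (-2 * b * 0 + (3 * b ^ 2 - 1) * z) +
      (-2 * z * 1 + (3 * z ^ 2 - 1) * z) = -2 * z := by
    linear_combination 3 * z * hs
  have e3 : (1 - a * w) ^ 2 + (Complex.I - b * w) ^ 2 + (0 - z * w) ^ 2 = - w ^ 2 := by
    linear_combination w ^ 2 * hs + hi + 2 * w * hw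
  have e4 : (-2 * a * 1 + (3 * a ^ 2 - 1) * w) + (-2 * b * Complex.I + (3 * b ^ 2 - 1) * w) +
      (-2 * z * 0 + (3 * z ^ 2 - 1) * w) = -2 * w := by
    linear_combination 3 * w * hs + 2 * hw
  have e5 : (0 - a * z) * (1 - a * w) + (0 - b * z) * (Complex.I - b * w) +
      (1 - z * z) * (0 - z * w) = - z * w := by
    linear_combination z * w * hs + z * hw
  -- The exponents m - 1 and m - 1 - 1 are truncated at 0; the prefactors m and m - 1 vanish exactly
  -- where that happens.
  have e6 : (m : ℂ) * w ^ (m - 1) * w = m * w ^ m := by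
    rcases m with _ | m
    · simp
    · simp [pow_succ, mul_assoc]
  have e7 : (m : ℂ) * ((m - 1 : ℕ) * w ^ (m - 1 - 1)) * w ^ 2 = m * (m - 1) * w ^ m := by
    rcases m with _ | _ | m
    · simp
    · simp
    · simp only [Nat.add_one_sub_one]
      push_cast
      ring
  linear_combination (q2 * w ^ m) * e1 + q1 * w ^ m * e2 + 2 * q1 * (m * w ^ (m - 1)) * e5
    + q * (m * ((m - 1 : ℕ) * w ^ (m - 1 - 1))) * e3 + q * m * w ^ (m - 1) * e4
    - (2 * q1 * z) * e6 - q * e7 - 2 * q * e6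

/-- The real-linear map L stands for taking real parts, scalar multiples and conjugation at once, so
that all orders, positive or negative, are covered by one real-valued computation. -/
lemma radialExt_comp (L : ℂ →L[ℝ] ℝ) (p : ℝ[X]) (m : ℕ) {x : E3} (hx : x ≠ 0) :
    radialExt (fun y => L (((p.eval (y.1 2) : ℝ) : ℂ) * cplxCoord y ^ m)) x
      = (L ∘ harmonicExt p m) x := by
  rw [radialExt, dif_pos hx]
  simp only [Function.comp, harmonicExt, cplxCoord]
  congr 4
  simp
  ring

lemma sphSmooth_comp (L : ℂ →L[ℝ] ℝ) (p : ℝ[X]) (m : ℕ) :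
    SphSmooth (fun y => L (((p.eval (y.1 2) : ℝ) : ℂ) * cplxCoord y ^ m)) := by
  have : ContDiffOn ℝ (⊤ : ℕ∞) (L ∘ harmonicExt p m) {0}ᶜ := fun x hx =>
    (L.contDiff.contDiffAt.comp x (contDiffAt_harmonicExt p m hx)).contDiffWithinAt
  exact this.congr fun x hx => radialExt_comp L p m hx

/-- L commutes with the Laplacian, and the differential equation of Q_{lm} turns the coefficient
m(m+1) into l(l+1), because (l-m)(l+m+1) + m(m+1) = l(l+1). -/
lemma sphLaplacian_comp (L : ℂ →L[ℝ] ℝ) (l m : ℕ) (x : S2) :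
    sphLaplacian (fun y => L ((((legendreD l m).eval (y.1 2) : ℝ) : ℂ) * cplxCoord y ^ m)) x =
      -(sphEigenvalue l) * L ((((legendreD l m).eval (x.1 2) : ℝ) : ℂ) * cplxCoord x ^ m) := by
  have hev : radialExt (fun y => L ((((legendreD l m).eval (y.1 2) : ℝ) : ℂ) * cplxCoord y ^ m))
      =ᶠ[𝓝 x.1] L ∘ harmonicExt (legendreD l m) m := by
    filter_upwards [isOpen_compl_singleton.mem_nhds x.ne_zero] with y hy
    exact radialExt_comp L _ m hy
  rw [sphLaplacian, (InnerProductSpace.laplacian_congr_nhds hev).eq_of_nhds,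
    ContDiffAt.laplacian_CLM_comp_left (contDiffAt_harmonicExt _ m x.ne_zero), Function.comp,
    laplacian_harmonicExt, ← smul_eq_mul (-sphEigenvalue l), ← map_smul, Complex.real_smul,
    ← mul_assoc, ← Complex.ofReal_mul]
  congr 4
  have h := congrArg (eval (x.1 2)) (legendreD_ode l m)
  simp only [derivative_legendreD, sphEigenvalue, eval_sub, eval_mul, eval_C, eval_X, eval_pow,
    eval_one, eval_add, eval_zero] at h ⊢
  linear_combination h

/-- The real parts of multiples of the spherical harmonics are smooth eigenfunctions. -/
lemma sphHarmonic_eigenfunction (l : ℕ) (k : ℤ) (c : ℂ) :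
    SphSmooth (fun x => (c * sphHarmonic l k x).re) ∧
      ∀ x, sphLaplacian (fun x => (c * sphHarmonic l k x).re) x =
        -(sphEigenvalue l) * (c * sphHarmonic l k x).re := by
  obtain ⟨L, hL⟩ : ∃ L : ℂ →L[ℝ] ℝ, (fun x => (c * sphHarmonic l k x).re) =
      fun y => L ((((legendreD l k.natAbs).eval (y.1 2) : ℝ) : ℂ) * cplxCoord y ^ k.natAbs) := by
    set s := Real.sqrt ((2 * l + 1) / (4 * Real.pi) *
      ((l - k.natAbs).factorial / (l + k.natAbs).factorial)) * (-1) ^ k.natAbs with hs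
    by_cases hk : 0 ≤ k
    · refine ⟨Complex.reCLM ∘L ContinuousLinearMap.mul ℝ ℂ (c * s), funext fun x => ?_⟩
      simp only [sphHarmonic_eq, angularPart, if_pos hk, harmonicPoly, ← hs, eval_mul, eval_C,
        ContinuousLinearMap.comp_apply, ContinuousLinearMap.mul_apply', Complex.reCLM_apply,
        Complex.ofReal_mul]
      congr 1
      ring
    -- For negative order the conjugation is absorbed into L.
    · refine ⟨Complex.reCLM ∘L ContinuousLinearMap.mul ℝ ℂ (c * s * (-1) ^ k.natAbs) ∘L
        Complex.conjCLE.toContinuousLinearMap, funext fun x => ?_⟩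
      simp only [sphHarmonic_eq, angularPart, if_neg hk, harmonicPoly, ← hs, eval_mul, eval_C,
        ContinuousLinearMap.comp_apply, ContinuousLinearMap.mul_apply', Complex.reCLM_apply,
        Complex.ofReal_mul, ContinuousLinearEquiv.coe_coe, Complex.conjCLE_apply, map_mul, map_pow,
        Complex.conj_ofReal]
      congr 1
      ring
  rw [hL]
  refine ⟨sphSmooth_comp L _ _, fun x => ?_⟩
  have h2 := congrFun hL x
  simp only at h2
  rw [sphLaplacian_comp, h2]

lemma SphSmooth.continuous {f : S2 → ℝ} (hf : SphSmooth f) : Continuous f := by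
  have h : f = fun x : S2 => radialExt f x.1 := by
    funext x
    rw [radialExt, dif_pos x.ne_zero]
    congr 1
    ext
    simp
  rw [h]
  exact hf.continuousOn.comp_continuous continuous_subtype_val fun x => x.ne_zero

end Eigenfunctions

/-! ### Zonal kernels -/

section Kernels

lemma conj_sphHarmonic (l : ℕ) (m : ℤ) (x : S2) :
    (starRingEnd ℂ) (sphHarmonic l m x) = (-1) ^ m.natAbs * sphHarmonic l (-m) x := by
  have h2 : (((-1 : ℂ)) ^ m.natAbs) * (-1) ^ m.natAbs = 1 := by rw [← mul_pow]; simp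
  rcases lt_trichotomy m 0 with h | h | h
  · rw [sphHarmonic, sphHarmonic, if_neg (by omega), if_pos (by omega), map_mul, Complex.conj_conj]
    simp
  · subst h
    have h3 : sphHarmonic 0 0 x = sphHarmonic 0 0 x := rfl
    simp [sphHarmonic_eq, angularPart]
  · rw [sphHarmonic, sphHarmonic, if_pos (by omega), if_neg (by omega)]
    simp only [Int.natAbs_neg]
    rw [← mul_assoc, h2, one_mul]

/-- The reproducing kernel of the spherical harmonics of degree `l`. -/
noncomputable def zonal (l : ℕ) (x y : S2) : ℝ :=
  (∑ m ∈ Finset.Icc (-(l : ℤ)) l, sphHarmonic l m x * (starRingEnd ℂ) (sphHarmonic l m y)).re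

/-- Conjugation exchanges the terms m and -m, the signs (-1)^m cancelling in pairs, so the sum is
real. -/
lemma ofReal_zonal (l : ℕ) (x y : S2) : ((zonal l x y : ℝ) : ℂ) =
    ∑ m ∈ Finset.Icc (-(l : ℤ)) l, sphHarmonic l m x * (starRingEnd ℂ) (sphHarmonic l m y) := by
  rw [zonal]
  refine Complex.conj_eq_iff_re.1 ?_
  rw [map_sum]
  refine Finset.sum_nbij' (fun m => -m) (fun m => -m) ?_ ?_ (by simp) (by simp) ?_
  · intro m hm; simp only [Finset.mem_Icc] at hm ⊢; omega
  · intro m hm; simp only [Finset.mem_Icc] at hm ⊢; omega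
  · intro m _
    have h2 : (((-1 : ℂ)) ^ m.natAbs) * (-1) ^ m.natAbs = 1 := by rw [← mul_pow]; simp
    rw [conj_sphHarmonic l (-m) y, map_mul, Complex.conj_conj, conj_sphHarmonic l m x, neg_neg,
      Int.natAbs_neg]
    ring

lemma continuous_zonal (l : ℕ) : Continuous fun p : S2 × S2 => zonal l p.1 p.2 := by
  unfold zonal
  refine Complex.continuous_re.comp (continuous_finsetSum _ fun m _ => ?_)
  exact ((continuous_sphHarmonic l m).comp continuous_fst).mul
    (Complex.continuous_conj.comp ((continuous_sphHarmonic l m).comp continuous_snd))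

lemma zonal_comm (l : ℕ) (x y : S2) : zonal l x y = zonal l y x := by
  have h := congrArg (starRingEnd ℂ) (ofReal_zonal l x y)
  rw [Complex.conj_ofReal, map_sum] at h
  apply Complex.ofReal_injective
  rw [h, ofReal_zonal]
  refine Finset.sum_congr rfl fun m _ => ?_
  rw [map_mul, Complex.conj_conj, mul_comm]

/-- The inequality 2ab ≤ a² + b² reduces to the diagonal, where Unsöld's theorem gives the exact
value. -/
lemma abs_zonal_le (l : ℕ) (x y : S2) : |zonal l x y| ≤ (2 * l + 1) / (4 * Real.pi) := by
  rw [← Real.norm_eq_abs, ← Complex.norm_real, ofReal_zonal]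
  refine (norm_sum_le _ _).trans ?_
  calc ∑ m ∈ Finset.Icc (-(l : ℤ)) l, ‖sphHarmonic l m x * (starRingEnd ℂ) (sphHarmonic l m y)‖
      ≤ ∑ m ∈ Finset.Icc (-(l : ℤ)) l,
        (‖sphHarmonic l m x‖ ^ 2 + ‖sphHarmonic l m y‖ ^ 2) / 2 := by
        refine Finset.sum_le_sum fun m _ => ?_
        rw [norm_mul, RCLike.norm_conj]
        nlinarith [sq_nonneg (‖sphHarmonic l m x‖ - ‖sphHarmonic l m y‖)]
    _ = _ := by
        rw [← Finset.sum_div, Finset.sum_add_distrib, sum_norm_sq_sphHarmonic,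
          sum_norm_sq_sphHarmonic]
        ring

lemma continuous_zonal_right (l : ℕ) (x : S2) : Continuous (zonal l x) := by
  have h : Continuous (Function.uncurry (zonal l)) := continuous_zonal l
  exact h.uncurry_left x

lemma integral_zonal_mul_sphHarmonic (l k : ℕ) (m : ℤ) (hm : m.natAbs ≤ k) (x : S2) :
    ∫ y, (zonal l x y : ℂ) * sphHarmonic k m y ∂sphMeasure
      = if l = k then sphHarmonic k m x else 0 := by
  simp only [ofReal_zonal, Finset.sum_mul]
  rw [integral_finsetSum]
  · have : ∀ j : ℤ, ∫ y, sphHarmonic l j x * (starRingEnd ℂ) (sphHarmonic l j y) *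
        sphHarmonic k m y ∂sphMeasure
        = sphHarmonic l j x * if k = l ∧ m = j then 1 else 0 := by
      intro j
      rw [← integral_sphHarmonic k l m j hm, ← integral_const_mul]
      refine integral_congr_ae (Eventually.of_forall fun y => ?_)
      ring
    simp only [this]
    by_cases h : l = k
    · subst h
      simp only [true_and, mul_ite, mul_one, mul_zero, Finset.sum_ite_eq, if_true]
      rw [if_pos (by rw [Finset.mem_Icc]; omega)]
    · simp [h, Ne.symm h]
  · intro j _
    refine integrable_of_continuous_S2 _ ?_
    exact (continuous_const.mul (Complex.continuous_conj.comp (continuous_sphHarmonic l j))).mul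
      (continuous_sphHarmonic k m)

/-- `∑_l a_l ∑_{|m| ≤ l} Y_{lm}(x) Y_{lm}(y)^*`. -/
noncomputable def sumKernel (a : ℕ → ℝ) (x y : S2) : ℝ := ∑' l, a l * zonal l x y

/-- The summability that makes `sumKernel` uniformly convergent. -/
def KernelSummable (a : ℕ → ℝ) : Prop := Summable fun l : ℕ => |a l| * ((2 * l + 1) / (4 * Real.pi))

variable {a : ℕ → ℝ}

lemma abs_mul_zonal_le (a : ℕ → ℝ) (l : ℕ) (x y : S2) :
    ‖a l * zonal l x y‖ ≤ |a l| * ((2 * l + 1) / (4 * Real.pi)) := by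
  rw [Real.norm_eq_abs, abs_mul]
  exact mul_le_mul_of_nonneg_left (abs_zonal_le l x y) (abs_nonneg _)

lemma hasSum_sumKernel (ha : KernelSummable a) (x y : S2) :
    HasSum (fun l => a l * zonal l x y) (sumKernel a x y) :=
  (Summable.of_norm_bounded ha fun l => abs_mul_zonal_le a l x y).hasSum

lemma continuous_sumKernel (ha : KernelSummable a) :
    Continuous fun p : S2 × S2 => sumKernel a p.1 p.2 :=
  continuous_tsum (fun l => continuous_const.mul (continuous_zonal l)) ha
    fun l p => abs_mul_zonal_le a l p.1 p.2

lemma continuous_sumKernel_right (ha : KernelSummable a) (x : S2) : Continuous (sumKernel a x) := by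
  have h : Continuous (Function.uncurry (sumKernel a)) := continuous_sumKernel ha
  exact h.uncurry_left x

lemma abs_sumKernel_le (ha : KernelSummable a) (x y : S2) :
    |sumKernel a x y| ≤ ∑' l : ℕ, |a l| * ((2 * l + 1) / (4 * Real.pi)) :=
  tsum_of_norm_bounded ha.hasSum fun l => abs_mul_zonal_le a l x y

lemma hasSum_integral_sumKernel {F : Type*} [NormedAddCommGroup F] [NormedSpace ℝ F]
    [CompleteSpace F] (ha : KernelSummable a) (x : S2) {f : S2 → F} (hf : Integrable f sphMeasure) :
    HasSum (fun l => a l • ∫ y, zonal l x y • f y ∂sphMeasure)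
      (∫ y, sumKernel a x y • f y ∂sphMeasure) := by
  have h := hasSum_integral_of_summable_integral_norm (μ := sphMeasure)
    (F := fun l y => (a l * zonal l x y) • f y) (fun l => ?_) ?_
  · have h2 : ∀ y, ∑' l, (a l * zonal l x y) • f y = sumKernel a x y • f y := fun y =>
      ((hasSum_sumKernel ha x y).smul_const (f y)).tsum_eq
    simp only [h2] at h
    convert! h using 2 with l
    rw [← integral_smul]
    simp only [mul_smul]
  · refine hf.bdd_smul (|a l| * ((2 * l + 1) / (4 * Real.pi)))
      ((continuous_const.mul (continuous_zonal_right l x)).aestronglyMeasurable)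
      (Eventually.of_forall fun y => abs_mul_zonal_le a l x y)
  · refine Summable.of_nonneg_of_le (fun l => integral_nonneg fun y => norm_nonneg _) (fun l => ?_)
      (ha.mul_right (∫ y, ‖f y‖ ∂sphMeasure))
    rw [← integral_const_mul]
    refine integral_mono_of_nonneg (Eventually.of_forall fun y => norm_nonneg _)
      (hf.norm.const_mul _) (Eventually.of_forall fun y => ?_)
    simp only [norm_smul]
    exact mul_le_mul_of_nonneg_right (abs_mul_zonal_le a l x y) (norm_nonneg _)

lemma integral_sumKernel_mul_sphHarmonic (ha : KernelSummable a) (k : ℕ) (m : ℤ)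
    (hm : m.natAbs ≤ k) (x : S2) :
    ∫ y, (sumKernel a x y) • sphHarmonic k m y ∂sphMeasure = a k • sphHarmonic k m x := by
  have h := hasSum_integral_sumKernel ha x
    (integrable_of_continuous_S2 sphMeasure (continuous_sphHarmonic k m))
  refine h.unique ?_
  have h2 : ∀ l, a l • ∫ y, zonal l x y • sphHarmonic k m y ∂sphMeasure
      = if l = k then a k • sphHarmonic k m x else 0 := by
    intro l
    have := integral_zonal_mul_sphHarmonic l k m hm x
    simp only [← Complex.real_smul] at this
    rw [this]
    split_ifs with h
    · rw [h]
    · simp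
  simp only [h2]
  exact hasSum_ite_eq k _

/-- A finite measure acting on spherical harmonics as multiplication by `a_l` followed by
evaluation at `x` has the density `sumKernel a x`. -/
lemma eq_withDensity_of_integral_sphHarmonic (ha : KernelSummable a) (x : S2) (ν : Measure S2)
    [IsFiniteMeasure ν]
    (h : ∀ (l : ℕ) (m : ℤ), m.natAbs ≤ l → ∫ y, sphHarmonic l m y ∂ν = a l • sphHarmonic l m x) :
    (0 ≤ᵐ[sphMeasure] sumKernel a x) ∧
      ν = sphMeasure.withDensity fun y => ENNReal.ofReal (sumKernel a x y) := by
  have hk := continuous_sumKernel_right ha x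
  -- Both sides are continuous functionals of g that agree on the spherical harmonics, hence on all
  -- of C(S²).
  have hcont : ∀ g : C(S2, ℂ), ∫ y, g y ∂ν = ∫ y, sumKernel a x y • g y ∂sphMeasure := by
    let Φ : C(S2, ℂ) →L[ℂ] ℂ := (LinearMap.mkContinuous
      { toFun := fun g => ∫ y, g y ∂ν
        map_add' := fun g g' => integral_add (integrable_of_continuous_S2 _ g.continuous)
          (integrable_of_continuous_S2 _ g'.continuous)
        map_smul' := fun c g => integral_const_mul _ _ } (ν.real Set.univ) (fun g => by
          rw [mul_comm]
          exact norm_integral_le_of_norm_le_const (Eventually.of_forall fun y => g.norm_coe_le_norm y)))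
    let Ψ : C(S2, ℂ) →L[ℂ] ℂ := (LinearMap.mkContinuous
      { toFun := fun g => ∫ y, sumKernel a x y • g y ∂sphMeasure
        map_add' := fun g g' => by
          simp only [ContinuousMap.add_apply, smul_add]
          exact integral_add (integrable_of_continuous_S2 _ (hk.smul g.continuous))
            (integrable_of_continuous_S2 _ (hk.smul g'.continuous))
        map_smul' := fun c g => by
          simp only [ContinuousMap.smul_apply, smul_comm _ c]
          exact integral_smul _ _ }
      ((∑' l : ℕ, |a l| * ((2 * l + 1) / (4 * Real.pi))) * sphMeasure.real Set.univ) (fun g => by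
        refine (norm_integral_le_of_norm_le_const
          (C := (∑' l : ℕ, |a l| * ((2 * l + 1) / (4 * Real.pi))) * ‖g‖)
          (Eventually.of_forall fun y => ?_)).trans (le_of_eq (by ring))
        rw [norm_smul]
        exact mul_le_mul (abs_sumKernel_le ha x y) (g.norm_coe_le_norm y) (norm_nonneg _)
          ((abs_nonneg _).trans (abs_sumKernel_le ha x y))))
    have : Φ = Ψ := continuousLinearMap_ext_sphHarmonic Φ Ψ fun l m hm =>
      (h l m hm).trans (integral_sumKernel_mul_sphHarmonic ha l m hm x).symm
    intro g
    exact congrArg (fun L : C(S2, ℂ) →L[ℂ] ℂ => L g) this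
  have hreal : ∀ g : S2 → ℝ, Continuous g → ∫ y, g y ∂ν = ∫ y, sumKernel a x y * g y ∂sphMeasure := by
    intro g hg
    have h1 := hcont ⟨fun y => (g y : ℂ), Complex.continuous_ofReal.comp hg⟩
    simp only [ContinuousMap.coe_mk, Complex.real_smul, ← Complex.ofReal_mul] at h1
    rw [integral_complex_ofReal, integral_complex_ofReal] at h1
    exact Complex.ofReal_injective h1
  -- Positivity is inherited from ν: tested against ν the negative part of the kernel has a
  -- nonnegative integral, but against the kernel it gives minus the integral of its square.
  have hpos : 0 ≤ᵐ[sphMeasure] sumKernel a x := by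
    have hn : Continuous fun y => max (-sumKernel a x y) 0 := hk.neg.max continuous_const
    have h1 := hreal _ hn
    have h2 : 0 ≤ ∫ y, max (-sumKernel a x y) 0 ∂ν := integral_nonneg fun y => le_max_right _ _
    have h3 : ∀ y, sumKernel a x y * max (-sumKernel a x y) 0 = -(max (-sumKernel a x y) 0) ^ 2 := by
      intro y
      rcases le_total (sumKernel a x y) 0 with hy | hy
      · rw [max_eq_left (by linarith)]; ring
      · rw [max_eq_right (by linarith)]; ring
    simp only [h3, integral_neg] at h1
    have h4 : ∫ y, (max (-sumKernel a x y) 0) ^ 2 ∂sphMeasure = 0 :=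
      le_antisymm (by linarith) (integral_nonneg fun y => sq_nonneg _)
    rw [integral_eq_zero_iff_of_nonneg (fun y => sq_nonneg _)
      (integrable_of_continuous_S2 _ (hn.pow 2))] at h4
    filter_upwards [h4] with y hy
    have h5 : max (-sumKernel a x y) 0 = 0 := by simpa using hy
    have := le_max_left (-sumKernel a x y) 0
    simp only [Pi.zero_apply]
    linarith
  refine ⟨hpos, ?_⟩
  have hfin : IsFiniteMeasure (sphMeasure.withDensity fun y => ENNReal.ofReal (sumKernel a x y)) :=
    isFiniteMeasure_withDensity_ofReal (integrable_of_continuous_S2 _ hk).2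
  refine ext_of_forall_integral_eq_of_IsFiniteMeasure fun g => ?_
  rw [hreal g g.continuous, integral_withDensity_eq_integral_toReal_smul hk.measurable.ennreal_ofReal
    (by simp)]
  refine integral_congr_ae ?_
  filter_upwards [hpos] with y hy
  rw [ENNReal.toReal_ofReal hy, smul_eq_mul]

/-- The density is bounded, so the identity extends from continuous functions to merely integrable
ones; realizations of the field are only of the latter kind. -/
lemma integrable_and_integral_of_integral_sphHarmonic (ha : KernelSummable a) (x : S2)
    (ν : Measure S2) [IsFiniteMeasure ν]
    (h : ∀ (l : ℕ) (m : ℤ), m.natAbs ≤ l → ∫ y, sphHarmonic l m y ∂ν = a l • sphHarmonic l m x)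
    {f : S2 → ℝ} (hf : Integrable f sphMeasure) :
    Integrable f ν ∧ ∫ y, f y ∂ν = ∫ y, sumKernel a x y * f y ∂sphMeasure := by
  obtain ⟨hpos, hν⟩ := eq_withDensity_of_integral_sphHarmonic ha x ν h
  have hk := continuous_sumKernel_right ha x
  rw [hν]
  have hfi : Integrable (fun y => sumKernel a x y * f y) sphMeasure :=
    hf.bdd_mul (c := ∑' l : ℕ, |a l| * ((2 * l + 1) / (4 * Real.pi))) hk.aestronglyMeasurable
      (Eventually.of_forall fun y => abs_sumKernel_le ha x y)
  have hae : (fun y => (ENNReal.ofReal (sumKernel a x y)).toReal • f y)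
      =ᵐ[sphMeasure] fun y => sumKernel a x y * f y := by
    filter_upwards [hpos] with y hy
    rw [ENNReal.toReal_ofReal hy, smul_eq_mul]
  constructor
  · rw [integrable_withDensity_iff_integrable_smul' hk.measurable.ennreal_ofReal (by simp)]
    exact hfi.congr hae.symm
  · rw [integral_withDensity_eq_integral_toReal_smul hk.measurable.ennreal_ofReal (by simp)]
    exact integral_congr_ae hae

end Kernels

/-! ### Rotational Brownian motion and its subordination -/

section Brownian

variable {Ω : Type*} [mΩ : MeasurableSpace Ω] {P : Measure Ω} [IsProbabilityMeasure P]

/-- The type `Ω` with the `σ`-algebra `m`. -/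
def WithSigma (Ω : Type*) (_ : MeasurableSpace Ω) : Type _ := Ω

instance (m : MeasurableSpace Ω) : MeasurableSpace (WithSigma Ω m) := m

/-- The identity as a map to `Ω` with a smaller `σ`-algebra. -/
def toSigma (m : MeasurableSpace Ω) (ω : Ω) : WithSigma Ω m := ω

lemma measurable_toSigma {m : MeasurableSpace Ω} (hm : m ≤ mΩ) :
    @Measurable Ω (WithSigma Ω m) mΩ _ (toSigma m) :=
  fun s hs => hm s hs

omit [IsProbabilityMeasure P] in
lemma indepFun_toSigma {β : Type*} [mβ : MeasurableSpace β] {m : MeasurableSpace Ω} {Y : Ω → β}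
    (h : Indep m (MeasurableSpace.comap Y mβ) P) : IndepFun (toSigma m) Y P := by
  rw [IndepFun_iff_Indep]
  have : MeasurableSpace.comap (toSigma m) inferInstance = m := MeasurableSpace.comap_id
  rwa [this]

section Freezing

variable {Ω₁ β E : Type*} [MeasurableSpace Ω₁] [MeasurableSpace β] [NormedAddCommGroup E]
  {X : Ω → Ω₁} {Y : Ω → β} {F : Ω₁ × β → E}

lemma ProbabilityTheory.IndepFun.integrable_comp_iff (h : IndepFun X Y P) (hX : Measurable X) (hY : Measurable Y)
    (hF : StronglyMeasurable F) : Integrable (fun ω => F (X ω, Y ω)) P ↔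
      Integrable F ((P.map X).prod (P.map Y)) := by
  rw [← (indepFun_iff_map_prod_eq_prod_map_map hX.aemeasurable hY.aemeasurable).1 h,
    integrable_map_measure hF.aestronglyMeasurable (hX.prodMk hY).aemeasurable]
  rfl

variable [NormedSpace ℝ E]

/-- Independence makes the joint law a product; Fubini then allows `X` to be frozen while `Y` is
averaged out. -/
lemma ProbabilityTheory.IndepFun.integral_comp_prodMk (h : IndepFun X Y P) (hX : Measurable X) (hY : Measurable Y)
    (hF : StronglyMeasurable F) (hi : Integrable (fun ω => F (X ω, Y ω)) P) :
    ∫ ω, F (X ω, Y ω) ∂P = ∫ ω, ∫ ω', F (X ω, Y ω') ∂P ∂P := by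
  have hi' := (h.integrable_comp_iff hX hY hF).1 hi
  have h1 : ∫ ω, F (X ω, Y ω) ∂P = ∫ p, F p ∂((P.map X).prod (P.map Y)) := by
    rw [← (indepFun_iff_map_prod_eq_prod_map_map hX.aemeasurable hY.aemeasurable).1 h,
      integral_map (hX.prodMk hY).aemeasurable hF.aestronglyMeasurable]
  rw [h1, integral_prod _ hi',
    integral_map hX.aemeasurable hF.integral_prod_right'.aestronglyMeasurable]
  refine integral_congr_ae (Eventually.of_forall fun ω => ?_)
  exact integral_map hY.aemeasurable (hF.comp_measurable measurable_prodMk_left).aestronglyMeasurable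

end Freezing

variable {x : S2} {B : ℝ≥0 → Ω → S2}

omit [IsProbabilityMeasure P] in
lemma IsRotationalBrownianMotion.measurable_uncurry (hB : IsRotationalBrownianMotion x B P) :
    Measurable fun p : ℝ≥0 × Ω => B p.1 p.2 :=
  measurable_uncurry_of_continuous_of_measurable (u := B) hB.continuous hB.measurable

/-- The expectation of an eigenfunction of the spherical Laplacian along the Brownian motion. -/
lemma IsRotationalBrownianMotion.integral_eigenfunction (hB : IsRotationalBrownianMotion x B P)
    {f : S2 → ℝ} (hf : SphSmooth f) {μ : ℝ} (hμ : ∀ y, sphLaplacian f y = -μ * f y) (t : ℝ≥0) :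
    ∫ ω, f (B t ω) ∂P = Real.exp (-(t * μ)) * f x := by
  have hfc := hf.continuous
  obtain ⟨K, hK⟩ : ∃ K, ∀ y, ‖f y‖ ≤ K := by
    obtain ⟨K, hK⟩ := isCompact_univ.exists_bound_of_continuousOn hfc.continuousOn
    exact ⟨K, fun y => hK y trivial⟩
  set g : ℝ → ℝ := fun s => ∫ ω, f (B s.toNNReal ω) ∂P with hg
  have hgc : Continuous g := by
    refine continuous_of_dominated (bound := fun _ => K) (fun s => ?_) (fun s => ?_)
      (integrable_const _) ?_
    · exact (hfc.measurable.comp (hB.measurable _)).aestronglyMeasurable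
    · exact Eventually.of_forall fun ω => hK _
    · exact Eventually.of_forall fun ω =>
        hfc.comp ((hB.continuous ω).comp continuous_real_toNNReal)
  have hint : ∀ s : ℝ≥0, Integrable (fun ω => f (B s ω)) P := fun s =>
    Integrable.of_bound (hfc.measurable.comp (hB.measurable s)).aestronglyMeasurable K
      (Eventually.of_forall fun ω => hK _)
  have hjoint : Measurable fun p : ℝ × Ω => f (B p.1.toNNReal p.2) :=
    hfc.measurable.comp (hB.measurable_uncurry.comp
      ((measurable_real_toNNReal.comp measurable_fst).prodMk measurable_snd))
  have hI : ∀ t : ℝ≥0, Integrable (Function.uncurry fun (ω : Ω) (s : ℝ) => f (B s.toNNReal ω))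
      (P.prod (volume.restrict (Set.Ioc 0 (t : ℝ)))) := fun t =>
    Integrable.of_bound (hjoint.comp measurable_swap).aestronglyMeasurable K
      (Eventually.of_forall fun ω => hK _)
  have hswap : ∀ t : ℝ≥0, ∫ ω, (∫ s in (0 : ℝ)..t, f (B s.toNNReal ω)) ∂P = ∫ s in (0 : ℝ)..t, g s := by
    intro t
    simp only [intervalIntegral.integral_of_le t.coe_nonneg]
    exact integral_integral_swap (hI t)
  have hIω : ∀ t : ℝ≥0, Integrable (fun ω => ∫ s in (0 : ℝ)..t, f (B s.toNNReal ω)) P := by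
    intro t
    simp only [intervalIntegral.integral_of_le t.coe_nonneg]
    exact (hI t).integral_prod_left
  -- Taking expectations in the martingale problem, with △f = -μ f, gives an integral equation for
  -- g.
  have hmain : ∀ t : ℝ≥0, g t = f x - μ * ∫ s in (0 : ℝ)..t, g s := by
    intro t
    have h1 := (hB.martingale f hf).setIntegral_eq (zero_le : 0 ≤ t) MeasurableSet.univ
    simp only [Measure.restrict_univ, hμ, intervalIntegral.integral_const_mul, NNReal.coe_zero,
      intervalIntegral.integral_same, sub_zero] at h1
    have h0 : ∫ ω, (f (B 0 ω) - f x) ∂P = 0 := by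
      refine integral_eq_zero_of_ae ?_
      filter_upwards [hB.start] with ω hω
      simp [hω]
    rw [h0] at h1
    have h2 : ∫ ω, (f (B t ω) - f x - -μ * ∫ s in (0 : ℝ)..t, f (B s.toNNReal ω)) ∂P
        = g t - f x - -μ * ∫ s in (0 : ℝ)..t, g s := by
      have i1 : Integrable (fun ω => f (B t ω) - f x) P := (hint t).sub (integrable_const _)
      rw [integral_sub i1 ((hIω t).const_mul _),
        integral_sub (hint t) (integrable_const _), integral_const_mul, hswap]
      simp [hg]
    rw [h2] at h1
    linarith
  have hG : ∀ s, HasDerivAt (fun t : ℝ => ∫ s in (0 : ℝ)..t, g s) (g s) s := fun s =>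
    intervalIntegral.integral_hasDerivAt_right (hgc.intervalIntegrable _ _)
      hgc.aestronglyMeasurable.stronglyMeasurableAtFilter hgc.continuousAt
  -- Integrating factor: by `hmain`, H(s) = e^{μs} g(s) for s ≥ 0 and its derivative vanishes there,
  -- so H(t) = H(0) = f(x).
  set H : ℝ → ℝ := fun s => Real.exp (μ * s) * (f x - μ * ∫ r in (0 : ℝ)..s, g r) with hH
  have hHd : ∀ s, HasDerivAt H (Real.exp (μ * s) * μ * (f x - μ * ∫ r in (0 : ℝ)..s, g r)
      + Real.exp (μ * s) * -(μ * g s)) s := fun s => by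
    have h1 : HasDerivAt (fun s : ℝ => Real.exp (μ * s)) (Real.exp (μ * s) * μ) s := by
      simpa using ((hasDerivAt_id s).const_mul μ).exp
    exact h1.mul (((hG s).const_mul μ).const_sub (f x))
  have hconst := constant_of_has_deriv_right_zero (a := 0) (b := (t : ℝ)) (f := H)
    (fun s _ => (hHd s).continuousAt.continuousWithinAt) (fun s hs => by
      refine ((hHd s).congr_deriv ?_).hasDerivWithinAt
      have := hmain ⟨s, hs.1⟩
      change g s = f x - μ * ∫ r in (0 : ℝ)..s, g r at this
      rw [this]
      ring) t ⟨t.2, le_rfl⟩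
  simp only [hH, mul_zero, Real.exp_zero, intervalIntegral.integral_same, sub_zero, one_mul] at hconst
  rw [← hmain t] at hconst
  have h3 : g t = ∫ ω, f (B t ω) ∂P := by simp [hg]
  rw [← h3, Real.exp_neg, mul_comm (t : ℝ) μ, ← hconst, ← mul_assoc,
    inv_mul_cancel₀ (Real.exp_ne_zero _), one_mul]

/-- The spherical Laplacian acts on real functions here, so Y_{lm} is split as Re Y and Im Y =
Re(-iY), both of which are smooth eigenfunctions. -/
lemma integral_sphHarmonic_of_eigenfunction {Ω' : Type*} [MeasurableSpace Ω'] {Q : Measure Ω'}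
    [IsFiniteMeasure Q] {Y : Ω' → S2} (hY : Measurable Y) {l : ℕ} {x : S2} {c : ℝ}
    (h : ∀ f : S2 → ℝ, SphSmooth f → (∀ y, sphLaplacian f y = -(sphEigenvalue l) * f y) →
      ∫ ω, f (Y ω) ∂Q = c * f x) (m : ℤ) :
    ∫ y, sphHarmonic l m y ∂(Q.map Y) = c • sphHarmonic l m x := by
  rw [integral_map hY.aemeasurable (continuous_sphHarmonic l m).aestronglyMeasurable]
  have hi : Integrable (fun ω => sphHarmonic l m (Y ω)) Q := by
    have := integrable_of_continuous_S2 (Q.map Y) (continuous_sphHarmonic l m)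
    exact this.comp_measurable hY
  have h1 := h _ (sphHarmonic_eigenfunction l m 1).1 (sphHarmonic_eigenfunction l m 1).2
  have h2 := h _ (sphHarmonic_eigenfunction l m (-Complex.I)).1
    (sphHarmonic_eigenfunction l m (-Complex.I)).2
  have e1 := Complex.reCLM.integral_comp_comm hi
  have e2 := Complex.imCLM.integral_comp_comm hi
  simp at h1 h2 e1 e2
  apply Complex.ext
  · rw [← e1, h1]; simp
  · rw [← e2, h2]; simp

variable {α : ℝ} {D : ℝ≥0 → Ω → ℝ≥0}

omit mΩ in
lemma measurable_subordinate_of {m : MeasurableSpace Ω} (hB : ∀ t, Measurable[m] (B t))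
    (hBc : ∀ ω, Continuous fun t => B t ω) (hD : ∀ t, Measurable[m] (D t)) (t : ℝ≥0) :
    Measurable[m] (subordinate B D t) := by
  have h : Measurable fun p : ℝ≥0 × Ω => B p.1 p.2 :=
    measurable_uncurry_of_continuous_of_measurable (u := B) hBc hB
  exact h.comp ((hD t).prodMk measurable_id)

/-- Given D_t = s the expectation is e^{-sμ} f(x) by the independence of B and D; the Laplace
exponent of D then turns E e^{-μ D_t} into e^{-tμ^α}. -/
lemma integral_subordinate_eigenfunction (hB : IsRotationalBrownianMotion x B P)
    (hD : IsStableSubordinator α D P) (hind : Indep (sigmaField B) (sigmaField D) P)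
    {f : S2 → ℝ} (hf : SphSmooth f) {μ : ℝ} (hμ0 : 0 ≤ μ)
    (hμ : ∀ y, sphLaplacian f y = -μ * f y) (t : ℝ≥0) :
    ∫ ω, f (subordinate B D t ω) ∂P = Real.exp (-(t * μ ^ α)) * f x := by
  have hfc := hf.continuous
  obtain ⟨K, hK⟩ : ∃ K, ∀ y, ‖f y‖ ≤ K := by
    obtain ⟨K, hK⟩ := isCompact_univ.exists_bound_of_continuousOn hfc.continuousOn
    exact ⟨K, fun y => hK y trivial⟩
  have hle : sigmaField B ≤ mΩ := iSup_le fun s => (hB.measurable s).comap_le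
  have hind' : Indep (sigmaField B) (MeasurableSpace.comap (D t) inferInstance) P :=
    indep_of_indep_of_le_right hind (le_iSup (fun s => MeasurableSpace.comap (D s) inferInstance) t)
  have hF : Measurable fun p : ℝ≥0 × WithSigma Ω (sigmaField B) => f (B p.1 p.2) := by
    have h : Measurable fun p : ℝ≥0 × WithSigma Ω (sigmaField B) => B p.1 p.2 :=
      measurable_uncurry_of_continuous_of_measurable (u := (B : ℝ≥0 → WithSigma Ω (sigmaField B) → S2))
        hB.continuous (fun s => Measurable.of_comap_le
          (le_iSup (fun s => MeasurableSpace.comap (B s) inferInstance) s))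
    exact hfc.measurable.comp h
  have hY := hD.measurable t
  calc ∫ ω, f (subordinate B D t ω) ∂P
      = ∫ ω, (∫ ω', f (B (D t ω) ω') ∂P) ∂P :=
        (indepFun_toSigma hind').symm.integral_comp_prodMk hY (measurable_toSigma hle)
          hF.stronglyMeasurable (Integrable.of_bound (hF.comp
            (hY.prodMk (measurable_toSigma hle))).aestronglyMeasurable K
            (Eventually.of_forall fun ω => hK _))
    _ = ∫ s, ∫ ω, f (B s ω) ∂P ∂(P.map (D t)) := by
        rw [integral_map hY.aemeasurable]
        exact (hfc.measurable.comp hB.measurable_uncurry).stronglyMeasurable.integral_prod_right'.aestronglyMeasurable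
    _ = ∫ s : ℝ≥0, Real.exp (-(s * μ)) * f x ∂(P.map (D t)) := by
        refine integral_congr_ae (Eventually.of_forall fun s => ?_)
        exact hB.integral_eigenfunction hf hμ s
    _ = ∫ ω, Real.exp (-(D t ω * μ)) * f x ∂P := by
        rw [integral_map (hD.measurable t).aemeasurable]
        exact (by fun_prop : Measurable fun s : ℝ≥0 =>
          Real.exp (-((s : ℝ) * μ)) * f x).aestronglyMeasurable
    _ = _ := by
        rw [integral_mul_const]
        congr 1
        have h1 := hD.laplace 0 t zero_le μ hμ0
        rw [NNReal.coe_zero, sub_zero] at h1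
        rw [← h1]
        refine integral_congr_ae ?_
        filter_upwards [hD.start] with ω hω
        simp [hω, mul_comm]

end Brownian

/-! ### The spectral projections of the spherical Laplacian -/

section Spectral

lemma sphEigenvalue_nonneg (l : ℕ) : 0 ≤ sphEigenvalue l := by
  unfold sphEigenvalue; positivity

lemma sphEigenvalue_injective : Function.Injective sphEigenvalue := by
  intro l k h
  simp only [sphEigenvalue] at h
  have h2 : ((l : ℝ) - k) * (l + k + 1) = 0 := by linarith
  have h3 : (l : ℝ) + k + 1 ≠ 0 := by positivity
  have h4 : (l : ℝ) - k = 0 := by simpa [h3] using h2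
  exact_mod_cast sub_eq_zero.1 h4

lemma tendsto_sphEigenvalue_rpow {α : ℝ} (hα : 0 < α) :
    Tendsto (fun l => sphEigenvalue l ^ α) atTop atTop := by
  refine (tendsto_rpow_atTop hα).comp (tendsto_atTop_mono (fun l => ?_) tendsto_natCast_atTop_atTop)
  simp only [sphEigenvalue]
  nlinarith [(Nat.cast_nonneg l : (0 : ℝ) ≤ l)]

lemma summable_rpow_mul_exp {α t : ℝ} (hα : 0 < α) (ht : 0 < t) (j : ℕ) :
    Summable fun l : ℕ => (sphEigenvalue l ^ α) ^ j * Real.exp (-(t * sphEigenvalue l ^ α)) *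
      ((2 * l + 1) / (4 * Real.pi)) := by
  -- The exponent -(j + 2/α) is chosen so that, after the factor μ^{αj}, exactly μ_l^{-2} ≤ l^{-4}
  -- remains; the weight of order l still leaves a summable bound.
  have h1 : (fun l : ℕ => Real.exp (-(t * sphEigenvalue l ^ α))) =O[atTop]
      fun l => (sphEigenvalue l ^ α) ^ (-(j + 2 / α) : ℝ) := by
    have := (isLittleO_exp_neg_mul_rpow_atTop ht (-(j + 2 / α))).comp_tendsto
      (tendsto_sphEigenvalue_rpow hα)
    simpa [Function.comp_def] using this.isBigO
  have h2 : (fun l : ℕ => (sphEigenvalue l ^ α) ^ j * Real.exp (-(t * sphEigenvalue l ^ α)) *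
      ((2 * l + 1) / (4 * Real.pi))) =O[atTop] fun l : ℕ => ((l : ℝ) ^ 2)⁻¹ := by
    have h3 : (fun l : ℕ => (2 * (l : ℝ) + 1) / (4 * Real.pi)) =O[atTop] fun l : ℕ => (l : ℝ) := by
      refine Asymptotics.IsBigO.of_bound 1 ?_
      filter_upwards [eventually_ge_atTop 1] with l hl
      have hl : (1 : ℝ) ≤ l := by exact_mod_cast hl
      have := Real.pi_gt_three
      rw [Real.norm_of_nonneg (by positivity), Real.norm_of_nonneg (by positivity),
        div_le_iff₀ (by positivity)]
      nlinarith
    refine (((Asymptotics.isBigO_refl (fun l : ℕ => (sphEigenvalue l ^ α) ^ j) atTop).mul h1).mul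
      h3).trans ?_
    refine Asymptotics.IsBigO.of_bound 1 ?_
    filter_upwards [eventually_ge_atTop 1] with l hl
    have hl : (1 : ℝ) ≤ l := by exact_mod_cast hl
    have hpos : 0 < sphEigenvalue l := by simp only [sphEigenvalue]; positivity
    have hge : (l : ℝ) ^ 2 ≤ sphEigenvalue l := by simp only [sphEigenvalue]; nlinarith
    have e1 : (sphEigenvalue l ^ α) ^ j * (sphEigenvalue l ^ α) ^ (-(j + 2 / α) : ℝ)
        = (sphEigenvalue l ^ 2)⁻¹ := by
      rw [← Real.rpow_natCast, ← Real.rpow_add (by positivity), ← Real.rpow_mul hpos.le,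
        show α * ((j : ℝ) + -(j + 2 / α)) = -2 by field_simp; ring, Real.rpow_neg hpos.le]
      norm_num
    rw [e1, Real.norm_of_nonneg (by positivity), Real.norm_of_nonneg (by positivity), one_mul,
      inv_mul_eq_div, div_le_iff₀ (by positivity), inv_mul_eq_div, le_div_iff₀ (by positivity)]
    calc (l : ℝ) * l ^ 2 ≤ l ^ 2 * l ^ 2 := by
          apply mul_le_mul_of_nonneg_right _ (by positivity)
          nlinarith
      _ ≤ sphEigenvalue l ^ 2 := by nlinarith
  exact summable_of_isBigO_nat (Real.summable_nat_pow_inv.2 (by norm_num)) h2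

lemma kernelSummable_exp {α t : ℝ} (hα : 0 < α) (ht : 0 < t) :
    KernelSummable fun l => Real.exp (-(t * sphEigenvalue l ^ α)) := by
  have h := summable_rpow_mul_exp hα ht 0
  simpa [KernelSummable] using h

lemma kernelSummable_single (l : ℕ) : KernelSummable fun k => if k = l then 1 else 0 :=
  summable_of_ne_finset_zero (s := {l}) fun k hk => by simp at hk; simp [hk]

lemma sumKernel_single (l : ℕ) (x y : S2) :
    sumKernel (fun k => if k = l then 1 else 0) x y = zonal l x y := by
  rw [sumKernel, tsum_eq_single l fun k hk => by simp [hk]]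
  simp

lemma sumKernel_comm (a : ℕ → ℝ) (x y : S2) : sumKernel a x y = sumKernel a y x := by
  simp only [sumKernel, zonal_comm _ x y]

/-- The integral operator with kernel `sumKernel a`. -/
noncomputable def kernelOp (a : ℕ → ℝ) (f : S2 → ℝ) (x : S2) : ℝ :=
  ∫ y, sumKernel a x y * f y ∂sphMeasure

variable {a : ℕ → ℝ} {f : S2 → ℝ}

lemma integrable_sumKernel_mul (ha : KernelSummable a) (hf : Integrable f sphMeasure) (x : S2) :
    Integrable (fun y => sumKernel a x y * f y) sphMeasure :=
  hf.bdd_mul (c := ∑' l : ℕ, |a l| * ((2 * l + 1) / (4 * Real.pi)))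
    (continuous_sumKernel_right ha x).aestronglyMeasurable
    (Eventually.of_forall fun y => abs_sumKernel_le ha x y)

lemma continuous_kernelOp (ha : KernelSummable a) (hf : Integrable f sphMeasure) :
    Continuous (kernelOp a f) := by
  refine continuous_of_dominated
    (bound := fun y => (∑' l : ℕ, |a l| * ((2 * l + 1) / (4 * Real.pi))) * ‖f y‖)
    (fun x => (integrable_sumKernel_mul ha hf x).aestronglyMeasurable)
    (fun x => Eventually.of_forall fun y => ?_) (hf.norm.const_mul _)
    (Eventually.of_forall fun y => ?_)
  · rw [norm_mul]
    exact mul_le_mul_of_nonneg_right (abs_sumKernel_le ha x y) (norm_nonneg _)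
  · refine Continuous.mul ?_ continuous_const
    simp only [sumKernel_comm a _ y]
    exact continuous_sumKernel_right ha y

/-- The integral operators are symmetric. -/
lemma integral_kernelOp_mul (ha : KernelSummable a) (hf : Integrable f sphMeasure) {g : S2 → ℂ}
    (hg : Integrable g sphMeasure) :
    ∫ x, (kernelOp a f x : ℂ) * g x ∂sphMeasure
      = ∫ y, (f y : ℂ) * ∫ x, sumKernel a y x • g x ∂sphMeasure ∂sphMeasure := by
  have hi : Integrable (Function.uncurry fun x y : S2 => sumKernel a x y • (g x * (f y : ℂ)))
      (sphMeasure.prod sphMeasure) :=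
    (hg.mul_prod hf.ofReal).bdd_smul (∑' l : ℕ, |a l| * ((2 * l + 1) / (4 * Real.pi)))
      (continuous_sumKernel ha).aestronglyMeasurable
      (Eventually.of_forall fun p => abs_sumKernel_le ha p.1 p.2)
  calc ∫ x, (kernelOp a f x : ℂ) * g x ∂sphMeasure
      = ∫ x, ∫ y, sumKernel a x y • (g x * (f y : ℂ)) ∂sphMeasure ∂sphMeasure := by
        refine integral_congr_ae (Eventually.of_forall fun x => ?_)
        simp only [kernelOp]
        rw [← integral_complex_ofReal, ← integral_mul_const]
        refine integral_congr_ae (Eventually.of_forall fun y => ?_)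
        simp only [Complex.real_smul, Complex.ofReal_mul]
        ring
    _ = ∫ y, ∫ x, sumKernel a x y • (g x * (f y : ℂ)) ∂sphMeasure ∂sphMeasure :=
        integral_integral_swap hi
    _ = _ := by
        refine integral_congr_ae (Eventually.of_forall fun y => ?_)
        simp only
        rw [← integral_const_mul]
        refine integral_congr_ae (Eventually.of_forall fun x => ?_)
        simp only [Complex.real_smul, sumKernel_comm a y x]
        ring

lemma integral_kernelOp_mul_real (ha : KernelSummable a) (hf : Integrable f sphMeasure) {g : S2 → ℝ}
    (hg : Integrable g sphMeasure) :
    ∫ x, kernelOp a f x * g x ∂sphMeasure = ∫ y, f y * kernelOp a g y ∂sphMeasure := by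
  have h := integral_kernelOp_mul ha hf hg.ofReal
  have h2 : ∀ y, ∫ x, sumKernel a y x • (g x : ℂ) ∂sphMeasure = ((kernelOp a g y : ℝ) : ℂ) := by
    intro y
    simp only [Complex.real_smul, ← Complex.ofReal_mul]
    rw [integral_complex_ofReal]
    rfl
  have e : ∀ x, ((@RCLike.ofReal ℂ _ (g x)) : ℂ) = (g x : ℂ) := fun x => rfl
  simp only [e, h2, ← Complex.ofReal_mul] at h
  rw [integral_complex_ofReal, integral_complex_ofReal] at h
  exact Complex.ofReal_injective h

/-- By symmetry the operator moves onto the conjugate of Y_{km}, which is up to sign Y_{k,-m} and so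
is multiplied by a_k. -/
lemma sphCoeff_kernelOp (ha : KernelSummable a) (hf : Integrable f sphMeasure) (k : ℕ) (m : ℤ)
    (hm : m.natAbs ≤ k) : sphCoeff (kernelOp a f) k m = a k * sphCoeff f k m := by
  have hY : Continuous fun x => (starRingEnd ℂ) (sphHarmonic k m x) :=
    Complex.continuous_conj.comp (continuous_sphHarmonic k m)
  rw [sphCoeff, integral_kernelOp_mul ha hf (integrable_of_continuous_S2 _ hY), sphCoeff,
    ← integral_const_mul]
  refine integral_congr_ae (Eventually.of_forall fun y => ?_)
  simp only
  have h := integral_sumKernel_mul_sphHarmonic ha k (-m) (by simpa using hm) y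
  have h2 : ∫ x, sumKernel a y x • (starRingEnd ℂ) (sphHarmonic k m x) ∂sphMeasure
      = (a k : ℂ) * (starRingEnd ℂ) (sphHarmonic k m y) := by
    simp only [conj_sphHarmonic]
    have : ∀ x, sumKernel a y x • ((-1) ^ m.natAbs * sphHarmonic k (-m) x) =
        (-1) ^ m.natAbs * (sumKernel a y x • sphHarmonic k (-m) x) := fun x => by
      simp only [Complex.real_smul]; ring
    simp only [this]
    rw [integral_const_mul, h, Complex.real_smul]
    ring
  rw [h2]
  ring

lemma memLp_of_continuous {g : S2 → ℝ} (hg : Continuous g) {p : ℝ≥0∞} : MemLp g p sphMeasure := by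
  obtain ⟨K, hK⟩ := isCompact_univ.exists_bound_of_continuousOn hg.continuousOn
  exact MemLp.of_bound hg.aestronglyMeasurable K (Eventually.of_forall fun y => hK y trivial)

lemma L2S.integrable (f : L2S) : Integrable f sphMeasure :=
  (Lp.memLp f).integrable (by norm_num)

/-- A function in `L²` without Fourier coefficients vanishes. -/
lemma L2S.eq_zero_of_sphCoeff (f : L2S)
    (h : ∀ (k : ℕ) (m : ℤ), m.natAbs ≤ k → sphCoeff f k m = 0) : f = 0 := by
  have hd : DenseRange (ContinuousMap.toLp 2 sphMeasure ℝ : C(S2, ℝ) →L[ℝ] L2S) :=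
    ContinuousMap.toLp_denseRange ℝ sphMeasure ℝ (by norm_num)
  refine hd.eq_zero_of_inner_left ℝ fun g => ?_
  have hΦ : ∀ g : C(S2, ℂ), Integrable (fun x => (f x : ℂ) * g x) sphMeasure := fun g =>
    f.integrable.ofReal.mul_bdd (c := ‖g‖) g.continuous.aestronglyMeasurable
      (Eventually.of_forall fun x => g.norm_coe_le_norm x)
  let Φ : C(S2, ℂ) →L[ℂ] ℂ := LinearMap.mkContinuous
    { toFun := fun g => ∫ x, (f x : ℂ) * g x ∂sphMeasure
      map_add' := fun g g' => by
        simp only [ContinuousMap.add_apply, mul_add]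
        exact integral_add (hΦ g) (hΦ g')
      map_smul' := fun c g => by
        simp only [ContinuousMap.smul_apply, smul_eq_mul, mul_left_comm _ c]
        exact integral_const_mul _ _ } (∫ x, ‖f x‖ ∂sphMeasure) (fun g => by
      refine (norm_integral_le_integral_norm _).trans ?_
      rw [← integral_mul_const]
      refine integral_mono_of_nonneg (Eventually.of_forall fun x => norm_nonneg _)
        (f.integrable.norm.mul_const _) (Eventually.of_forall fun x => ?_)
      simp only [norm_mul, Complex.norm_real]
      exact mul_le_mul_of_nonneg_left (g.norm_coe_le_norm x) (norm_nonneg _))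
  -- Pairing with f kills every Y_{km}, hence all continuous functions, and these are dense in L².
  have h0 : Φ = 0 := continuousLinearMap_ext_sphHarmonic Φ 0 fun k m hm => by
    have h1 := h k (-m) (by simpa using hm)
    simp only [sphCoeff, conj_sphHarmonic, neg_neg, Int.natAbs_neg, mul_left_comm _ ((-1 : ℂ) ^ _)] at h1
    rw [integral_const_mul] at h1
    have h2 : ((-1 : ℂ)) ^ m.natAbs ≠ 0 := pow_ne_zero _ (by norm_num)
    exact (mul_eq_zero.1 h1).resolve_left h2
  have h1 : ∫ x, (f x : ℂ) * (g x : ℂ) ∂sphMeasure = 0 :=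
    congrArg (fun L : C(S2, ℂ) →L[ℂ] ℂ =>
      L ⟨fun x => (g x : ℂ), Complex.continuous_ofReal.comp g.continuous⟩) h0
  simp only [← Complex.ofReal_mul] at h1
  rw [integral_complex_ofReal, Complex.ofReal_eq_zero] at h1
  rw [L2.inner_def, ← h1]
  refine integral_congr_ae ?_
  filter_upwards [ContinuousMap.coeFn_toLp (p := 2) (𝕜 := ℝ) sphMeasure g] with x hx
  rw [hx]
  simp [mul_comm]

lemma sphCoeff_congr {f g : S2 → ℝ} (h : f =ᵐ[sphMeasure] g) (k : ℕ) (m : ℤ) :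
    sphCoeff f k m = sphCoeff g k m := by
  refine integral_congr_ae ?_
  filter_upwards [h] with x hx
  rw [hx]

lemma sphCoeff_sub {f g : S2 → ℝ} (hf : Integrable f sphMeasure) (hg : Integrable g sphMeasure)
    (k : ℕ) (m : ℤ) : sphCoeff (fun x => f x - g x) k m = sphCoeff f k m - sphCoeff g k m := by
  obtain ⟨K, hK⟩ := isCompact_univ.exists_bound_of_continuousOn
    (Complex.continuous_conj.comp (continuous_sphHarmonic k m)).continuousOn
  have hi : ∀ {f : S2 → ℝ}, Integrable f sphMeasure →
      Integrable (fun x => (f x : ℂ) * (starRingEnd ℂ) (sphHarmonic k m x)) sphMeasure := fun h =>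
    h.ofReal.mul_bdd (c := K)
      (Complex.continuous_conj.comp (continuous_sphHarmonic k m)).aestronglyMeasurable
      (Eventually.of_forall fun x => hK x trivial)
  simp only [sphCoeff, Complex.ofReal_sub, sub_mul]
  exact integral_sub (hi hf) (hi hg)

/-- The kernel operator of degree `l` is the frequency component. -/
lemma sphComponent_eq (hf : Integrable f sphMeasure) (l : ℕ) (x : S2) :
    sphComponent f l x = ((kernelOp (fun k => if k = l then 1 else 0) f x : ℝ) : ℂ) := by
  simp only [kernelOp, sumKernel_single]
  rw [← integral_complex_ofReal]
  simp only [Complex.ofReal_mul, ofReal_zonal, Finset.sum_mul]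
  rw [integral_finsetSum]
  · rw [sphComponent]
    refine Finset.sum_congr rfl fun m _ => ?_
    rw [sphCoeff, ← integral_mul_const]
    refine integral_congr_ae (Eventually.of_forall fun y => ?_)
    ring
  · intro m _
    obtain ⟨K, hK⟩ := isCompact_univ.exists_bound_of_continuousOn (continuous_const.mul
      (Complex.continuous_conj.comp (continuous_sphHarmonic l m)) :
        Continuous fun y => sphHarmonic l m x * (starRingEnd ℂ) (sphHarmonic l m y)).continuousOn
    exact hf.ofReal.bdd_mul (c := K) (continuous_const.mul (Complex.continuous_conj.comp
      (continuous_sphHarmonic l m))).aestronglyMeasurable (Eventually.of_forall fun y => hK y trivial)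

/-- The frequency component of degree `l`, as an element of `L²`. -/
noncomputable def zonalOp (l : ℕ) (f : L2S) : L2S :=
  (memLp_of_continuous (continuous_kernelOp (kernelSummable_single l) f.integrable) (p := 2)).toLp _

lemma coeFn_zonalOp (l : ℕ) (f : L2S) :
    (zonalOp l f : S2 → ℝ) =ᵐ[sphMeasure] kernelOp (fun k => if k = l then 1 else 0) f :=
  MemLp.coeFn_toLp _

lemma sphCoeff_zonalOp (l : ℕ) (f : L2S) (k : ℕ) (m : ℤ) (hm : m.natAbs ≤ k) :
    sphCoeff (zonalOp l f) k m = if k = l then sphCoeff f k m else 0 := by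
  rw [sphCoeff_congr (coeFn_zonalOp l f), sphCoeff_kernelOp (kernelSummable_single l) f.integrable k m hm]
  split_ifs <;> simp

lemma L2S.ext_sphCoeff {f g : L2S}
    (h : ∀ (k : ℕ) (m : ℤ), m.natAbs ≤ k → sphCoeff f k m = sphCoeff g k m) : f = g := by
  rw [← sub_eq_zero]
  refine L2S.eq_zero_of_sphCoeff _ fun k m hm => ?_
  rw [sphCoeff_congr (Lp.coeFn_sub f g)]
  have := sphCoeff_sub f.integrable g.integrable k m
  simp only [Pi.sub_def]
  rw [this, h k m hm, sub_self]

/-- A function in the range of the frequency projection is a sum of smooth eigenfunctions. -/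
lemma zonalOp_mem (l : ℕ) (f : L2S) : zonalOp l f ∈ sphEigenspace l := by
  have hc : ∀ (m : ℤ) (c : ℂ), Continuous fun x => (c * sphHarmonic l m x).re := fun m c =>
    (sphHarmonic_eigenfunction l m c).1.continuous
  have : zonalOp l f = ∑ m ∈ Finset.Icc (-(l : ℤ)) l,
      (memLp_of_continuous (hc m (sphCoeff f l m)) (p := 2)).toLp _ := by
    refine Lp.ext ?_
    have h1 : ∀ᵐ x ∂sphMeasure, ∀ m : ℤ, (memLp_of_continuous (hc m (sphCoeff f l m)) (p := 2)).toLp _ x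
        = (sphCoeff f l m * sphHarmonic l m x).re := by
      rw [ae_all_iff]
      exact fun m => MemLp.coeFn_toLp _
    filter_upwards [coeFn_zonalOp l f, h1, Lp.coeFn_finsetSum (Finset.Icc (-(l : ℤ)) l)
      (fun m => (memLp_of_continuous (hc m (sphCoeff f l m)) (p := 2)).toLp _)] with x hx h1 h2
    rw [hx, h2, Finset.sum_apply]
    simp only [h1]
    rw [← Complex.re_sum]
    exact (congrArg Complex.re (sphComponent_eq f.integrable l x)).symm
  rw [this]
  refine Submodule.sum_mem _ fun m _ => ?_
  exact Submodule.le_topologicalClosure _ (Submodule.subset_span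
    ⟨_, (sphHarmonic_eigenfunction l m _).1, (sphHarmonic_eigenfunction l m _).2,
      MemLp.coeFn_toLp _⟩)

/-- For every point there is a probability law that acts on the eigenfunctions of the
spherical Laplacian as the heat kernel at time `1`. -/
def HasHeatKernel : Prop := ∀ x : S2, ∃ ν : Measure S2, IsProbabilityMeasure ν ∧
  ∀ (l : ℕ) (φ : S2 → ℝ), SphSmooth φ → (∀ y, sphLaplacian φ y = -(sphEigenvalue l) * φ y) →
    ∫ y, φ y ∂ν = Real.exp (-sphEigenvalue l) * φ x

/-- This excludes eigenfunctions other than combinations of the Y_{lm}. It stands in for Green's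
formula, which is not needed because a symmetric operator with distinct eigenvalues e^{-μ_k} is at
hand. -/
lemma zonalOp_of_eigenfunction (H : HasHeatKernel) {l : ℕ} {φ : S2 → ℝ} (hφ : SphSmooth φ)
    (hl : ∀ y, sphLaplacian φ y = -(sphEigenvalue l) * φ y) {f : L2S}
    (hf : (f : S2 → ℝ) =ᵐ[sphMeasure] φ) : zonalOp l f = f := by
  have ha : KernelSummable fun k => Real.exp (-sphEigenvalue k) := by
    simpa using kernelSummable_exp (α := 1) one_pos one_pos
  have hφi : Integrable φ sphMeasure := integrable_of_continuous_S2 _ hφ.continuous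
  -- The law ν has the zonal density with coefficients e^{-μ_k}, so φ is an eigenfunction of that
  -- kernel operator.
  have h1 : ∀ x, Real.exp (-sphEigenvalue l) * φ x
      = kernelOp (fun k => Real.exp (-sphEigenvalue k)) φ x := by
    intro x
    obtain ⟨ν, hν, h⟩ := H x
    rw [← h l φ hφ hl]
    refine (integrable_and_integral_of_integral_sphHarmonic ha x ν (fun k m _ => ?_) hφi).2
    have := integral_sphHarmonic_of_eigenfunction (Q := ν) (Y := id) measurable_id (l := k) (x := x)
      (c := Real.exp (-sphEigenvalue k)) (fun f h1 h2 => h k f h1 h2) m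
    simpa using this
  refine L2S.ext_sphCoeff fun k m hm => ?_
  rw [sphCoeff_zonalOp l f k m hm]
  split_ifs with hk
  · rfl
  · rw [sphCoeff_congr hf]
    -- The coefficient of order (k, m) gets the factor e^{-μ_k} from the kernel and e^{-μ_l} from
    -- `h1`; it vanishes unless k = l.
    have h2 := sphCoeff_kernelOp ha hφi k m hm
    have h3 : sphCoeff (kernelOp (fun k => Real.exp (-sphEigenvalue k)) φ) k m
        = Real.exp (-sphEigenvalue l) * sphCoeff φ k m := by
      rw [sphCoeff, sphCoeff, ← integral_const_mul]
      refine integral_congr_ae (Eventually.of_forall fun x => ?_)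
      simp only [← h1, Complex.ofReal_mul]
      ring
    rw [h3] at h2
    by_contra hne
    have h4 := mul_right_cancel₀ (fun h => hne h.symm) h2
    have h5 := sphEigenvalue_injective (neg_injective (Real.exp_injective (Complex.ofReal_injective h4)))
    exact hk h5.symm

lemma inner_zonalOp (l : ℕ) (f g : L2S) : inner ℝ (zonalOp l f) g = inner ℝ f (zonalOp l g) := by
  rw [L2.inner_def, L2.inner_def]
  have h1 : ∫ x, inner ℝ (zonalOp l f x) (g x) ∂sphMeasure =
      ∫ x, kernelOp (fun k => if k = l then 1 else 0) f x * g x ∂sphMeasure := by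
    refine integral_congr_ae ?_
    filter_upwards [coeFn_zonalOp l f] with x hx
    rw [hx]; simp [mul_comm]
  have h2 : ∫ x, inner ℝ (f x) (zonalOp l g x) ∂sphMeasure =
      ∫ x, f x * kernelOp (fun k => if k = l then 1 else 0) g x ∂sphMeasure := by
    refine integral_congr_ae ?_
    filter_upwards [coeFn_zonalOp l g] with x hx
    rw [hx]; simp [mul_comm]
  rw [h1, h2]
  exact integral_kernelOp_mul_real (kernelSummable_single l) f.integrable g.integrable

/-- The orthogonal projection to the eigenspace is the frequency projection. -/
lemma starProjection_sphEigenspace (H : HasHeatKernel) (l : ℕ) (f : L2S) :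
    (sphEigenspace l).starProjection f = zonalOp l f := by
  refine Submodule.eq_starProjection_of_mem_orthogonal (zonalOp_mem l f) ?_
  rw [sphEigenspace, Submodule.orthogonal_closure, Submodule.mem_orthogonal']
  intro g hg
  induction hg using Submodule.span_induction with
  | mem g hg =>
    obtain ⟨φ, h1, h2, h3⟩ := hg
    rw [inner_sub_left, inner_zonalOp, zonalOp_of_eigenfunction H h1 h2 h3, sub_self]
  | zero => simp
  | add g g' _ _ h h' => rw [inner_add_right, h, h', add_zero]
  | smul c g _ h => rw [inner_smul_right, h, mul_zero]

lemma orthogonalFamily_sphEigenspace (H : HasHeatKernel) :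
    OrthogonalFamily ℝ (fun l => sphEigenspace l) fun l => (sphEigenspace l).subtypeₗᵢ := by
  intro l k hlk f g
  change inner ℝ (f : L2S) (g : L2S) = 0
  have h1 : zonalOp l f = f := by
    rw [← starProjection_sphEigenspace H, Submodule.starProjection_eq_self_iff.2 f.2]
  have h2 : zonalOp k g = g := by
    rw [← starProjection_sphEigenspace H, Submodule.starProjection_eq_self_iff.2 g.2]
  rw [← h1, inner_zonalOp]
  have : zonalOp l (g : L2S) = 0 := by
    rw [← h2]
    refine L2S.eq_zero_of_sphCoeff _ fun j m hm => ?_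
    rw [sphCoeff_zonalOp _ _ _ _ hm, sphCoeff_zonalOp _ _ _ _ hm]
    split_ifs with h h'
    · exact absurd (h.symm.trans h') hlk
    · rfl
    · rfl
  rw [this, inner_zero_right]

lemma eq_zero_of_starProjection_sphEigenspace (H : HasHeatKernel) (f : L2S)
    (h : ∀ l, (sphEigenspace l).starProjection f = 0) : f = 0 := by
  refine L2S.eq_zero_of_sphCoeff f fun k m hm => ?_
  have h1 := sphCoeff_zonalOp k f k m hm
  rw [if_pos rfl, ← starProjection_sphEigenspace H, h] at h1
  rw [← h1, sphCoeff_congr (Lp.coeFn_zero _ _ _)]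
  simp [sphCoeff]

/-- The law at time one of the given Brownian motion serves, so no heat kernel has to be
constructed. -/
lemma hasHeatKernel_of_brownian {Ω : Type*} [MeasurableSpace Ω] {P : Measure Ω}
    [IsProbabilityMeasure P] {B : S2 → ℝ≥0 → Ω → S2}
    (hB : ∀ x, IsRotationalBrownianMotion x (B x) P) : HasHeatKernel := by
  intro x
  refine ⟨P.map (B x 1), Measure.isProbabilityMeasure_map ((hB x).measurable 1).aemeasurable,
    fun l φ h1 h2 => ?_⟩
  rw [integral_map ((hB x).measurable 1).aemeasurable h1.continuous.aestronglyMeasurable,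
    (hB x).integral_eigenfunction h1 h2]
  simp

end Spectral

/-! ### The fractional heat equation -/

section Scalar

variable {α μ : ℝ}

lemma one_sub_exp_nonneg {x : ℝ} (hx : 0 ≤ x) : 0 ≤ 1 - Real.exp (-x) := by
  have := Real.exp_le_one_iff.2 (neg_nonpos.2 hx); linarith

lemma one_sub_exp_le (x : ℝ) : 1 - Real.exp (-x) ≤ x := by
  have := Real.add_one_le_exp (-x); linarith

lemma continuousOn_rpow_Ioi (b : ℝ) : ContinuousOn (fun s : ℝ => s ^ b) (Set.Ioi 0) :=
  fun _ hs => (Real.continuousAt_rpow_const _ _ (Or.inl (ne_of_gt hs))).continuousWithinAt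

/-- Near 0 the bound 1 - e^{-sμ} ≤ sμ leaves s^{-α}, integrable as α < 1; at infinity s^{-α-1} is
integrable as α > 0. -/
lemma integrableOn_subordination (hα₀ : 0 < α) (hα₁ : α < 1) (hμ : 0 ≤ μ) :
    IntegrableOn (fun s => (1 - Real.exp (-(s * μ))) * s ^ (-α - 1)) (Set.Ioi 0) := by
  have hc : ContinuousOn (fun s => (1 - Real.exp (-(s * μ))) * s ^ (-α - 1)) (Set.Ioi 0) :=
    (Continuous.continuousOn (by fun_prop)).mul (continuousOn_rpow_Ioi _)
  rw [← Set.Ioc_union_Ioi_eq_Ioi (zero_le_one' ℝ)]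
  refine IntegrableOn.union ?_ ?_
  · have h1 : IntegrableOn (fun s : ℝ => μ * s ^ (-α)) (Set.Ioc 0 1) := by
      have := (intervalIntegral.intervalIntegrable_rpow' (a := 0) (b := 1) (r := -α)
        (by linarith)).const_mul μ
      rwa [intervalIntegrable_iff_integrableOn_Ioc_of_le zero_le_one] at this
    refine Integrable.mono' h1 ((hc.mono fun s hs => hs.1).aestronglyMeasurable measurableSet_Ioc) ?_
    filter_upwards [ae_restrict_mem measurableSet_Ioc] with s hs
    have h0 := mul_nonneg hs.1.le hμ
    rw [Real.norm_eq_abs, abs_of_nonneg (mul_nonneg (one_sub_exp_nonneg h0)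
      (Real.rpow_nonneg hs.1.le _))]
    refine (mul_le_mul_of_nonneg_right (one_sub_exp_le _) (Real.rpow_nonneg hs.1.le _)).trans ?_
    rw [Real.rpow_sub_one hs.1.ne']
    have hs' := hs.1.ne'
    exact le_of_eq (by field_simp)
  · have h1 : IntegrableOn (fun s : ℝ => s ^ (-α - 1)) (Set.Ioi 1) :=
      integrableOn_Ioi_rpow_of_lt (by linarith) one_pos
    refine Integrable.mono' h1 ((hc.mono (Set.Ioi_subset_Ioi zero_le_one)).aestronglyMeasurable measurableSet_Ioi) ?_
    filter_upwards [ae_restrict_mem measurableSet_Ioi] with s hs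
    have hs0 : (0 : ℝ) < s := one_pos.trans hs
    have h0 := mul_nonneg hs0.le hμ
    rw [Real.norm_eq_abs, abs_of_nonneg (mul_nonneg (one_sub_exp_nonneg h0)
      (Real.rpow_nonneg hs0.le _))]
    refine mul_le_of_le_one_left (Real.rpow_nonneg hs0.le _) ?_
    linarith [Real.exp_pos (-(s * μ))]

/-- The Lévy–Khintchine formula of the stable subordinator. -/
lemma integral_subordination (hα₀ : 0 < α) (hα₁ : α < 1) (hμ : 0 ≤ μ) :
    ∫ s in Set.Ioi 0, (1 - Real.exp (-(s * μ))) * s ^ (-α - 1) = Real.Gamma (1 - α) / α * μ ^ α := by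
  rcases hμ.eq_or_lt with rfl | hμ'
  · simp [Real.zero_rpow hα₀.ne']
  have hu : ∀ s ∈ Set.Ioi (0 : ℝ), HasDerivAt (fun s => 1 - Real.exp (-(s * μ)))
      (μ * Real.exp (-(μ * s))) s := fun s _ => by
    refine ((((hasDerivAt_id' s).mul_const μ).fun_neg.exp).const_sub 1).congr_deriv ?_
    rw [mul_comm s μ]
    ring
  have hv : ∀ s ∈ Set.Ioi (0 : ℝ), HasDerivAt (fun s : ℝ => -(s ^ (-α)) / α) (s ^ (-α - 1)) s :=
    fun s hs => by
      refine ((Real.hasDerivAt_rpow_const (x := s) (p := -α)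
        (Or.inl (ne_of_gt hs))).fun_neg.div_const α).congr_deriv ?_
      rw [neg_mul, neg_neg, mul_div_cancel_left₀ _ hα₀.ne']
  have hG : IntegrableOn (fun t : ℝ => t ^ ((1 - α) - 1) * Real.exp (-(μ * t))) (Set.Ioi 0) :=
    by
      have := integrableOn_rpow_mul_exp_neg_mul_rpow (s := (1 - α) - 1) (p := 1) (b := μ)
        (by linarith) one_pos hμ'
      simpa using this
  have hw : ∀ s : ℝ, μ * Real.exp (-(μ * s)) * (-(s ^ (-α)) / α) =
      (-(μ / α)) * (s ^ ((1 - α) - 1) * Real.exp (-(μ * s))) := fun s => by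
    rw [show (1 - α) - 1 = -α by ring]; ring
  have h0 : Tendsto (fun s => (1 - Real.exp (-(s * μ))) * (-(s ^ (-α)) / α)) (𝓝[>] 0) (𝓝 0) := by
    have h1 : Tendsto (fun s : ℝ => μ / α * s ^ (1 - α)) (𝓝[>] 0) (𝓝 0) := by
      have : ContinuousAt (fun s : ℝ => μ / α * s ^ (1 - α)) 0 :=
        continuousAt_const.mul (Real.continuousAt_rpow_const _ _ (Or.inr (by linarith)))
      have h := this.tendsto
      simp only [Real.zero_rpow (sub_pos.2 hα₁).ne', mul_zero] at h
      exact h.mono_left nhdsWithin_le_nhds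
    refine squeeze_zero_norm' ?_ h1
    filter_upwards [self_mem_nhdsWithin] with s hs
    have hs0 : (0 : ℝ) < s := hs
    have h0 := mul_nonneg hs0.le hμ
    rw [norm_mul, Real.norm_eq_abs, Real.norm_eq_abs, abs_of_nonneg (one_sub_exp_nonneg h0),
      abs_div, abs_neg, abs_of_nonneg (Real.rpow_nonneg hs0.le _), abs_of_pos hα₀]
    refine (mul_le_mul_of_nonneg_right (one_sub_exp_le _) (by positivity)).trans (le_of_eq ?_)
    rw [sub_eq_add_neg, Real.rpow_add hs0, Real.rpow_one]
    ring
  have hinf : Tendsto (fun s => (1 - Real.exp (-(s * μ))) * (-(s ^ (-α)) / α)) atTop (𝓝 0) := by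
    have h1 : Tendsto (fun s : ℝ => s ^ (-α) / α) atTop (𝓝 0) := by
      simpa using (tendsto_rpow_neg_atTop hα₀).div_const α
    refine squeeze_zero_norm' ?_ h1
    filter_upwards [eventually_gt_atTop 0] with s hs0
    have h0 := mul_nonneg hs0.le hμ
    rw [norm_mul, Real.norm_eq_abs, Real.norm_eq_abs, abs_of_nonneg (one_sub_exp_nonneg h0),
      abs_div, abs_neg, abs_of_nonneg (Real.rpow_nonneg hs0.le _), abs_of_pos hα₀]
    refine mul_le_of_le_one_left (by positivity) ?_
    linarith [Real.exp_pos (-(s * μ))]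
  -- Integration by parts with primitive -s^{-α}/α. The boundary terms are at most (μ/α) s^{1-α} at
  -- 0 and s^{-α}/α at infinity, and what remains is a Gamma integral.
  rw [integral_Ioi_mul_deriv_eq_deriv_mul hu hv (integrableOn_subordination hα₀ hα₁ hμ)
    (by
      exact (IntegrableOn.congr_fun (hG.const_mul (-(μ / α))) (fun s _ => (hw s).symm) measurableSet_Ioi)) h0 hinf]
  simp only [hw]
  rw [integral_const_mul, Real.integral_rpow_mul_exp_neg_mul_Ioi (by linarith) hμ']
  rw [one_div, Real.inv_rpow hμ, ← Real.rpow_neg hμ, show -(1 - α) = α - 1 by ring,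
    Real.rpow_sub_one hμ'.ne']
  field_simp
  ring

/-- The truncated Lévy–Khintchine integral, normalized. -/
noncomputable def truncatedExponent (α ε μ : ℝ) : ℝ :=
  α / Real.Gamma (1 - α) * ∫ s in Set.Ioi ε, (1 - Real.exp (-(s * μ))) * s ^ (-α - 1)

lemma gamma_const_pos (hα₀ : 0 < α) (hα₁ : α < 1) : 0 < α / Real.Gamma (1 - α) :=
  div_pos hα₀ (Real.Gamma_pos_of_pos (by linarith))

lemma subordination_nonneg (hμ : 0 ≤ μ) {ε : ℝ} (hε : 0 ≤ ε) :
    0 ≤ᵐ[volume.restrict (Set.Ioi ε)] fun s => (1 - Real.exp (-(s * μ))) * s ^ (-α - 1) := by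
  filter_upwards [ae_restrict_mem measurableSet_Ioi] with s hs
  have hs0 : (0 : ℝ) < s := hε.trans_lt hs
  exact mul_nonneg (one_sub_exp_nonneg (mul_nonneg hs0.le hμ)) (Real.rpow_nonneg hs0.le _)

lemma truncatedExponent_nonneg (hα₀ : 0 < α) (hα₁ : α < 1) (hμ : 0 ≤ μ) {ε : ℝ} (hε : 0 ≤ ε) :
    0 ≤ truncatedExponent α ε μ :=
  mul_nonneg (gamma_const_pos hα₀ hα₁).le (integral_nonneg_of_ae (subordination_nonneg hμ hε))

lemma truncatedExponent_zero (hα₀ : 0 < α) (hα₁ : α < 1) (hμ : 0 ≤ μ) :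
    truncatedExponent α 0 μ = μ ^ α := by
  have := (Real.Gamma_pos_of_pos (sub_pos.2 hα₁)).ne'
  rw [truncatedExponent, integral_subordination hα₀ hα₁ hμ]
  field_simp

/-- The integrand is nonnegative, so truncation only lowers the integral; the bound, uniform in ε,
is what dominates the limit ε ↓ 0. -/
lemma truncatedExponent_le (hα₀ : 0 < α) (hα₁ : α < 1) (hμ : 0 ≤ μ) {ε : ℝ} (hε : 0 ≤ ε) :
    truncatedExponent α ε μ ≤ μ ^ α := by
  rw [← truncatedExponent_zero hα₀ hα₁ hμ]
  refine mul_le_mul_of_nonneg_left ?_ (gamma_const_pos hα₀ hα₁).le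
  exact setIntegral_mono_set (integrableOn_subordination hα₀ hα₁ hμ) (subordination_nonneg hμ le_rfl)
    (LE.le.eventuallyLE (Set.Ioi_subset_Ioi hε))

lemma tendsto_truncatedExponent (hα₀ : 0 < α) (hα₁ : α < 1) (hμ : 0 ≤ μ) :
    Tendsto (fun ε => truncatedExponent α ε μ) (𝓝[>] 0) (𝓝 (μ ^ α)) := by
  rw [← truncatedExponent_zero hα₀ hα₁ hμ]
  have hi := integrableOn_subordination hα₀ hα₁ hμ
  refine Tendsto.const_mul _ ?_
  have h1 : ∀ ε : ℝ, 0 ≤ ε → ∫ s in Set.Ioi ε, (1 - Real.exp (-(s * μ))) * s ^ (-α - 1) =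
      (∫ s in Set.Ioi 0, (1 - Real.exp (-(s * μ))) * s ^ (-α - 1)) -
        ∫ s in (0 : ℝ)..ε, (1 - Real.exp (-(s * μ))) * s ^ (-α - 1) := fun ε hε => by
    rw [← intervalIntegral.integral_Ioi_sub_Ioi hi hε]; ring
  have h2 : Tendsto (fun ε : ℝ => ∫ s in (0 : ℝ)..ε, (1 - Real.exp (-(s * μ))) * s ^ (-α - 1))
      (𝓝[>] 0) (𝓝 0) := by
    have hc : ContinuousWithinAt (fun ε : ℝ => ∫ s in (0 : ℝ)..ε,
        (1 - Real.exp (-(s * μ))) * s ^ (-α - 1)) (Set.Icc 0 1) 0 := by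
      refine intervalIntegral.continuousWithinAt_primitive (by simp) ?_
      rw [intervalIntegrable_iff_integrableOn_Ioc_of_le (by simp)]
      exact hi.mono_set fun s hs => by simpa using hs.1
    have h := hc.tendsto
    rw [intervalIntegral.integral_same] at h
    exact h.mono_left (nhdsWithin_le_iff.2 (mem_of_superset (Ioo_mem_nhdsGT one_pos)
      Set.Ioo_subset_Icc_self))
  have h3 := tendsto_const_nhds (x := ∫ s in Set.Ioi (0:ℝ), (1 - Real.exp (-(s * μ))) * s ^ (-α - 1))
    |>.sub h2
  rw [sub_zero] at h3
  refine h3.congr' ?_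
  filter_upwards [self_mem_nhdsWithin] with ε hε
  exact (h1 ε (le_of_lt hε)).symm

lemma mul_exp_neg_le (x : ℝ) : x * Real.exp (-x) ≤ 1 := by
  have := Real.add_one_le_exp x
  rw [Real.exp_neg, mul_inv_le_iff₀ (Real.exp_pos x)]
  linarith

end Scalar

/-! ### Diagonal operators on an orthogonal sum of subspaces. -/

section Abstract

variable {H : Type*} [NormedAddCommGroup H] [InnerProductSpace ℝ H] [CompleteSpace H]
  {V : ℕ → Submodule ℝ H} [∀ l, CompleteSpace (V l)]

/-- The Hilbert space is the orthogonal sum of the subspaces. -/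
structure IsOrthogonalDecomposition (V : ℕ → Submodule ℝ H) [∀ l, CompleteSpace (V l)] : Prop where
  orthogonal : OrthogonalFamily ℝ (fun l => V l) fun l => (V l).subtypeₗᵢ
  total : ∀ f, (∀ l, (V l).starProjection f = 0) → f = 0

variable (V) in
/-- The diagonal operator with the given multipliers. -/
noncomputable def diagOp (b : ℕ → ℝ) (f : H) : H := ∑' l, b l • (V l).starProjection f

namespace IsOrthogonalDecomposition

omit [CompleteSpace H] in
lemma starProjection_starProjection (hV : IsOrthogonalDecomposition V) (k l : ℕ) (f : H) :
    (V k).starProjection ((V l).starProjection f) = if k = l then (V k).starProjection f else 0 := by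
  split_ifs with h
  · subst h
    exact Submodule.starProjection_eq_self_iff.2 (Submodule.starProjection_apply_mem _ _)
  · rw [Submodule.starProjection_apply_eq_zero_iff, Submodule.mem_orthogonal]
    intro u hu
    exact hV.orthogonal h ⟨u, hu⟩ ⟨_, Submodule.starProjection_apply_mem (V l) f⟩

omit [CompleteSpace H] in
lemma inner_self_starProjection (l : ℕ) (f : H) :
    inner ℝ f ((V l).starProjection f) = ‖(V l).starProjection f‖ ^ 2 := by
  rw [← real_inner_self_eq_norm_sq]
  have := Submodule.starProjection_inner_eq_zero (K := V l) f ((V l).starProjection f)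
    (Submodule.starProjection_apply_mem _ _)
  rw [inner_sub_left, sub_eq_zero] at this
  exact this

omit [CompleteSpace H] in
lemma norm_sum_sq (hV : IsOrthogonalDecomposition V) (s : Finset ℕ) (f : H) :
    ‖∑ l ∈ s, (V l).starProjection f‖ ^ 2 = ∑ l ∈ s, ‖(V l).starProjection f‖ ^ 2 :=
  hV.orthogonal.norm_sum
    (fun l => (⟨_, Submodule.starProjection_apply_mem (V l) f⟩ : V l)) s

omit [CompleteSpace H] in
-- Bessel's inequality: the partial sum S satisfies ⟨f, S⟩ = ‖S‖², and Cauchy–Schwarz finishes.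
lemma sum_norm_sq_le (hV : IsOrthogonalDecomposition V) (s : Finset ℕ) (f : H) :
    ∑ l ∈ s, ‖(V l).starProjection f‖ ^ 2 ≤ ‖f‖ ^ 2 := by
  have h1 : inner ℝ f (∑ l ∈ s, (V l).starProjection f) = ∑ l ∈ s, ‖(V l).starProjection f‖ ^ 2 := by
    rw [inner_sum]
    exact Finset.sum_congr rfl fun l _ => inner_self_starProjection l f
  have h2 := hV.norm_sum_sq s f
  have h3 := real_inner_le_norm f (∑ l ∈ s, (V l).starProjection f)
  nlinarith [sq_nonneg (‖f‖ - ‖∑ l ∈ s, (V l).starProjection f‖)]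

omit [CompleteSpace H] in
lemma summable_norm_sq (hV : IsOrthogonalDecomposition V) (f : H) :
    Summable fun l => ‖(V l).starProjection f‖ ^ 2 :=
  summable_of_sum_le (fun _ => sq_nonneg _) fun s => hV.sum_norm_sq_le s f

lemma summable_smul (hV : IsOrthogonalDecomposition V) {b : ℕ → ℝ} {C : ℝ} (hb : ∀ l, |b l| ≤ C)
    (f : H) : Summable fun l => b l • (V l).starProjection f := by
  have := (hV.orthogonal.summable_iff_norm_sq_summable
    (fun l => b l • (⟨_, Submodule.starProjection_apply_mem (V l) f⟩ : V l))).2 (by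
      refine Summable.of_nonneg_of_le (fun _ => sq_nonneg _) (fun l => ?_)
        ((hV.summable_norm_sq f).mul_left (C ^ 2))
      rw [norm_smul, mul_pow]
      exact mul_le_mul_of_nonneg_right (by simpa using pow_le_pow_left₀ (abs_nonneg _) (hb l) 2)
        (sq_nonneg _))
  exact this

lemma starProjection_diagOp (hV : IsOrthogonalDecomposition V) {b : ℕ → ℝ} {C : ℝ}
    (hb : ∀ l, |b l| ≤ C) (f : H) (k : ℕ) :
    (V k).starProjection (diagOp V b f) = b k • (V k).starProjection f := by
  rw [diagOp, (V k).starProjection.map_tsum (hV.summable_smul hb f), tsum_eq_single k]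
  · rw [map_smul, hV.starProjection_starProjection, if_pos rfl]
  · intro l hl
    rw [map_smul, hV.starProjection_starProjection, if_neg hl.symm, smul_zero]

omit [CompleteSpace H] in
lemma ext (hV : IsOrthogonalDecomposition V) {f g : H}
    (h : ∀ l, (V l).starProjection f = (V l).starProjection g) : f = g := by
  rw [← sub_eq_zero]
  exact hV.total _ fun l => by rw [map_sub, h l, sub_self]

lemma diagOp_one (hV : IsOrthogonalDecomposition V) (f : H) : diagOp V (fun _ => 1) f = f :=
  hV.ext fun l => by rw [hV.starProjection_diagOp (C := 1) (by simp), one_smul]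

/-- Parseval: by totality f is the sum of its projections (the multiplier 1), and pairing with f
gives the squares. -/
lemma hasSum_norm_sq (hV : IsOrthogonalDecomposition V) (f : H) :
    HasSum (fun l => ‖(V l).starProjection f‖ ^ 2) (‖f‖ ^ 2) := by
  have h1 : HasSum (fun l => (V l).starProjection f) f := by
    have h := (hV.summable_smul (b := fun _ => 1) (C := 1) (by simp) f).hasSum
    have h2 := hV.diagOp_one f
    rw [diagOp] at h2
    rw [h2] at h
    simpa using h
  have h2 := h1.mapL (innerSL ℝ f)
  simp only [innerSL_apply_apply, inner_self_starProjection, real_inner_self_eq_norm_sq] at h2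
  exact h2

lemma norm_sq_diagOp (hV : IsOrthogonalDecomposition V) {b : ℕ → ℝ} {C : ℝ}
    (hb : ∀ l, |b l| ≤ C) (f : H) :
    ‖diagOp V b f‖ ^ 2 = ∑' l, b l ^ 2 * ‖(V l).starProjection f‖ ^ 2 := by
  rw [← (hV.hasSum_norm_sq _).tsum_eq]
  refine tsum_congr fun l => ?_
  rw [hV.starProjection_diagOp hb, norm_smul, mul_pow, Real.norm_eq_abs, sq_abs]

lemma norm_diagOp_le (hV : IsOrthogonalDecomposition V) {b : ℕ → ℝ} {C : ℝ}
    (hb : ∀ l, |b l| ≤ C) (f : H) : ‖diagOp V b f‖ ≤ C * ‖f‖ := by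
  have hC : 0 ≤ C := (abs_nonneg _).trans (hb 0)
  refine le_of_sq_le_sq ?_ (by positivity)
  rw [hV.norm_sq_diagOp hb, mul_pow, ← (hV.hasSum_norm_sq f).tsum_eq, ← tsum_mul_left]
  have h : ∀ l, b l ^ 2 * ‖(V l).starProjection f‖ ^ 2 ≤ C ^ 2 * ‖(V l).starProjection f‖ ^ 2 :=
    fun l => mul_le_mul_of_nonneg_right (by simpa using pow_le_pow_left₀ (abs_nonneg _) (hb l) 2)
      (sq_nonneg _)
  exact Summable.tsum_le_tsum h (Summable.of_nonneg_of_le (fun _ => by positivity) h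
    ((hV.summable_norm_sq f).mul_left _)) ((hV.summable_norm_sq f).mul_left _)

lemma diagOp_sub (hV : IsOrthogonalDecomposition V) {b c : ℕ → ℝ} {C C' : ℝ}
    (hb : ∀ l, |b l| ≤ C) (hc : ∀ l, |c l| ≤ C') (f : H) :
    diagOp V b f - diagOp V c f = diagOp V (fun l => b l - c l) f :=
  hV.ext fun l => by
    rw [map_sub, hV.starProjection_diagOp hb, hV.starProjection_diagOp hc,
      hV.starProjection_diagOp (C := C + C') fun l => (abs_sub _ _).trans (add_le_add (hb l) (hc l)),
      sub_smul]

lemma smul_diagOp (hV : IsOrthogonalDecomposition V) {b : ℕ → ℝ} {C : ℝ}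
    (hb : ∀ l, |b l| ≤ C) (c : ℝ) (f : H) :
    c • diagOp V b f = diagOp V (fun l => c * b l) f :=
  hV.ext fun l => by
    rw [map_smul, hV.starProjection_diagOp hb, hV.starProjection_diagOp (C := |c| * C) fun l => by
      rw [abs_mul]; exact mul_le_mul_of_nonneg_left (hb l) (abs_nonneg _), smul_smul]

/-- Dominated convergence for the series of squared norms. Continuity in time, the time derivative
and the Bochner limit ε ↓ 0 all reduce to this statement about scalar multipliers. -/
lemma tendsto_diagOp (hV : IsOrthogonalDecomposition V) {ι : Type*} {F : Filter ι}
    {b : ι → ℕ → ℝ} {c : ℕ → ℝ} {C : ℝ} (hb : ∀ᶠ i in F, ∀ l, |b i l| ≤ C) (hc : ∀ l, |c l| ≤ C)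
    (h : ∀ l, Tendsto (fun i => b i l) F (𝓝 (c l))) (f : H) :
    Tendsto (fun i => diagOp V (b i) f) F (𝓝 (diagOp V c f)) := by
  have hs := (hV.summable_norm_sq f).mul_left ((C + C) ^ 2)
  have hd : ∀ i, (∀ l, |b i l| ≤ C) → ∀ l, |b i l - c l| ≤ C + C := fun i hi l =>
    (abs_sub _ _).trans (add_le_add (hi l) (hc l))
  have h1 : Tendsto (fun i => ∑' l, (b i l - c l) ^ 2 * ‖(V l).starProjection f‖ ^ 2) F
      (𝓝 (∑' l : ℕ, (0 : ℝ))) := by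
    refine tendsto_tsum_of_dominated_convergence hs (fun l => ?_) ?_
    · have := (((h l).sub_const (c l)).pow 2).mul_const (‖(V l).starProjection f‖ ^ 2)
      simpa using this
    · filter_upwards [hb] with i hi l
      rw [Real.norm_eq_abs, abs_of_nonneg (by positivity)]
      exact mul_le_mul_of_nonneg_right (by simpa using pow_le_pow_left₀ (abs_nonneg _) (hd i hi l) 2)
        (sq_nonneg _)
  rw [tsum_zero] at h1
  rw [tendsto_iff_norm_sub_tendsto_zero]
  have h2 := h1.sqrt
  rw [Real.sqrt_zero] at h2
  refine h2.congr' ?_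
  filter_upwards [hb] with i hi
  rw [hV.diagOp_sub hi hc, ← hV.norm_sq_diagOp (hd i hi), Real.sqrt_sq (norm_nonneg _)]

end IsOrthogonalDecomposition

end Abstract

/-! ### The Cauchy problem in `L²(S²)`: existence and uniqueness. -/

section FracHeat

variable {α : ℝ}

lemma isOrthogonalDecomposition_sphEigenspace (h : HasHeatKernel) :
    IsOrthogonalDecomposition sphEigenspace :=
  ⟨orthogonalFamily_sphEigenspace h, eq_zero_of_starProjection_sphEigenspace h⟩

lemma heatSemigroup_eq_diagOp (s : ℝ) (f : L2S) :
    heatSemigroup s f = diagOp sphEigenspace (fun l => Real.exp (-(s * sphEigenvalue l))) f := rfl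

lemma abs_exp_neg_le_one {x : ℝ} (hx : 0 ≤ x) : |Real.exp (-x)| ≤ 1 := by
  rw [abs_of_pos (Real.exp_pos _)]
  exact Real.exp_le_one_iff.2 (neg_nonpos.2 hx)

lemma sphEigenvalue_rpow_nonneg (l : ℕ) : 0 ≤ sphEigenvalue l ^ α :=
  Real.rpow_nonneg (sphEigenvalue_nonneg l) _

section

variable (hV : IsOrthogonalDecomposition sphEigenspace)
include hV

lemma continuousOn_heatSemigroup (f : L2S) :
    ContinuousOn (fun s => heatSemigroup s f) (Set.Ioi 0) := by
  intro s hs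
  simp only [heatSemigroup_eq_diagOp]
  refine hV.tendsto_diagOp (C := 1) ?_ ?_ (fun l => ?_) f
  · filter_upwards [self_mem_nhdsWithin] with s hs l
    exact abs_exp_neg_le_one (mul_nonneg (le_of_lt hs) (sphEigenvalue_nonneg l))
  · exact fun l => abs_exp_neg_le_one (mul_nonneg (le_of_lt hs) (sphEigenvalue_nonneg l))
  · exact (Continuous.tendsto (by fun_prop) s).mono_left nhdsWithin_le_nhds

lemma norm_heatSemigroup_le {s : ℝ} (hs : 0 ≤ s) (f : L2S) : ‖heatSemigroup s f‖ ≤ ‖f‖ := by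
  have := hV.norm_diagOp_le (C := 1) (b := fun l => Real.exp (-(s * sphEigenvalue l)))
    (fun l => abs_exp_neg_le_one (mul_nonneg hs (sphEigenvalue_nonneg l))) f
  rwa [one_mul] at this

lemma integrableOn_heatSemigroup (hα₀ : 0 < α) {ε : ℝ} (hε : 0 < ε) (f : L2S) :
    IntegrableOn (fun s : ℝ => s ^ (-α - 1) • (heatSemigroup s f - f)) (Set.Ioi ε) := by
  have h1 : IntegrableOn (fun s : ℝ => s ^ (-α - 1) * (2 * ‖f‖)) (Set.Ioi ε) :=
    (integrableOn_Ioi_rpow_of_lt (by linarith) hε).mul_const _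
  have hc : ContinuousOn (fun s : ℝ => s ^ (-α - 1) • (heatSemigroup s f - f)) (Set.Ioi 0) :=
    (continuousOn_rpow_Ioi _).smul ((continuousOn_heatSemigroup hV f).sub continuousOn_const)
  refine Integrable.mono' h1 ((hc.mono (Set.Ioi_subset_Ioi hε.le)).aestronglyMeasurable
    measurableSet_Ioi) ?_
  filter_upwards [ae_restrict_mem measurableSet_Ioi] with s hs
  have hs0 : (0 : ℝ) < s := hε.trans hs
  rw [norm_smul, Real.norm_eq_abs, abs_of_nonneg (Real.rpow_nonneg hs0.le _)]
  refine mul_le_mul_of_nonneg_left ?_ (Real.rpow_nonneg hs0.le _)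
  refine (norm_sub_le _ _).trans ?_
  linarith [norm_heatSemigroup_le hV hs0.le f]

/-- The projection passes through the Bochner integral, and on the eigenspace the semigroup is the
scalar e^{-sμ_l}. -/
lemma starProjection_integral_heatSemigroup (hα₀ : 0 < α) {ε : ℝ} (hε : 0 < ε)
    (f : L2S) (l : ℕ) :
    (sphEigenspace l).starProjection ((α / Real.Gamma (1 - α)) •
      ∫ s in Set.Ioi ε, s ^ (-α - 1) • (heatSemigroup s f - f)) =
      -truncatedExponent α ε (sphEigenvalue l) • (sphEigenspace l).starProjection f := by
  rw [map_smul, ← ContinuousLinearMap.integral_comp_comm _ (integrableOn_heatSemigroup hV hα₀ hε f)]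
  have h1 : ∫ s in Set.Ioi ε, (sphEigenspace l).starProjection
      (s ^ (-α - 1) • (heatSemigroup s f - f)) =
      ∫ s in Set.Ioi ε, (-((1 - Real.exp (-(s * sphEigenvalue l))) * s ^ (-α - 1))) •
        (sphEigenspace l).starProjection f := by
    refine setIntegral_congr_fun measurableSet_Ioi fun s hs => ?_
    have hs0 : (0 : ℝ) < s := hε.trans hs
    rw [map_smul, map_sub, heatSemigroup_eq_diagOp, hV.starProjection_diagOp (C := 1)
      (fun l => abs_exp_neg_le_one (mul_nonneg hs0.le (sphEigenvalue_nonneg l)))]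
    module
  rw [h1, integral_smul_const, integral_neg, smul_smul, truncatedExponent]
  congr 1
  ring

lemma starProjection_of_hasFracLaplacian (hα₀ : 0 < α) (hα₁ : α < 1) {f g : L2S}
    (h : HasFracLaplacian α f g) (l : ℕ) :
    (sphEigenspace l).starProjection g =
      sphEigenvalue l ^ α • (sphEigenspace l).starProjection f := by
  have h1 := ((sphEigenspace l).starProjection.continuous.tendsto _).comp h
  have h2 := ((tendsto_truncatedExponent hα₀ hα₁ (sphEigenvalue_nonneg l)).neg).smul_const
    ((sphEigenspace l).starProjection f)
  have h3 := tendsto_nhds_unique (h1.congr' (by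
    filter_upwards [self_mem_nhdsWithin] with ε hε
    exact starProjection_integral_heatSemigroup hV hα₀ hε f l)) h2
  rw [map_neg, neg_smul] at h3
  exact neg_injective h3

/-- The solution of the fractional heat equation, mode by mode. -/
noncomputable def fracHeat (α : ℝ) (f : L2S) (t : ℝ) : L2S :=
  diagOp sphEigenspace (fun l => Real.exp (-(t * sphEigenvalue l ^ α))) f

omit hV in
lemma abs_mul_exp_le {t x : ℝ} (ht : 0 < t) (hx : 0 ≤ x) : |x * Real.exp (-(t * x))| ≤ 1 / t := by
  rw [abs_of_nonneg (by positivity), le_div_iff₀ ht]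
  have := mul_exp_neg_le (t * x)
  linarith

lemma starProjection_fracHeat {t : ℝ} (ht : 0 ≤ t) (f : L2S) (l : ℕ) :
    (sphEigenspace l).starProjection (fracHeat α f t) =
      Real.exp (-(t * sphEigenvalue l ^ α)) • (sphEigenspace l).starProjection f :=
  hV.starProjection_diagOp (C := 1)
    (fun l => abs_exp_neg_le_one (mul_nonneg ht (sphEigenvalue_rpow_nonneg l))) f l

lemma fracHeat_zero (f : L2S) : fracHeat α f 0 = f := by
  simpa [fracHeat] using hV.diagOp_one f

lemma continuousOn_fracHeat (f : L2S) : ContinuousOn (fracHeat α f) (Set.Ici 0) := by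
  intro s hs
  refine hV.tendsto_diagOp (C := 1) ?_ ?_ (fun l => ?_) f
  · filter_upwards [self_mem_nhdsWithin] with s hs l
    exact abs_exp_neg_le_one (mul_nonneg hs (sphEigenvalue_rpow_nonneg l))
  · exact fun l => abs_exp_neg_le_one (mul_nonneg hs (sphEigenvalue_rpow_nonneg l))
  · exact (Continuous.tendsto (by fun_prop) s).mono_left nhdsWithin_le_nhds

/-- The truncated multipliers are at most μ_l^α e^{-tμ_l^α} ≤ 1/t, uniformly in ε and `l`: the
solution enters the domain at once, whatever the initial datum in L². -/
lemma hasFracLaplacian_fracHeat (hα₀ : 0 < α) (hα₁ : α < 1) {t : ℝ} (ht : 0 < t) (f : L2S) :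
    HasFracLaplacian α (fracHeat α f t) (diagOp sphEigenspace
      (fun l => sphEigenvalue l ^ α * Real.exp (-(t * sphEigenvalue l ^ α))) f) := by
  have hb : ∀ ε : ℝ, 0 ≤ ε → ∀ l, |-(truncatedExponent α ε (sphEigenvalue l) *
      Real.exp (-(t * sphEigenvalue l ^ α)))| ≤ 1 / t := fun ε hε l => by
    rw [abs_neg]
    refine le_trans ?_ (abs_mul_exp_le ht (sphEigenvalue_rpow_nonneg (α := α) l))
    rw [abs_mul, abs_mul, abs_of_nonneg (truncatedExponent_nonneg hα₀ hα₁ (sphEigenvalue_nonneg l) hε),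
      abs_of_nonneg (sphEigenvalue_rpow_nonneg (α := α) l)]
    exact mul_le_mul_of_nonneg_right (truncatedExponent_le hα₀ hα₁ (sphEigenvalue_nonneg l) hε)
      (abs_nonneg _)
  have hc : ∀ l, |sphEigenvalue l ^ α * Real.exp (-(t * sphEigenvalue l ^ α))| ≤ 1 / t := fun l =>
    abs_mul_exp_le ht (sphEigenvalue_rpow_nonneg l)
  have h1 : Tendsto (fun ε => diagOp sphEigenspace (fun l => -(truncatedExponent α ε (sphEigenvalue l) *
      Real.exp (-(t * sphEigenvalue l ^ α)))) f) (𝓝[>] 0) (𝓝 (diagOp sphEigenspace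
      (fun l => -(sphEigenvalue l ^ α * Real.exp (-(t * sphEigenvalue l ^ α)))) f)) := by
    refine hV.tendsto_diagOp (C := 1 / t) ?_ (by simpa only [abs_neg] using hc) (fun l => ?_) f
    · filter_upwards [self_mem_nhdsWithin] with ε hε
      exact hb ε (le_of_lt hε)
    · exact ((tendsto_truncatedExponent hα₀ hα₁ (sphEigenvalue_nonneg l)).mul_const _).neg
  have h2 := hV.smul_diagOp hc (-1) f
  simp only [neg_mul, one_mul, neg_smul, one_smul] at h2
  rw [HasFracLaplacian, h2]
  refine h1.congr' ?_
  filter_upwards [self_mem_nhdsWithin] with ε hε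
  refine hV.ext fun l => ?_
  rw [starProjection_integral_heatSemigroup hV hα₀ hε, hV.starProjection_diagOp (hb ε (le_of_lt hε)),
    starProjection_fracHeat hV ht.le, smul_smul, neg_mul]

lemma hasDerivAt_fracHeat {t : ℝ} (ht : 0 < t) (f : L2S) :
    HasDerivAt (fracHeat α f) (-(diagOp sphEigenspace
      (fun l => sphEigenvalue l ^ α * Real.exp (-(t * sphEigenvalue l ^ α))) f)) t := by
  have hc : ∀ s, 0 < s → ∀ l, |sphEigenvalue l ^ α * Real.exp (-(s * sphEigenvalue l ^ α))| ≤ 1 / s :=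
    fun s hs l => abs_mul_exp_le hs (sphEigenvalue_rpow_nonneg l)
  have h2 := hV.smul_diagOp (hc t ht) (-1) f
  simp only [neg_mul, one_mul, neg_smul, one_smul] at h2
  rw [h2, hasDerivAt_iff_tendsto_slope]
  have he : ∀ s, 0 ≤ s → ∀ l, |Real.exp (-(s * sphEigenvalue l ^ α))| ≤ 1 := fun s hs l =>
    abs_exp_neg_le_one (mul_nonneg hs (sphEigenvalue_rpow_nonneg l))
  have hd : ∀ (l : ℕ) (s : ℝ), HasDerivAt (fun s => Real.exp (-(s * sphEigenvalue l ^ α)))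
      (-(sphEigenvalue l ^ α * Real.exp (-(s * sphEigenvalue l ^ α)))) s := fun l s => by
    refine (((hasDerivAt_id' s).mul_const _).fun_neg.exp).congr_deriv ?_
    ring
  -- On (t/2, ∞) the derivative of every mode is at most 2/t, so the mean value inequality bounds
  -- all slopes uniformly in `l`.
  have hmem : Set.Ioi (t / 2) ∈ 𝓝 t := Ioi_mem_nhds (by linarith)
  have h3 : Tendsto (fun s => diagOp sphEigenspace (fun l => slope
      (fun s => Real.exp (-(s * sphEigenvalue l ^ α))) t s) f) (𝓝[≠] t) (𝓝 (diagOp sphEigenspace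
      (fun l => -(sphEigenvalue l ^ α * Real.exp (-(t * sphEigenvalue l ^ α)))) f)) := by
    refine hV.tendsto_diagOp (C := 2 / t) ?_ (fun l => ?_) (fun l => ?_) f
    · filter_upwards [nhdsWithin_le_nhds hmem, self_mem_nhdsWithin] with s hs hst l
      have h4 := (convex_Ioi (t / 2)).norm_image_sub_le_of_norm_hasDerivWithin_le (C := 2 / t)
        (fun x _ => (hd l x).hasDerivWithinAt) (fun x hx => by
          have hx' : t / 2 < x := hx
          have hx0 : 0 < x := (half_pos ht).trans hx'
          rw [norm_neg, Real.norm_eq_abs]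
          refine (hc x hx0 l).trans ?_
          rw [div_le_div_iff₀ hx0 ht]
          linarith) (show t ∈ Set.Ioi (t / 2) by simpa using ht) hs
      have h5 : 0 < |s - t| := abs_pos.2 (sub_ne_zero.2 hst)
      rw [slope_def_field, abs_div, div_le_iff₀ h5]
      exact h4
    · rw [abs_neg]
      refine (hc t ht l).trans ?_
      gcongr
      norm_num
    · exact hasDerivAt_iff_tendsto_slope.1 (hd l t)
  refine h3.congr' ?_
  filter_upwards [nhdsWithin_le_nhds hmem] with s hs
  have hs' : t / 2 < s := hs
  have hs0 : 0 ≤ s := ((half_pos ht).trans hs').le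
  rw [slope_def_module, fracHeat, fracHeat, hV.diagOp_sub (he s hs0) (he t ht.le),
    hV.smul_diagOp (C := 1 + 1) (fun l => (abs_sub _ _).trans (add_le_add (he s hs0 l) (he t ht.le l)))]
  rfl

/-- In each mode the equation is y' = -c y, so e^{sc} y(s) is constant, and totality of the
eigenspaces recovers u. -/
lemma eq_fracHeat_of_hasDerivAt (hα₀ : 0 < α) (hα₁ : α < 1) {f : L2S} {u : ℝ → L2S} (h0 : u 0 = f)
    (hc : ContinuousOn u (Set.Ici 0))
    (hd : ∀ t : ℝ, 0 < t → ∃ g : L2S, HasFracLaplacian α (u t) g ∧ HasDerivAt u (-g) t)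
    {t : ℝ} (ht : 0 ≤ t) : u t = fracHeat α f t := by
  rcases ht.eq_or_lt with rfl | ht
  · rw [h0, fracHeat_zero hV]
  refine hV.ext fun l => ?_
  rw [starProjection_fracHeat hV ht.le]
  set c := sphEigenvalue l ^ α
  set w : ℝ → L2S := fun s => Real.exp (s * c) • (sphEigenspace l).starProjection (u s) with hw
  have hwc : ContinuousOn w (Set.Ici 0) :=
    ContinuousOn.smul (Real.continuous_exp.comp (continuous_id.mul continuous_const)).continuousOn
      ((sphEigenspace l).starProjection.continuous.comp_continuousOn hc)
  have hwd : ∀ s, 0 < s → HasDerivAt w 0 s := fun s hs => by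
    obtain ⟨g, hg, hg'⟩ := hd s hs
    have h1 := ((sphEigenspace l).starProjection.hasFDerivAt.comp_hasDerivAt s hg')
    have h2 : HasDerivAt (fun s => Real.exp (s * c)) (Real.exp (s * c) * c) s := by
      simpa using ((hasDerivAt_id' s).mul_const c).exp
    refine (h2.smul h1).congr_deriv ?_
    simp only [map_neg, starProjection_of_hasFracLaplacian hV hα₀ hα₁ hg l, Function.comp_apply]
    module
  -- The equation holds for positive times only: constancy is first obtained on [s, t], and
  -- continuity at 0 then allows s ↓ 0.
  have h1 : ∀ s, 0 < s → s ≤ t → w t = w s := fun s hs hst =>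
    constant_of_has_deriv_right_zero (hwc.mono fun x hx => hs.le.trans hx.1)
      (fun x hx => (hwd x (hs.trans_le hx.1)).hasDerivWithinAt) t ⟨hst, le_rfl⟩
  have h2 : Tendsto w (𝓝[>] 0) (𝓝 (w 0)) :=
    (hwc 0 (Set.mem_Ici.2 le_rfl)).tendsto.mono_left (nhdsWithin_mono _ Set.Ioi_subset_Ici_self)
  have h3 : w t = w 0 := by
    refine tendsto_nhds_unique (tendsto_const_nhds.congr' ?_) h2
    filter_upwards [Ioo_mem_nhdsGT ht] with s hs
    exact h1 s hs.1 hs.2.le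
  simp only [hw, zero_mul, Real.exp_zero, one_smul, h0] at h3
  rw [← h3, smul_smul, ← Real.exp_add, neg_add_cancel, Real.exp_zero, one_smul]

end

end FracHeat

/-! ### Gaussian closed linear spans -/

section GaussianClosure

variable {Ω : Type*} [MeasurableSpace Ω] {P : Measure Ω} [IsProbabilityMeasure P]

/-- `Y` is a centred Gaussian element of `L²(P)`, in terms of its characteristic function. -/
def IsCentredGaussian (Y : Lp ℝ 2 P) : Prop :=
  ∫ ω, Y ω ∂P = 0 ∧ ∀ s : ℝ, ∫ ω, Complex.exp (s * Y ω * Complex.I) ∂P =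
    Complex.exp (-(s ^ 2 * ‖Y‖ ^ 2 / 2 : ℝ))

omit [IsProbabilityMeasure P] in
lemma Lp.norm_sq_eq_integral (Y : Lp ℝ 2 P) : ‖Y‖ ^ 2 = ∫ ω, Y ω ^ 2 ∂P := by
  rw [← real_inner_self_eq_norm_sq, L2.inner_def]
  refine integral_congr_ae (Eventually.of_forall fun ω => ?_)
  simp [sq]

lemma Lp.integral_abs_sub_le (Y Z : Lp ℝ 2 P) : ∫ ω, |Y ω - Z ω| ∂P ≤ ‖Y - Z‖ := by
  have h1 : ∫ ω, |Y ω - Z ω| ∂P = ∫ ω, ‖(Y - Z) ω‖ ∂P := by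
    refine integral_congr_ae ?_
    filter_upwards [Lp.coeFn_sub Y Z] with ω hω
    rw [hω]; rfl
  rw [h1, integral_norm_eq_lintegral_enorm (Lp.aestronglyMeasurable _), Lp.norm_def,
    ← eLpNorm_one_eq_lintegral_enorm]
  refine ENNReal.toReal_mono (Lp.eLpNorm_ne_top _) ?_
  exact eLpNorm_le_eLpNorm_of_exponent_le (by norm_num) (Lp.aestronglyMeasurable _)

lemma integrable_exp_mul_I {Y : Ω → ℝ} (hY : AEStronglyMeasurable Y P) (s : ℝ) :
    Integrable (fun ω => Complex.exp (s * Y ω * Complex.I)) P := by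
  refine Integrable.of_bound (C := 1) ?_ (Eventually.of_forall fun ω => ?_)
  · exact Complex.continuous_exp.comp_aestronglyMeasurable
      (((Complex.continuous_ofReal.comp_aestronglyMeasurable hY).const_mul _).mul_const _)
  · rw [← Complex.ofReal_mul, Complex.norm_exp_ofReal_mul_I]

/-- From |e^{ia} - e^{ib}| ≤ |a - b| and the inclusion of L² in L¹, the map is Lipschitz with
constant |s|. -/
lemma continuous_integral_exp (s : ℝ) :
    Continuous fun Y : Lp ℝ 2 P => ∫ ω, Complex.exp (s * Y ω * Complex.I) ∂P := by
  refine (LipschitzWith.of_dist_le_mul (K := Real.nnabs s) fun Y Z => ?_).continuous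
  rw [dist_eq_norm, dist_eq_norm, ← integral_sub (integrable_exp_mul_I (Lp.aestronglyMeasurable _) s)
    (integrable_exp_mul_I (Lp.aestronglyMeasurable _) s)]
  have hi : Integrable (fun ω => |Y ω - Z ω|) P :=
    (((Lp.memLp Y).integrable (by norm_num)).sub ((Lp.memLp Z).integrable (by norm_num))).abs
  refine (norm_integral_le_of_norm_le (hi.const_mul |s|) (Eventually.of_forall fun ω => ?_)).trans ?_
  · have h1 : Complex.exp (s * Y ω * Complex.I) - Complex.exp (s * Z ω * Complex.I) =
        Complex.exp (s * Z ω * Complex.I) *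
          (Complex.exp (Complex.I * (s * (Y ω - Z ω) : ℝ)) - 1) := by
      rw [mul_sub, ← Complex.exp_add, mul_one]
      congr 2
      push_cast
      ring
    rw [h1, norm_mul, ← Complex.ofReal_mul, Complex.norm_exp_ofReal_mul_I, one_mul]
    refine (Real.norm_exp_I_mul_ofReal_sub_one_le).trans ?_
    rw [Real.norm_eq_abs, abs_mul]
  · rw [integral_const_mul]
    exact mul_le_mul_of_nonneg_left (Lp.integral_abs_sub_le Y Z) (abs_nonneg _)

lemma continuous_integral_Lp : Continuous fun Y : Lp ℝ 2 P => ∫ ω, Y ω ∂P := by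
  refine (LipschitzWith.of_dist_le_mul (K := 1) fun Y Z => ?_).continuous
  rw [dist_eq_norm, dist_eq_norm, ← integral_sub ((Lp.memLp Y).integrable (by norm_num))
    ((Lp.memLp Z).integrable (by norm_num)), NNReal.coe_one, one_mul]
  exact (norm_integral_le_integral_norm _).trans (Lp.integral_abs_sub_le Y Z)

/-- The mean, the characteristic function and the norm are continuous on L²(P), so limits of centred
Gaussian variables, possibly degenerate, are centred Gaussian. -/
lemma isClosed_isCentredGaussian : IsClosed {Y : Lp ℝ 2 P | IsCentredGaussian Y} := by
  have h : {Y : Lp ℝ 2 P | IsCentredGaussian Y} = {Y | ∫ ω, Y ω ∂P = 0} ∩ ⋂ s : ℝ,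
      {Y | ∫ ω, Complex.exp (s * Y ω * Complex.I) ∂P =
        Complex.exp (-(s ^ 2 * ‖Y‖ ^ 2 / 2 : ℝ))} := by
    ext Y
    simp [IsCentredGaussian]
  rw [h]
  refine (isClosed_eq continuous_integral_Lp continuous_const).inter (isClosed_iInter fun s => ?_)
  refine isClosed_eq (continuous_integral_exp s) ?_
  fun_prop

lemma variance_eq_norm_toLp_sq {X : Ω → ℝ} (hX : MemLp X 2 P) (h0 : ∫ ω, X ω ∂P = 0) :
    Var[X; P] = ‖hX.toLp X‖ ^ 2 := by
  rw [variance_eq_sub hX, h0, Lp.norm_sq_eq_integral]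
  simp only [ne_eq, OfNat.ofNat_ne_zero, not_false_eq_true, zero_pow, sub_zero]
  refine integral_congr_ae ?_
  filter_upwards [hX.coeFn_toLp] with ω hω
  simp [hω]

lemma isCentredGaussian_toLp {X : Ω → ℝ} (hX : HasGaussianLaw X P) (h0 : ∫ ω, X ω ∂P = 0) :
    IsCentredGaussian (hX.memLp_two.toLp X) := by
  have he := hX.memLp_two.coeFn_toLp
  refine ⟨by rw [integral_congr_ae he, h0], fun s => ?_⟩
  rw [← variance_eq_norm_toLp_sq _ h0]
  have h1 := hX.charFun_map_eq s
  rw [charFun_apply_real, integral_map hX.aemeasurable (by fun_prop)] at h1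
  have h2 : ∫ ω, Complex.exp (s * (hX.memLp_two.toLp X) ω * Complex.I) ∂P =
      ∫ ω, Complex.exp (s * X ω * Complex.I) ∂P := by
    refine integral_congr_ae ?_
    filter_upwards [he] with ω hω
    rw [hω]
  rw [h2, h1]
  have h3 : (fun ω => inner ℝ s (X ω)) = fun ω => s * X ω := by
    funext ω; simp [mul_comm]
  rw [h3, integral_const_mul, h0, variance_const_mul]
  congr 1
  push_cast
  ring

/-- The closed linear span of a family of square integrable random variables. -/
noncomputable def closedSpan {ι : Type*} {X : ι → Ω → ℝ} (hX : ∀ i, MemLp (X i) 2 P) :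
    Submodule ℝ (Lp ℝ 2 P) :=
  (Submodule.span ℝ (Set.range fun i => (hX i).toLp (X i))).topologicalClosure

lemma isCentredGaussian_of_mem_closedSpan {ι : Type*} {X : ι → Ω → ℝ}
    (hG : IsGaussianProcess X P) (h0 : ∀ i, ∫ ω, X i ω ∂P = 0) (hX : ∀ i, MemLp (X i) 2 P)
    {Y : Lp ℝ 2 P} (hY : Y ∈ closedSpan hX) : IsCentredGaussian Y := by
  refine closure_minimal (t := {Y : Lp ℝ 2 P | IsCentredGaussian Y}) ?_ isClosed_isCentredGaussian hY
  intro Y hY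
  obtain ⟨c, rfl⟩ := Finsupp.mem_span_range_iff_exists_finsupp.1 hY
  have hZ : HasGaussianLaw (fun ω => ∑ i ∈ c.support, c i * X i ω) P := by
    have := (hG.hasGaussianLaw c.support).map
      (∑ i : c.support, c i • ContinuousLinearMap.proj (R := ℝ) (φ := fun _ : c.support => ℝ) i)
    convert! this using 1
    funext ω
    simp [Finset.sum_attach c.support fun i => c i * X i ω]
  have hZ0 : ∫ ω, ∑ i ∈ c.support, c i * X i ω ∂P = 0 := by
    rw [integral_finsetSum _ fun i _ => ((hX i).integrable (by norm_num)).const_mul _]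
    exact Finset.sum_eq_zero fun i _ => by rw [integral_const_mul, h0, mul_zero]
  have h := isCentredGaussian_toLp hZ hZ0
  convert! h using 1
  refine Lp.ext ?_
  have h1 : ∀ᵐ ω ∂P, ∀ i ∈ c.support, (c i • (hX i).toLp (X i)) ω = c i * X i ω := by
    refine (ae_ball_iff (Finset.countable_toSet _)).2 fun i _ => ?_
    filter_upwards [Lp.coeFn_smul (c i) ((hX i).toLp (X i)), (hX i).coeFn_toLp] with ω h1 h2
    rw [h1, Pi.smul_apply, h2, smul_eq_mul]
  filter_upwards [hZ.memLp_two.coeFn_toLp, h1,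
    Lp.coeFn_finsetSum c.support fun i => c i • (hX i).toLp (X i)] with ω h1 h2 h3
  rw [h1, Finsupp.sum, h3, Finset.sum_apply]
  exact Finset.sum_congr rfl fun i hi => h2 i hi

/-- A family in the closed linear span of a centred Gaussian process is a Gaussian process. -/
lemma isGaussianProcess_of_mem_closedSpan {ι κ : Type*} {X : ι → Ω → ℝ}
    (hG : IsGaussianProcess X P) (h0 : ∀ i, ∫ ω, X i ω ∂P = 0) (hX : ∀ i, MemLp (X i) 2 P)
    {Z : κ → Ω → ℝ} (hZ : ∀ k, MemLp (Z k) 2 P) (hmem : ∀ k, (hZ k).toLp (Z k) ∈ closedSpan hX) :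
    IsGaussianProcess Z P where
  hasGaussianLaw I := by
    classical
    have hm : AEMeasurable (fun ω => I.restrict (Z · ω)) P :=
      aemeasurable_pi_lambda _ fun k => (hZ k).aestronglyMeasurable.aemeasurable
    rw [hasGaussianLaw_iff_charFunDual_map_eq hm]
    intro L
    -- A linear functional of a finite marginal is a finite combination of the Z_k, hence in the
    -- closed span; Gaussianity of the vector is tested on such functionals.
    set Y : Lp ℝ 2 P := ∑ k : I, L (Pi.single k 1) • (hZ k).toLp (Z k) with hYdef
    have hYmem : Y ∈ closedSpan hX := Submodule.sum_mem _ fun k _ => Submodule.smul_mem _ _ (hmem k)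
    have hYG := isCentredGaussian_of_mem_closedSpan hG h0 hX hYmem
    have hYe : (L ∘ fun ω => I.restrict (Z · ω)) =ᵐ[P] Y := by
      have h1 : ∀ᵐ ω ∂P, ∀ k : I, (L (Pi.single k 1) • (hZ k).toLp (Z k)) ω =
          L (Pi.single k 1) * Z k ω := by
        rw [ae_all_iff]
        intro k
        filter_upwards [Lp.coeFn_smul (L (Pi.single k 1)) ((hZ k).toLp (Z k)),
          (hZ k).coeFn_toLp] with ω h1 h2
        rw [h1, Pi.smul_apply, h2, smul_eq_mul]
      filter_upwards [h1, Lp.coeFn_finsetSum Finset.univ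
        fun k : I => L (Pi.single k 1) • (hZ k).toLp (Z k)] with ω h1 h2
      rw [hYdef, h2, Finset.sum_apply]
      simp only [h1, Function.comp_apply]
      conv_lhs => rw [← Finset.univ_sum_single (I.restrict (Z · ω)), map_sum]
      refine Finset.sum_congr rfl fun k _ => ?_
      have : Pi.single k (I.restrict (Z · ω) k) =
          (Z k ω) • (Pi.single k 1 : I → ℝ) := by
        rw [← Pi.single_smul]; simp
      rw [this, map_smul, smul_eq_mul, mul_comm]
    have hW : MemLp (L ∘ fun ω => I.restrict (Z · ω)) 2 P := (memLp_congr_ae hYe).2 (Lp.memLp Y)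
    have hW0 : ∫ ω, (L ∘ fun ω => I.restrict (Z · ω)) ω ∂P = 0 := by
      rw [integral_congr_ae hYe, hYG.1]
    have hWY : hW.toLp _ = Y := Lp.ext (hW.coeFn_toLp.trans hYe)
    rw [hW0, variance_eq_norm_toLp_sq hW hW0, hWY, charFunDual_apply,
      integral_map hm (by fun_prop)]
    have h2 := hYG.2 1
    rw [show ∫ ω, Complex.exp (L (I.restrict (Z · ω)) * Complex.I) ∂P =
      ∫ ω, Complex.exp ((1 : ℝ) * Y ω * Complex.I) ∂P by
        refine integral_congr_ae ?_
        filter_upwards [hYe] with ω hω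
        rw [← hω]
        simp, h2]
    congr 1
    push_cast
    ring

end GaussianClosure

/-! ### Isotropic Gaussian fields -/

section Field

set_option linter.unusedSectionVars false

/-- The rotation group acts transitively on the sphere. -/
lemma exists_rotation (x y : S2) :
    ∃ g : E3 ≃ₗᵢ[ℝ] E3, LinearMap.det (g : E3 →ₗ[ℝ] E3) = 1 ∧ sphRotate g x = y := by
  by_cases hxy : x = y
  · subst hxy
    refine ⟨LinearIsometryEquiv.refl ℝ E3, ?_, ?_⟩
    · exact LinearMap.det_id
    · rfl
  have hxy' : (x : E3) - y ≠ 0 := sub_ne_zero.2 fun h => hxy (Subtype.ext h)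
  have hn : ‖(x : E3)‖ = ‖(y : E3)‖ := by
    rw [mem_sphere_zero_iff_norm.1 x.2, mem_sphere_zero_iff_norm.1 y.2]
  have hfr : Module.finrank ℝ E3 = 2 + 1 := by simp
  have : Fact (Module.finrank ℝ E3 = 2 + 1) := ⟨hfr⟩
  -- The reflection exchanging x and y has determinant -1. Composing it with the reflection that
  -- negates some z ⊥ y, and hence fixes y, corrects the sign.
  obtain ⟨z, hz, hz0⟩ : ∃ z ∈ (Submodule.span ℝ {(y : E3)})ᗮ, z ≠ 0 := by
    refine Submodule.exists_mem_ne_zero_of_ne_bot fun h => ?_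
    have h1 := Submodule.finrank_orthogonal_span_singleton (𝕜 := ℝ) (n := 2) (S2.ne_zero y)
    rw [h, finrank_bot] at h1
    omega
  have hdet : ∀ v : E3, v ≠ 0 →
      LinearMap.det ((Submodule.span ℝ {v})ᗮ.reflection : E3 →ₗ[ℝ] E3) = -1 := fun v hv => by
    have := (Submodule.span ℝ {v})ᗮ.det_reflection
    rw [Submodule.orthogonal_orthogonal, finrank_span_singleton hv, pow_one] at this
    exact this
  refine ⟨(Submodule.span ℝ {(x : E3) - y})ᗮ.reflection.trans (Submodule.span ℝ {z})ᗮ.reflection,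
    ?_, ?_⟩
  · have : ((((Submodule.span ℝ {(x : E3) - y})ᗮ.reflection.trans
        (Submodule.span ℝ {z})ᗮ.reflection : E3 ≃ₗᵢ[ℝ] E3)) : E3 →ₗ[ℝ] E3) =
        ((Submodule.span ℝ {z})ᗮ.reflection : E3 →ₗ[ℝ] E3) ∘ₗ
          ((Submodule.span ℝ {(x : E3) - y})ᗮ.reflection : E3 →ₗ[ℝ] E3) := rfl
    rw [this, LinearMap.det_comp, hdet _ hz0, hdet _ hxy']
    norm_num
  · refine Subtype.ext ?_
    change (Submodule.span ℝ {z})ᗮ.reflection ((Submodule.span ℝ {(x : E3) - y})ᗮ.reflection (x : E3))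
      = y
    rw [Submodule.reflection_sub hn]
    refine Submodule.reflection_mem_subspace_eq_self ?_
    rw [Submodule.mem_orthogonal_singleton_iff_inner_right] at hz ⊢
    rw [real_inner_comm]; exact hz

variable {Ω : Type*} [mΩ : MeasurableSpace Ω] {P : Measure Ω} [IsProbabilityMeasure P]
  {T : S2 → Ω → ℝ}

namespace IsIsotropicGaussianField

variable (hT : IsIsotropicGaussianField T P)
include hT

lemma sigmaField_le : sigmaField T ≤ mΩ := iSup_le fun x => (hT.measurable x).comap_le

lemma measurable_withSigma :
    Measurable fun p : S2 × WithSigma Ω (sigmaField T) => T p.1 p.2 := hT.measurable_joint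

lemma measurable_uncurry : Measurable fun p : S2 × Ω => T p.1 p.2 :=
  hT.measurable_withSigma.comp
    (measurable_fst.prodMk ((measurable_toSigma hT.sigmaField_le).comp measurable_snd))

lemma measurable_section (ω : Ω) : Measurable fun x => T x ω :=
  hT.measurable_uncurry.comp (measurable_id.prodMk measurable_const)

lemma memLp (x : S2) : MemLp (T x) 2 P := (hT.gaussian.hasGaussianLaw_eval x).memLp_two

/-- Isotropy together with the transitivity of SO(3) makes the variance constant, so it is
integrable over the sphere. -/
lemma integral_sq_eq (x y : S2) : ∫ ω, T x ω ^ 2 ∂P = ∫ ω, T y ω ^ 2 ∂P := by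
  obtain ⟨g, hg, rfl⟩ := exists_rotation x y
  have h := (hT.isotropic g hg).comp (u := fun f : S2 → ℝ => f x ^ 2)
    ((measurable_pi_apply x).pow_const 2)
  exact h.integral_eq.symm

lemma integrable_prod_sq : Integrable (fun p : S2 × Ω => T p.1 p.2 ^ 2) (sphMeasure.prod P) := by
  rw [integrable_prod_iff (hT.measurable_uncurry.pow_const 2).aestronglyMeasurable]
  refine ⟨Eventually.of_forall fun x => (hT.memLp x).integrable_sq, ?_⟩
  obtain ⟨x₀⟩ : Nonempty S2 := (NormedSpace.sphere_nonempty.2 zero_le_one).to_subtype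
  refine (integrable_const (∫ ω, T x₀ ω ^ 2 ∂P)).congr (Eventually.of_forall fun x => ?_)
  simp only [Real.norm_eq_abs, abs_pow, sq_abs]
  exact hT.integral_sq_eq _ _

lemma ae_memLp : ∀ᵐ ω ∂P, MemLp (fun x => T x ω) 2 sphMeasure := by
  filter_upwards [hT.integrable_prod_sq.prod_left_ae] with ω hω
  exact (memLp_two_iff_integrable_sq (hT.measurable_section ω).aestronglyMeasurable).2 hω

lemma integrable_prod_mul {k : S2 → ℝ} (hk : Continuous k) {v : Ω → ℝ} (hv : MemLp v 2 P) :
    Integrable (fun p : S2 × Ω => v p.2 * (k p.1 * T p.1 p.2)) (sphMeasure.prod P) := by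
  have hT2 : MemLp (fun p : S2 × Ω => T p.1 p.2) 2 (sphMeasure.prod P) :=
    (memLp_two_iff_integrable_sq hT.measurable_uncurry.aestronglyMeasurable).2 hT.integrable_prod_sq
  have hv2 : MemLp (fun p : S2 × Ω => v p.2) 2 (sphMeasure.prod P) := hv.comp_snd _
  obtain ⟨K, hK⟩ := isCompact_univ.exists_bound_of_continuousOn hk.continuousOn
  have h : Integrable (fun p : S2 × Ω => k p.1 * (v p.2 * T p.1 p.2)) (sphMeasure.prod P) :=
    (hv2.integrable_mul hT2).bdd_mul (c := K)
      (hk.measurable.comp measurable_fst).aestronglyMeasurable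
      (Eventually.of_forall fun p => hK p.1 trivial)
  refine h.congr (Eventually.of_forall fun p => ?_)
  ring

/-- A weighted integral of the field belongs to its closed linear span. -/
lemma toLp_integral_mem_closedSpan {k : S2 → ℝ} (hk : Continuous k)
    (hZ : MemLp (fun ω => ∫ y, k y * T y ω ∂sphMeasure) 2 P) :
    hZ.toLp _ ∈ closedSpan hT.memLp := by
  set W := closedSpan hT.memLp with hW
  have hWc : IsClosed (W : Set (Lp ℝ 2 P)) := Submodule.isClosed_topologicalClosure _
  have : CompleteSpace W := hWc.completeSpace_coe
  -- A closed subspace is its double orthogonal complement. A variable v orthogonal to every T(y) is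
  -- orthogonal to the weighted integral by Fubini.
  rw [← W.orthogonal_orthogonal, Submodule.mem_orthogonal]
  intro v hv
  have h1 : ∀ y, ∫ ω, v ω * T y ω ∂P = 0 := fun y => by
    have h := (Submodule.mem_orthogonal W v).1 hv ((hT.memLp y).toLp (T y))
      (Submodule.le_topologicalClosure _ (Submodule.subset_span ⟨y, rfl⟩))
    rw [L2.inner_def] at h
    rw [← h]
    refine integral_congr_ae ?_
    filter_upwards [(hT.memLp y).coeFn_toLp] with ω hω
    rw [hω]
    simp
  rw [L2.inner_def]
  have h2 : ∫ ω, inner ℝ (v ω) (hZ.toLp _ ω) ∂P =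
      ∫ ω, ∫ y, v ω * (k y * T y ω) ∂sphMeasure ∂P := by
    refine integral_congr_ae ?_
    filter_upwards [hZ.coeFn_toLp] with ω hω
    rw [hω, integral_const_mul]
    simp [mul_comm]
  rw [h2, ← integral_integral_swap (f := fun y ω => v ω * (k y * T y ω))
    (hT.integrable_prod_mul hk (Lp.memLp v))]
  simp only [mul_left_comm _ (k _), integral_const_mul, h1, mul_zero, integral_zero]

/-- Cauchy–Schwarz on the sphere bounds the square by ‖k‖² ∫ T², whose expectation is finite. -/
lemma memLp_integral {k : S2 → ℝ} (hk : Continuous k) :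
    MemLp (fun ω => ∫ y, k y * T y ω ∂sphMeasure) 2 P := by
  obtain ⟨K, hK⟩ := isCompact_univ.exists_bound_of_continuousOn hk.continuousOn
  have hm : StronglyMeasurable fun ω => ∫ y, k y * T y ω ∂sphMeasure :=
    StronglyMeasurable.integral_prod_left' (f := fun p : S2 × Ω => k p.1 * T p.1 p.2)
      ((hk.measurable.comp measurable_fst).mul hT.measurable_uncurry).stronglyMeasurable
  rw [memLp_two_iff_integrable_sq hm.aestronglyMeasurable]
  have hi : Integrable (fun ω => (∫ y, ‖k y‖ ^ 2 ∂sphMeasure) * ∫ y, T y ω ^ 2 ∂sphMeasure) P :=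
    (hT.integrable_prod_sq.integral_prod_right).const_mul _
  refine hi.mono' (hm.aestronglyMeasurable.pow 2) ?_
  filter_upwards [hT.ae_memLp] with ω hω
  have hk2 := memLp_of_continuous hk (p := 2)
  have h1 : ∫ y, k y * T y ω ∂sphMeasure = inner ℝ (hk2.toLp k) (hω.toLp _) := by
    rw [L2.inner_def]
    refine integral_congr_ae ?_
    filter_upwards [hk2.coeFn_toLp, hω.coeFn_toLp] with y h1 h2
    rw [h1, h2]
    simp [mul_comm]
  have h2 : ∀ {f : S2 → ℝ} (hf : MemLp f 2 sphMeasure), ‖hf.toLp f‖ ^ 2 = ∫ y, f y ^ 2 ∂sphMeasure := by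
    intro f hf
    rw [← real_inner_self_eq_norm_sq, L2.inner_def]
    refine integral_congr_ae ?_
    filter_upwards [hf.coeFn_toLp] with y h1
    rw [h1]
    simp [sq]
  simp only [Real.norm_eq_abs, sq_abs]
  rw [abs_of_nonneg (sq_nonneg _), h1, ← h2 hk2, ← h2 hω, ← mul_pow, ← sq_abs]
  exact pow_le_pow_left₀ (abs_nonneg _) (abs_real_inner_le_norm _ _) 2

end IsIsotropicGaussianField

end Field

/-! ### The solution field and its representations -/

section Solution

set_option linter.unusedSectionVars false

/-- A zonal kernel operator is the diagonal operator with the same multipliers. -/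
lemma diagOp_ae_eq_kernelOp (H : HasHeatKernel) {a : ℕ → ℝ} (ha : KernelSummable a) {C : ℝ}
    (hC : ∀ l, |a l| ≤ C) (f : L2S) :
    ((diagOp sphEigenspace a f : L2S) : S2 → ℝ) =ᵐ[sphMeasure] kernelOp a f := by
  have hV := isOrthogonalDecomposition_sphEigenspace H
  have hm := memLp_of_continuous (continuous_kernelOp ha f.integrable) (p := 2)
  suffices h : diagOp sphEigenspace a f = hm.toLp _ by rw [h]; exact hm.coeFn_toLp
  refine hV.ext fun l => ?_
  rw [hV.starProjection_diagOp hC, starProjection_sphEigenspace H, starProjection_sphEigenspace H]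
  refine L2S.ext_sphCoeff fun k m hkm => ?_
  rw [sphCoeff_zonalOp _ _ _ _ hkm, sphCoeff_congr hm.coeFn_toLp,
    sphCoeff_kernelOp ha f.integrable k m hkm, sphCoeff_congr (Lp.coeFn_smul _ _)]
  have h1 : sphCoeff (a l • (zonalOp l f : S2 → ℝ)) k m = a l * sphCoeff (zonalOp l f) k m := by
    simp only [sphCoeff, Pi.smul_apply, smul_eq_mul, Complex.ofReal_mul, mul_assoc]
    rw [integral_const_mul]
  rw [h1, sphCoeff_zonalOp _ _ _ _ hkm]
  split_ifs with h
  · rw [h]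
  · rw [mul_zero]

lemma kernelOp_congr {a : ℕ → ℝ} {f g : S2 → ℝ} (h : f =ᵐ[sphMeasure] g) (x : S2) :
    kernelOp a f x = kernelOp a g x := by
  refine integral_congr_ae ?_
  filter_upwards [h] with y hy
  rw [hy]

lemma lintegral_enorm_sq_L2S (g : L2S) : ∫⁻ x, ‖g x‖ₑ ^ 2 ∂sphMeasure = ‖g‖ₑ ^ 2 := by
  have h := eLpNorm_nnreal_pow_eq_lintegral (f := g) (μ := sphMeasure) (p := 2) (by norm_num)
  rw [Lp.enorm_def]
  simpa using h.symm

/-- The image of the field under the subordinate heat semigroup. -/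
noncomputable def heatField {Ω : Type*} (α : ℝ) (T : S2 → Ω → ℝ) (t : ℝ≥0) (x : S2) (ω : Ω) : ℝ :=
  -- At `t = 0` all coefficients are 1 and `KernelSummable` fails. The separate value makes η_0 = T
  -- hold at every point, not merely almost everywhere.
  if t = 0 then T x ω
  else kernelOp (fun l => Real.exp (-(t * sphEigenvalue l ^ α))) (fun y => T y ω) x

variable {Ω : Type*} [mΩ : MeasurableSpace Ω] {P : Measure Ω} [IsProbabilityMeasure P]
  {T : S2 → Ω → ℝ} {α : ℝ}

lemma coe_pos_of_ne_zero {t : ℝ≥0} (ht : t ≠ 0) : (0 : ℝ) < t := NNReal.coe_pos.2 (pos_iff_ne_zero.2 ht)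

/-- The field at `t` is the solution of the fractional heat equation from `T`. -/
lemma fracHeat_ae_eq_heatField (H : HasHeatKernel) (hα₀ : 0 < α) {ω : Ω}
    (hω : MemLp (fun x => T x ω) 2 sphMeasure) (t : ℝ≥0) :
    (fracHeat α (hω.toLp _) t : S2 → ℝ) =ᵐ[sphMeasure] fun x => heatField α T t x ω := by
  by_cases ht : t = 0
  · subst ht
    rw [NNReal.coe_zero, fracHeat_zero (isOrthogonalDecomposition_sphEigenspace H)]
    simpa [heatField] using hω.coeFn_toLp
  · refine (diagOp_ae_eq_kernelOp H (kernelSummable_exp hα₀ (coe_pos_of_ne_zero ht)) (C := 1)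
      (fun l => abs_exp_neg_le_one (mul_nonneg t.coe_nonneg (sphEigenvalue_rpow_nonneg l)))
      (hω.toLp _)).trans (Eventually.of_forall fun x => ?_)
    simp only [heatField, if_neg ht]
    exact kernelOp_congr hω.coeFn_toLp x

lemma isFracHeatSolution_heatField (H : HasHeatKernel) (hα₀ : 0 < α) (hα₁ : α < 1) {ω : Ω}
    (hω : MemLp (fun x => T x ω) 2 sphMeasure) :
    IsFracHeatSolution α (fun x => T x ω) fun t x => heatField α T t x ω := by
  have hV := isOrthogonalDecomposition_sphEigenspace H
  refine ⟨fracHeat α (hω.toLp _), fracHeat_ae_eq_heatField H hα₀ hω, ?_,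
    continuousOn_fracHeat hV _, fun t ht => ⟨_, hasFracLaplacian_fracHeat hV hα₀ hα₁ ht _,
      hasDerivAt_fracHeat hV ht _⟩⟩
  rw [fracHeat_zero hV]
  exact hω.coeFn_toLp

lemma IsFracHeatSolution.ae_eq_heatField (H : HasHeatKernel) (hα₀ : 0 < α) (hα₁ : α < 1) {ω : Ω}
    (hω : MemLp (fun x => T x ω) 2 sphMeasure) {v : ℝ≥0 → S2 → ℝ}
    (hv : IsFracHeatSolution α (fun x => T x ω) v) (t : ℝ≥0) :
    v t =ᵐ[sphMeasure] fun x => heatField α T t x ω := by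
  obtain ⟨u, h1, h2, h3, h4⟩ := hv
  have h := eq_fracHeat_of_hasDerivAt (isOrthogonalDecomposition_sphEigenspace H) hα₀ hα₁
    (Lp.ext (h2.trans hω.coeFn_toLp.symm)) h3 h4 t.coe_nonneg
  refine (h1 t).symm.trans ?_
  rw [h]
  exact fracHeat_ae_eq_heatField H hα₀ hω t

namespace IsIsotropicGaussianField

variable (hT : IsIsotropicGaussianField T P)
include hT

/-- Joint measurability is kept relative to the σ-field of T rather than the ambient one, as the
conditional expectation requires. -/
lemma measurable_kernelOp {a : ℕ → ℝ} (ha : KernelSummable a) :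
    Measurable fun p : S2 × WithSigma Ω (sigmaField T) => kernelOp a (fun y => T y p.2) p.1 := by
  have hk : Measurable fun q : (S2 × WithSigma Ω (sigmaField T)) × S2 =>
      sumKernel a q.1.1 q.2 * T q.2 q.1.2 :=
    ((continuous_sumKernel ha).measurable.comp
      ((measurable_fst.comp measurable_fst).prodMk measurable_snd)).mul
      (hT.measurable_withSigma.comp (measurable_snd.prodMk (measurable_snd.comp measurable_fst)))
  exact (hk.stronglyMeasurable.integral_prod_right' (ν := sphMeasure)).measurable

lemma measurable_heatField_withSigma (hα₀ : 0 < α) (t : ℝ≥0) :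
    Measurable fun p : S2 × WithSigma Ω (sigmaField T) => heatField α T t p.1 p.2 := by
  by_cases ht : t = 0
  · simpa only [heatField, if_pos ht] using hT.measurable_withSigma
  · simpa only [heatField, if_neg ht] using
      hT.measurable_kernelOp (kernelSummable_exp hα₀ (coe_pos_of_ne_zero ht))

lemma measurable_of_withSigma {f : S2 → Ω → ℝ}
    (hf : Measurable fun p : S2 × WithSigma Ω (sigmaField T) => f p.1 p.2) :
    Measurable fun p : S2 × Ω => f p.1 p.2 :=
  hf.comp (measurable_fst.prodMk ((measurable_toSigma hT.sigmaField_le).comp measurable_snd))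

lemma memLp_heatField (hα₀ : 0 < α) (t : ℝ≥0) (x : S2) : MemLp (heatField α T t x) 2 P := by
  by_cases ht : t = 0
  · have h : heatField α T t x = T x := funext fun ω => if_pos ht
    rw [h]
    exact hT.memLp x
  · have h : heatField α T t x = fun ω => kernelOp _ (fun y => T y ω) x := funext fun ω => if_neg ht
    rw [h]
    exact hT.memLp_integral
      (continuous_sumKernel_right (kernelSummable_exp hα₀ (coe_pos_of_ne_zero ht)) x)

lemma isGaussianProcess_heatField (hα₀ : 0 < α) :
    IsGaussianProcess (fun (p : ℝ≥0 × S2) ω => heatField α T p.1 p.2 ω) P := by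
  refine isGaussianProcess_of_mem_closedSpan hT.gaussian hT.mean_zero hT.memLp
    (fun p => hT.memLp_heatField hα₀ p.1 p.2) fun p => ?_
  by_cases ht : p.1 = 0
  · have : (hT.memLp_heatField hα₀ p.1 p.2).toLp _ = (hT.memLp p.2).toLp (T p.2) := by
      congr 1
      funext ω
      simp only [heatField, if_pos ht]
    rw [this]
    exact Submodule.le_topologicalClosure _ (Submodule.subset_span ⟨p.2, rfl⟩)
  · have hk := continuous_sumKernel_right (kernelSummable_exp hα₀ (coe_pos_of_ne_zero ht)) p.2
    have : (hT.memLp_heatField hα₀ p.1 p.2).toLp _ = (hT.memLp_integral hk).toLp _ := by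
      congr 1
      funext ω
      simp only [heatField, if_neg ht]
      rfl
    rw [this]
    exact hT.toLp_integral_mem_closedSpan hk _

/-- For each realization in L² the error is the squared norm of a diagonal operator with multipliers
tending to 0, so it tends to 0; dominated convergence handles the expectation. -/
lemma tendsto_series (H : HasHeatKernel) (hα₀ : 0 < α) (t : ℝ≥0) : Tendsto
    (fun L : ℕ => ∫⁻ ω, ∫⁻ x, ‖(heatField α T t x ω : ℂ) - ∑ l ∈ Finset.range (L + 1),
      (Real.exp (-(t * sphEigenvalue l ^ α)) : ℂ) *
        sphComponent (fun y => T y ω) l x‖ₑ ^ 2 ∂sphMeasure ∂P) atTop (𝓝 0) := by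
  have hV := isOrthogonalDecomposition_sphEigenspace H
  set c : ℕ → ℝ := fun l => Real.exp (-(t * sphEigenvalue l ^ α)) with hc
  have hc1 : ∀ l, |c l| ≤ 1 := fun l =>
    abs_exp_neg_le_one (mul_nonneg t.coe_nonneg (sphEigenvalue_rpow_nonneg l))
  -- The partial sum is the diagonal operator with the multipliers cut off after degree `L`.
  set b : ℕ → ℕ → ℝ := fun L l => if l < L + 1 then c l else 0 with hb
  have hb1 : ∀ L l, |b L l| ≤ 1 := fun L l => by
    simp only [hb]
    split_ifs
    · exact hc1 l
    · simp
  set R : ℕ → Ω → S2 → ℝ := fun L ω x => heatField α T t x ω - ∑ l ∈ Finset.range (L + 1),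
    c l * kernelOp (fun k => if k = l then 1 else 0) (fun y => T y ω) x with hR
  have hRm : ∀ L, Measurable fun p : S2 × Ω => R L p.2 p.1 := fun L =>
    (hT.measurable_of_withSigma (hT.measurable_heatField_withSigma hα₀ t)).sub
      (Finset.measurable_fun_sum _ fun l _ => (hT.measurable_of_withSigma
        (f := fun x ω => kernelOp _ (fun y => T y ω) x)
        (hT.measurable_kernelOp (kernelSummable_single l))).const_mul _)
  have hpart : ∀ (L : ℕ) (f : L2S), ((diagOp sphEigenspace (b L) f : L2S) : S2 → ℝ) =ᵐ[sphMeasure] fun x =>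
      ∑ l ∈ Finset.range (L + 1), c l * kernelOp (fun k => if k = l then 1 else 0) f x := by
    intro L f
    have h1 : diagOp sphEigenspace (b L) f = ∑ l ∈ Finset.range (L + 1), c l • zonalOp l f := by
      rw [diagOp, tsum_eq_sum (s := Finset.range (L + 1))]
      · refine Finset.sum_congr rfl fun l hl => ?_
        rw [starProjection_sphEigenspace H]
        simp only [hb, if_pos (Finset.mem_range.1 hl)]
      · intro l hl
        simp only [hb, if_neg (fun h => hl (Finset.mem_range.2 h)), zero_smul]
    have h2 : ∀ᵐ x ∂sphMeasure, ∀ l, (c l • zonalOp l f) x =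
        c l * kernelOp (fun k => if k = l then 1 else 0) f x := by
      rw [ae_all_iff]
      intro l
      filter_upwards [Lp.coeFn_smul (c l) (zonalOp l f), coeFn_zonalOp l f] with x h1 h2
      rw [h1, Pi.smul_apply, h2, smul_eq_mul]
    rw [h1]
    filter_upwards [h2, Lp.coeFn_finsetSum (Finset.range (L + 1)) fun l => c l • zonalOp l f]
      with x h2 h3
    rw [h3, Finset.sum_apply]
    exact Finset.sum_congr rfl fun l _ => h2 l
  have hRe : ∀ {ω} (hω : MemLp (fun x => T x ω) 2 sphMeasure) (L : ℕ),
      ∫⁻ x, ‖R L ω x‖ₑ ^ 2 ∂sphMeasure =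
        ‖fracHeat α (hω.toLp _) t - diagOp sphEigenspace (b L) (hω.toLp _)‖ₑ ^ 2 := by
    intro ω hω L
    rw [← lintegral_enorm_sq_L2S]
    refine lintegral_congr_ae ?_
    filter_upwards [Lp.coeFn_sub (fracHeat α (hω.toLp _) t)
      (diagOp sphEigenspace (b L) (hω.toLp _)), fracHeat_ae_eq_heatField H hα₀ hω t,
      hpart L (hω.toLp _)] with x h1 h2 h3
    rw [h1, Pi.sub_apply, h2, h3]
    simp only [hR, kernelOp_congr hω.coeFn_toLp]
  have hgood : ∀ᵐ ω ∂P, ∀ L : ℕ, ∫⁻ x, ‖(heatField α T t x ω : ℂ) - ∑ l ∈ Finset.range (L + 1),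
      (Real.exp (-(t * sphEigenvalue l ^ α)) : ℂ) *
        sphComponent (fun y => T y ω) l x‖ₑ ^ 2 ∂sphMeasure = ∫⁻ x, ‖R L ω x‖ₑ ^ 2 ∂sphMeasure := by
    filter_upwards [hT.ae_memLp] with ω hω L
    refine lintegral_congr fun x => ?_
    have h1 : (heatField α T t x ω : ℂ) - ∑ l ∈ Finset.range (L + 1),
        (Real.exp (-(t * sphEigenvalue l ^ α)) : ℂ) * sphComponent (fun y => T y ω) l x =
        ((R L ω x : ℝ) : ℂ) := by
      simp only [hR, sphComponent_eq (hω.integrable (by norm_num)), Complex.ofReal_sub,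
        Complex.ofReal_sum, Complex.ofReal_mul, hc]
    rw [h1]
    congr 1
    exact enorm_eq_iff_norm_eq.2 (Complex.norm_real _)
  -- The factor 4 = (1 + 1)² comes from |c_l - b_l| ≤ 1 + 1.
  have hbound : ∫⁻ ω, 4 * ∫⁻ x, ‖T x ω‖ₑ ^ 2 ∂sphMeasure ∂P ≠ ∞ := by
    have hm : Measurable fun p : S2 × Ω => ‖T p.1 p.2‖ₑ ^ 2 := hT.measurable_uncurry.enorm.pow_const 2
    rw [lintegral_const_mul _ hm.lintegral_prod_left']
    refine ENNReal.mul_ne_top (by norm_num) ?_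
    rw [← lintegral_prod_symm' _ hm]
    have := hT.integrable_prod_sq.hasFiniteIntegral
    simpa [HasFiniteIntegral, enorm_pow] using this.ne
  have key := tendsto_lintegral_of_dominated_convergence' (μ := P)
    (F := fun L ω => ∫⁻ x, ‖(heatField α T t x ω : ℂ) - ∑ l ∈ Finset.range (L + 1),
      (Real.exp (-(t * sphEigenvalue l ^ α)) : ℂ) *
        sphComponent (fun y => T y ω) l x‖ₑ ^ 2 ∂sphMeasure) (f := fun _ => 0)
    (fun ω => 4 * ∫⁻ x, ‖T x ω‖ₑ ^ 2 ∂sphMeasure) (fun L => ?_) (fun L => ?_) hbound ?_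
  · simpa using key
  · refine ⟨fun ω => ∫⁻ x, ‖R L ω x‖ₑ ^ 2 ∂sphMeasure,
      ((hRm L).enorm.pow_const 2).lintegral_prod_left', ?_⟩
    filter_upwards [hgood] with ω hω
    exact hω L
  · filter_upwards [hgood, hT.ae_memLp] with ω hω hm
    rw [hω L, hRe hm L, fracHeat, hV.diagOp_sub hc1 (hb1 L)]
    have h1 := hV.norm_diagOp_le (C := 1 + 1) (fun l => (abs_sub _ _).trans
      (add_le_add (hc1 l) (hb1 L l))) (hm.toLp _)
    have h2 : ∫⁻ x, ‖T x ω‖ₑ ^ 2 ∂sphMeasure = ‖hm.toLp (fun x => T x ω)‖ₑ ^ 2 := by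
      rw [← lintegral_enorm_sq_L2S]
      refine lintegral_congr_ae ?_
      filter_upwards [hm.coeFn_toLp] with x hx
      rw [hx]
    rw [h2]
    have h3 : ‖diagOp sphEigenspace (fun l => c l - b L l) (hm.toLp _)‖ₑ ≤
        2 * ‖hm.toLp (fun x => T x ω)‖ₑ := by
      have h4 : ENNReal.ofReal ((1 + 1) * ‖hm.toLp (fun x => T x ω)‖) =
          2 * ENNReal.ofReal ‖hm.toLp (fun x => T x ω)‖ := by
        rw [ENNReal.ofReal_mul (by norm_num), one_add_one_eq_two, ENNReal.ofReal_ofNat]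
      rw [← ofReal_norm, ← ofReal_norm, ← h4]
      exact ENNReal.ofReal_le_ofReal h1
    refine (pow_le_pow_left' h3 2).trans (le_of_eq ?_)
    rw [mul_pow]
    norm_num
  · filter_upwards [hgood, hT.ae_memLp] with ω hω hm
    simp only [hω, hRe hm]
    have h1 : Tendsto (fun L => diagOp sphEigenspace (b L) (hm.toLp _)) atTop
        (𝓝 (fracHeat α (hm.toLp _) t)) := by
      refine hV.tendsto_diagOp (Eventually.of_forall hb1) hc1 (fun l => ?_) _
      refine tendsto_const_nhds.congr' ?_
      filter_upwards [eventually_ge_atTop l] with L hL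
      simp only [hb, if_pos (Nat.lt_succ_of_le hL)]
    have h2 := (tendsto_const_nhds (x := fracHeat α (hm.toLp _) t)).sub h1
    rw [sub_self] at h2
    have h3 := ((ENNReal.continuous_pow 2).comp continuous_enorm).tendsto (0 : L2S)
    simp only [Function.comp_apply, enorm_zero, ne_eq, OfNat.ofNat_ne_zero, not_false_eq_true,
      zero_pow] at h3
    exact h3.comp h2

end IsIsotropicGaussianField

end Solution

/-! ### Semigroup and conditional expectation representations. -/

section Representation

set_option linter.unusedSectionVars false

variable {Ω : Type*} [mΩ : MeasurableSpace Ω] {P : Measure Ω} [IsProbabilityMeasure P]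
  {T : S2 → Ω → ℝ} {α : ℝ} {x : S2} {B : ℝ≥0 → Ω → S2} {D : ℝ≥0 → Ω → ℝ≥0}

lemma IsRotationalBrownianMotion.measurable_subordinate (hB : IsRotationalBrownianMotion x B P)
    (hD : IsStableSubordinator α D P) (t : ℝ≥0) : Measurable (subordinate B D t) :=
  measurable_subordinate_of hB.measurable hB.continuous hD.measurable t

lemma subordinate_zero_ae_eq (hB : IsRotationalBrownianMotion x B P)
    (hD : IsStableSubordinator α D P) : ∀ᵐ ω ∂P, subordinate B D 0 ω = x := by
  filter_upwards [hB.start, hD.start] with ω h1 h2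
  rw [subordinate, h2, h1]

/-- The transition semigroup of the subordinate Brownian motion has a zonal kernel. -/
lemma integrable_and_integral_subordinate (hα₀ : 0 < α) (hB : IsRotationalBrownianMotion x B P)
    (hD : IsStableSubordinator α D P) (hind : Indep (sigmaField B) (sigmaField D) P)
    {t : ℝ≥0} (ht : t ≠ 0) {f : S2 → ℝ} (hf : Integrable f sphMeasure) (hfm : Measurable f) :
    Integrable (fun ω => f (subordinate B D t ω)) P ∧ ∫ ω, f (subordinate B D t ω) ∂P =
      kernelOp (fun l => Real.exp (-(t * sphEigenvalue l ^ α))) f x := by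
  have hY := hB.measurable_subordinate hD t
  have : IsProbabilityMeasure (P.map (subordinate B D t)) :=
    Measure.isProbabilityMeasure_map hY.aemeasurable
  have h := integrable_and_integral_of_integral_sphHarmonic
    (kernelSummable_exp hα₀ (coe_pos_of_ne_zero ht)) x (P.map (subordinate B D t))
    (fun l m _ => integral_sphHarmonic_of_eigenfunction hY (fun f h1 h2 =>
      integral_subordinate_eigenfunction hB hD hind h1 (sphEigenvalue_nonneg l) h2 t) m) hf
  rw [integrable_map_measure hfm.aestronglyMeasurable hY.aemeasurable,
    integral_map hY.aemeasurable hfm.aestronglyMeasurable] at h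
  exact h

namespace IsIsotropicGaussianField

variable (hT : IsIsotropicGaussianField T P)
include hT

/-- For t > 0 the law of B_{D_t} has the bounded zonal density, so any realization in L² can be
integrated against it. At t = 0 the point is almost surely x itself. -/
lemma ae_heatField_eq_integral (hα₀ : 0 < α) (hB : IsRotationalBrownianMotion x B P)
    (hD : IsStableSubordinator α D P) (hind : Indep (sigmaField B) (sigmaField D) P) (t : ℝ≥0) :
    ∀ᵐ ω ∂P, Integrable (fun ω' => T (subordinate B D t ω') ω) P ∧
      heatField α T t x ω = ∫ ω', T (subordinate B D t ω') ω ∂P := by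
  by_cases ht : t = 0
  · subst ht
    refine Eventually.of_forall fun ω => ?_
    have h : (fun ω' => T (subordinate B D 0 ω') ω) =ᵐ[P] fun _ => T x ω := by
      filter_upwards [subordinate_zero_ae_eq hB hD] with ω' h
      rw [h]
    refine ⟨(integrable_const _).congr h.symm, ?_⟩
    rw [integral_congr_ae h]
    simp [heatField]
  · filter_upwards [hT.ae_memLp] with ω hω
    have h := integrable_and_integral_subordinate hα₀ hB hD hind ht (hω.integrable (by norm_num))
      (hT.measurable_section ω)
    refine ⟨h.1, ?_⟩
    rw [h.2, heatField, if_neg ht]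

lemma integral_abs_eq (x y : S2) : ∫ ω, |T x ω| ∂P = ∫ ω, |T y ω| ∂P := by
  obtain ⟨g, hg, rfl⟩ := exists_rotation x y
  have h := (hT.isotropic g hg).comp (u := fun f : S2 → ℝ => |f x|)
    (measurable_abs.comp (measurable_pi_apply x))
  exact h.integral_eq.symm

/-- Under the product law the inner integral is E|T(y)|, which isotropy makes independent of y. -/
lemma integrable_comp {Y : Ω → S2} (hY : Measurable Y)
    (hind : IndepFun (toSigma (sigmaField T)) Y P) : Integrable (fun ω => T (Y ω) ω) P := by
  have hF : Measurable fun q : WithSigma Ω (sigmaField T) × S2 => T q.2 q.1 :=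
    hT.measurable_withSigma.comp measurable_swap
  have hs := measurable_toSigma hT.sigmaField_le
  refine (hind.integrable_comp_iff hs hY hF.stronglyMeasurable).2 ?_
  have : IsProbabilityMeasure (P.map Y) := Measure.isProbabilityMeasure_map hY.aemeasurable
  have : IsProbabilityMeasure (P.map (toSigma (sigmaField T))) :=
    Measure.isProbabilityMeasure_map hs.aemeasurable
  have hTm : ∀ y, Measurable fun w : WithSigma Ω (sigmaField T) => T y w := fun y =>
    hF.comp (measurable_id.prodMk measurable_const)
  obtain ⟨x⟩ : Nonempty S2 := (NormedSpace.sphere_nonempty.2 zero_le_one).to_subtype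
  rw [integrable_prod_iff' hF.aestronglyMeasurable]
  refine ⟨Eventually.of_forall fun y => ?_, ?_⟩
  · rw [integrable_map_measure (hTm y).aestronglyMeasurable hs.aemeasurable]
    exact (hT.memLp y).integrable (by norm_num)
  · refine (integrable_const (∫ ω, |T x ω| ∂P)).congr (Eventually.of_forall fun y => ?_)
    simp only
    rw [integral_map hs.aemeasurable (hTm y).norm.aestronglyMeasurable]
    exact hT.integral_abs_eq x y

/-- The conditional expectation of the field at an independent point. -/
lemma condExp_comp {Y : Ω → S2} (hY : Measurable Y)
    (hind : IndepFun (toSigma (sigmaField T)) Y P) {g : Ω → ℝ}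
    (hg : Measurable fun w : WithSigma Ω (sigmaField T) => g w) (hgi : Integrable g P)
    (h : ∀ᵐ ω ∂P, g ω = ∫ ω', T (Y ω') ω ∂P) :
    g =ᵐ[P] P[fun ω => T (Y ω) ω | sigmaField T] := by
  have hi := hT.integrable_comp hY hind
  have hgs : StronglyMeasurable[sigmaField T] g := 
    Measurable.stronglyMeasurable (show Measurable[sigmaField T] g from hg)
  refine ae_eq_condExp_of_forall_setIntegral_eq hT.sigmaField_le hi (fun _ _ _ => hgi.integrableOn)
    (fun A hA _ => ?_) ⟨g, hgs, ae_eq_rfl⟩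
  have hA' := hT.sigmaField_le A hA
  have hA1 : Measurable fun w : WithSigma Ω (sigmaField T) => A.indicator (1 : Ω → ℝ) w :=
    show Measurable[sigmaField T] (A.indicator (1 : Ω → ℝ)) from
      (@measurable_const ℝ Ω _ (sigmaField T) 1).indicator hA
  have hF : Measurable fun q : WithSigma Ω (sigmaField T) × S2 => A.indicator 1 q.1 * T q.2 q.1 :=
    (hA1.comp measurable_fst).mul (hT.measurable_withSigma.comp measurable_swap)
  have e : ∀ (f : Ω → ℝ), (fun ω => A.indicator 1 ω * f ω) = A.indicator f := fun f => by
    funext ω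
    by_cases h : ω ∈ A <;> simp [h]
  -- The indicator of A is measurable for the σ-field of T, so it is frozen together with the field
  -- while the point is averaged.
  have h1 := hind.integral_comp_prodMk (measurable_toSigma hT.sigmaField_le) hY
    hF.stronglyMeasurable (by
      have := hi.indicator hA'
      rw [← e] at this
      exact this)
  have h2 : ∫ ω, A.indicator 1 ω * T (Y ω) ω ∂P =
      ∫ ω, ∫ ω', A.indicator 1 ω * T (Y ω') ω ∂P ∂P := h1
  simp only [integral_const_mul] at h2
  rw [e, e, integral_indicator hA', integral_indicator hA'] at h2
  rw [h2]
  exact setIntegral_congr_ae hA' (h.mono fun ω hω _ => hω)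

end IsIsotropicGaussianField

end Representation

/-! ### Proof of the theorem. -/

theorem corollary1 {Ω : Type*} [MeasurableSpace Ω] (P : Measure Ω) [IsProbabilityMeasure P]
    (α : ℝ) (hα₀ : 0 < α) (hα₁ : α < 1)
    (T : S2 → Ω → ℝ) (hT : IsIsotropicGaussianField T P)
    (B : S2 → ℝ≥0 → Ω → S2) (hB : ∀ x, IsRotationalBrownianMotion x (B x) P)
    (D : ℝ≥0 → Ω → ℝ≥0) (hD : IsStableSubordinator α D P)
    (hindep : ∀ x, iIndep ![sigmaField T, sigmaField (B x), sigmaField D] P) :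
    ∃ η : ℝ≥0 → S2 → Ω → ℝ,
      -- `η` is a measurable random field that solves the Cauchy problem
      (∀ t, Measurable (fun p : S2 × Ω => η t p.1 p.2)) ∧
      (∀ x ω, η 0 x ω = T x ω) ∧
      (∀ᵐ ω ∂P, IsFracHeatSolution α (fun x => T x ω) (fun t x => η t x ω)) ∧
      -- it is the only solution
      (∀ ζ : ℝ≥0 → S2 → Ω → ℝ,
        (∀ᵐ ω ∂P, IsFracHeatSolution α (fun x => T x ω) (fun t x => ζ t x ω)) →
        ∀ᵐ ω ∂P, ∀ t, (fun x => ζ t x ω) =ᵐ[sphMeasure] (fun x => η t x ω)) ∧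
      -- it is Gaussian
      IsGaussianProcess (fun (p : ℝ≥0 × S2) ω => η p.1 p.2 ω) P ∧
      -- it is the sum of the series `∑_l e^{-t μ_l^α} T_l(x)`
      (∀ t : ℝ≥0, Tendsto
        (fun L : ℕ => ∫⁻ ω, ∫⁻ x, ‖(η t x ω : ℂ) - ∑ l ∈ Finset.range (L + 1),
          (Real.exp (-(t * sphEigenvalue l ^ α)) : ℂ) *
            sphComponent (fun y => T y ω) l x‖ₑ ^ 2 ∂sphMeasure ∂P)
        atTop (𝓝 0)) ∧
      -- it is the image of `T` under the transition semigroup of the subordinate Brownian motion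
      (∀ t x, ∀ᵐ ω ∂P, Integrable (fun ω' => T (subordinate (B x) D t ω') ω) P ∧
        η t x ω = ∫ ω', T (subordinate (B x) D t ω') ω ∂P) ∧
      -- it is the conditional expectation of the coordinates-change field given `T`
      (∀ t x, Integrable (timeChangedField T B D t x) P ∧
        η t x =ᵐ[P] P[timeChangedField T B D t x | sigmaField T]) := by
  have H := hasHeatKernel_of_brownian hB
  have hBD : ∀ x, Indep (sigmaField (B x)) (sigmaField D) P := fun x =>
    (hindep x).indep (i := 1) (j := 2) (by decide)
  have hTBD : ∀ x, Indep (sigmaField T) (sigmaField (B x) ⊔ sigmaField D) P := fun x => by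
    have hle : ∀ i, (![sigmaField T, sigmaField (B x), sigmaField D] : Fin 3 → _) i ≤
        ‹MeasurableSpace Ω› := by
      intro i
      fin_cases i
      · exact hT.sigmaField_le
      · exact iSup_le fun t => ((hB x).measurable t).comap_le
      · exact iSup_le fun t => (hD.measurable t).comap_le
    -- Joint independence lets B and D be grouped: T is independent of the pair, hence of B_{D_t},
    -- which pairwise independence would not give.
    have h := indep_iSup_of_disjoint hle (hindep x) (S := {0}) (T := {1, 2}) (by simp)
    rw [iSup_singleton, iSup_pair] at h
    exact h
  have hY : ∀ t x, Measurable (subordinate (B x) D t) := fun t x =>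
    (hB x).measurable_subordinate hD t
  have hYind : ∀ t x, IndepFun (toSigma (sigmaField T)) (subordinate (B x) D t) P := fun t x => by
    refine indepFun_toSigma (indep_of_indep_of_le_right (hTBD x) (Measurable.comap_le ?_))
    refine measurable_subordinate_of (fun s => ?_) (hB x).continuous (fun s => ?_) t
    · exact (comap_measurable (B x s)).mono ((le_iSup (fun s => MeasurableSpace.comap (B x s)
        inferInstance) s).trans le_sup_left) le_rfl
    · exact (comap_measurable (D s)).mono ((le_iSup (fun s => MeasurableSpace.comap (D s)
        inferInstance) s).trans le_sup_right) le_rfl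
  have hrep := fun t x => hT.ae_heatField_eq_integral hα₀ (hB x) hD (hBD x) t
  refine ⟨heatField α T, fun t => ?_, fun x ω => if_pos rfl, ?_, fun ζ hζ => ?_,
    hT.isGaussianProcess_heatField hα₀, hT.tendsto_series H hα₀, hrep, fun t x => ⟨?_, ?_⟩⟩
  · exact hT.measurable_of_withSigma (hT.measurable_heatField_withSigma hα₀ t)
  · filter_upwards [hT.ae_memLp] with ω hω
    exact isFracHeatSolution_heatField H hα₀ hα₁ hω
  · filter_upwards [hζ, hT.ae_memLp] with ω h hω t
    exact h.ae_eq_heatField H hα₀ hα₁ hω t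
  · exact hT.integrable_comp (hY t x) (hYind t x)
  · refine hT.condExp_comp (hY t x) (hYind t x) ?_
      ((hT.memLp_heatField hα₀ t x).integrable (by norm_num)) ((hrep t x).mono fun ω h => h.2)
    exact (hT.measurable_heatField_withSigma hα₀ t).of_uncurry_left (x := x)
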